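/- **Lemma (continuity of the forms).** Let $\hat T$ be the tetrahedron with vertices $(1,1,1),(1,-1,-1),(-1,1,-1),(-1,-1,1)$ and let $V(\hat T)=\operatorname{span}\{1,x_1,x_2,x_3,x_1^2-x_2^2,x_2^2-x_3^2\}$. Let $\mathcal T_h$ be a conforming mesh of $\Omega\subset\mathbb R^3$ by finitely many closed tetrahedra ($\Omega$ is the interior of their union, and any two of them meet in the convex hull of their common vertices), with mesh parameter $h=\max_{T}\operatorname{diam}T$. Let $\mathcal T_h$ be shape regular with constant $\sigma$: each $T$ contains a ball of some radius $\rho>0$ with $\operatorname{diam}T\le\sigma\rho$. Let $V_h$ be the space of $v\in L^2(\Omega)$ such that, for all $T\in\mathcal T_h$, $v|_T\circ F\in V(\hat T)$ with $F:\hat T\to T$ affine and onto, and such that $v$ is continuous at the midpoints of the edges interior to $\Omega$. Put $$W=[H^1_0(\Omega)]^3,\qquad W_h=\{v\in[V_h]^3:\ v=0\text{ at the midpoints of the edges on }\partial\Omega\},\qquad Q=\{q\in L^2(\Omega):\ \textstyle\int_\Omega q=0\}.$$ For $v,w\in W+W_h$ and $q,r\in Q\cap H^1(\Omega)$ let $$a_h(v,w)=\sum_{T\in\mathcal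 T_h}(\nabla v,\nabla w)_T,\qquad b(v,q)=-\sum_{T\in\mathcal T_h}(v,\nabla q)_T,$$ $$A_h((v,q),(w,r))=a_h(v,w)-b(v,r)+b(w,q),$$ where $b(v,q)$ is also equal to $\sum_T\big[(\nabla\cdot v,q)_T-(n\cdot v,q)_{\partial T}\big]$ by integration by parts on each $T$. Let $\|\nabla v\|_\Omega=\|v\|_{a_h}=a_h(v,v)^{1/2}$ (gradients are taken element by element) and $$|||(v,q)|||_h^2=\|v\|_{a_h}^2+\|q\|_\Omega^2+h^2\|\nabla q\|_\Omega^2 ,$$ with $\|\cdot\|_\Omega$ the $L^2(\Omega)$ norm. Then there is a constant $C>0$ that depends only on the shape regularity constant $\sigma$ (in particular not on $h$) such that for all $v,w\in W+W_h$ and all $q,r\in Q\cap H^1(\Omega)$ $$|b(v,q)|\le C\,\|\nabla v\|_\Omega\big(\|q\|_\Omega+h\|\nabla q\|_\Omega\big),$$ $$|A_h((v,q),(w,r))|\le C\,|||(v,q)|||_h\,|||(w,r)|||_h .$$ -/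

import Mathlib

open MeasureTheory Filter Topology
open scoped ContDiff

noncomputable section

namespace RotatedQ1

/-- Three-dimensional Euclidean space. -/
abbrev E3 : Type := EuclideanSpace ℝ (Fin 3)

/-! ### Sobolev spaces -/

/-- `φ` is a test function on `U`, that is `φ ∈ C_c^∞(U)`. -/
def IsTest (U : Set E3) (φ : E3 → ℝ) : Prop :=
  ContDiff ℝ ∞ φ ∧ HasCompactSupport φ ∧ tsupport φ ⊆ U

/-- `f ∈ L²(U)` has the weak gradient `G ∈ L²(U)³` on the open set `U`; in particular
`f ∈ H¹(U)`. -/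
structure HasWeakGrad (U : Set E3) (f : E3 → ℝ) (G : E3 → E3) : Prop where
  memLp_fun : MemLp f 2 (volume.restrict U)
  memLp_grad : MemLp G 2 (volume.restrict U)
  integral_eq : ∀ φ : E3 → ℝ, IsTest U φ → ∀ i : Fin 3,
    ∫ x in U, f x * gradient φ x i = -∫ x in U, G x i * φ x

/-- `f ∈ H¹(U)`. -/
def MemH1 (U : Set E3) (f : E3 → ℝ) : Prop := ∃ G, HasWeakGrad U f G

open Classical in
/-- The weak gradient of `f ∈ H¹(U)` (unique up to null sets of `U`). -/
def weakGrad (U : Set E3) (f : E3 → ℝ) : E3 → E3 :=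
  if h : MemH1 U f then h.choose else 0

/-- `f ∈ H¹₀(U)`: the functions in `H¹(U)` that vanish on `∂U`, as the closure of `C_c^∞(U)`
in `H¹(U)`. -/
def MemH10 (U : Set E3) (f : E3 → ℝ) : Prop :=
  MemH1 U f ∧ ∃ φ : ℕ → E3 → ℝ, (∀ n, IsTest U (φ n)) ∧
    Tendsto (fun n => eLpNorm (f - φ n) 2 (volume.restrict U)) atTop (𝓝 0) ∧
    Tendsto (fun n => eLpNorm (weakGrad U f - gradient (φ n)) 2 (volume.restrict U)) atTop (𝓝 0)

/-- The velocity space `W`: vector fields with components in `H¹(Ω)` that vanish on `∂Ω`. -/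
def MemW (Ω : Set E3) (v : E3 → E3) : Prop := ∀ i : Fin 3, MemH10 Ω (fun x => v x i)

/-- The pressure space `Q`: square integrable functions on `Ω` with mean value zero. -/
def MemQ (Ω : Set E3) (q : E3 → ℝ) : Prop :=
  MemLp q 2 (volume.restrict Ω) ∧ ∫ x in Ω, q x = 0

/-- `‖q‖_Ω`. -/
def normL2 (Ω : Set E3) (q : E3 → ℝ) : ℝ := Real.sqrt (∫ x in Ω, q x ^ 2)

/-- `‖∇q‖_Ω` for `q ∈ H¹(Ω)`. -/
def normGrad (Ω : Set E3) (q : E3 → ℝ) : ℝ := Real.sqrt (∫ x in Ω, ‖weakGrad Ω q x‖ ^ 2)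

/-! ### The rotated `Q₁` element -/

/-- The vertices of the reference tetrahedron inscribed in the cube `[-1,1]³`; its six edges are
diagonals of the six faces of the cube, so that their midpoints are the points `± e_i`. -/
def refVertices : Set E3 := {!₂[1, 1, 1], !₂[1, -1, -1], !₂[-1, 1, -1], !₂[-1, -1, 1]}

/-- The reference shape functions `span {1, x₁, x₂, x₃, x₁² - x₂², x₂² - x₃²}`. -/
def refSpace : Submodule ℝ (E3 → ℝ) :=
  Submodule.span ℝ {fun _ => 1, fun x => x 0, fun x => x 1, fun x => x 2,
    fun x => x 0 ^ 2 - x 1 ^ 2, fun x => x 1 ^ 2 - x 2 ^ 2}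

/-- `p` is a shape function on the tetrahedron with vertex set `T`: `p ∘ F` is a reference shape
function for an affine map `F` of the reference tetrahedron onto that tetrahedron. (The reference
space is invariant under the symmetries of the reference tetrahedron, so that the choice of `F`
does not matter.) -/
def IsShape (T : Finset E3) (p : E3 → ℝ) : Prop :=
  ∃ F : E3 ≃ᵃ[ℝ] E3, F '' refVertices = (T : Set E3) ∧ p ∘ F ∈ refSpace

/-! ### Meshes -/

/-- A conforming mesh of `Ω` by finitely many tetrahedra, each given by its set of four vertices:
two tetrahedra meet in the convex hull of their common vertices, and `Ω` is the interior of the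
union of the (closed) tetrahedra. -/
structure TetMesh (Ω : Set E3) where
  tets : Finset (Finset E3)
  card_eq : ∀ T ∈ tets, T.card = 4
  indep : ∀ T ∈ tets, AffineIndependent ℝ (fun x : T => (x : E3))
  inter_subset : ∀ S ∈ tets, ∀ T ∈ tets,
    convexHull ℝ (S : Set E3) ∩ convexHull ℝ (T : Set E3) ⊆
      convexHull ℝ ((S : Set E3) ∩ (T : Set E3))
  interior_iUnion : interior (⋃ T ∈ tets, convexHull ℝ (T : Set E3)) = Ω

/-- The open tetrahedron with vertex set `T`. -/
def cell (T : Finset E3) : Set E3 := interior (convexHull ℝ (T : Set E3))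

namespace TetMesh

variable {Ω : Set E3}

/-- The mesh parameter `h`, the largest diameter of a tetrahedron. -/
def meshSize (M : TetMesh Ω) : ℝ :=
  sSup ((fun T : Finset E3 => Metric.diam (convexHull ℝ (T : Set E3))) '' (M.tets : Set (Finset E3)))

/-- Shape regularity with constant `σ`: each tetrahedron contains a ball of some radius `ρ > 0`
such that its diameter is at most `σ ρ`. -/
def ShapeRegular (M : TetMesh Ω) (σ : ℝ) : Prop :=
  ∀ T ∈ M.tets, ∃ (c : E3) (ρ : ℝ), 0 < ρ ∧ Metric.ball c ρ ⊆ convexHull ℝ (T : Set E3) ∧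
    Metric.diam (convexHull ℝ (T : Set E3)) ≤ σ * ρ

/-- The element-wise functions `p T` are the restrictions to the tetrahedra of a function
`v ∈ V_h`: they are shape functions and their values agree at the midpoints of all interior
edges. -/
structure IsVhRep (M : TetMesh Ω) (v : E3 → ℝ) (p : Finset E3 → E3 → ℝ) : Prop where
  shape : ∀ T ∈ M.tets, IsShape T (p T)
  ae_eq : ∀ T ∈ M.tets, v =ᵐ[volume.restrict (cell T)] p T
  continuous_mid : ∀ S ∈ M.tets, ∀ T ∈ M.tets, ∀ x y : E3, x ≠ y →
    x ∈ S → y ∈ S → x ∈ T → y ∈ T → midpoint ℝ x y ∈ Ω →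
      p S (midpoint ℝ x y) = p T (midpoint ℝ x y)

/-- The nonconforming velocity space `W_h`: the components are in `V_h` and vanish at the midpoints
of the edges on `∂Ω`. -/
def MemWh (M : TetMesh Ω) (v : E3 → E3) : Prop :=
  ∀ i : Fin 3, ∃ p : Finset E3 → E3 → ℝ, M.IsVhRep (fun x => v x i) p ∧
    ∀ T ∈ M.tets, ∀ x ∈ T, ∀ y ∈ T, x ≠ y → midpoint ℝ x y ∈ frontier Ω →
      p T (midpoint ℝ x y) = 0

/-- The space `W + W_h`. -/
def MemWaddWh (M : TetMesh Ω) (v : E3 → E3) : Prop :=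
  ∃ w wh : E3 → E3, MemW Ω w ∧ M.MemWh wh ∧ v = w + wh

/-! ### Forms and norms -/

/-- `a_h(v, w) = ∑_T (∇v, ∇w)_T`, with the gradients taken on each tetrahedron. -/
def aForm (M : TetMesh Ω) (v w : E3 → E3) : ℝ :=
  ∑ T ∈ M.tets, ∫ x in cell T, ∑ i : Fin 3,
    inner ℝ (weakGrad (cell T) (fun y => v y i) x) (weakGrad (cell T) (fun y => w y i) x)

/-- `b(v, q) = - ∑_T (v, ∇q)_T`. -/
def bForm (M : TetMesh Ω) (v : E3 → E3) (q : E3 → ℝ) : ℝ :=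
  -∑ T ∈ M.tets, ∫ x in cell T, inner ℝ (v x) (weakGrad (cell T) q x)

/-- `A_h((v, q), (w, r)) = a_h(v, w) - b(v, r) + b(w, q)`. -/
def AForm (M : TetMesh Ω) (v : E3 → E3) (q : E3 → ℝ) (w : E3 → E3) (r : E3 → ℝ) : ℝ :=
  M.aForm v w - M.bForm v r + M.bForm w q

/-- The element-wise norm `‖∇v‖_Ω = ‖v‖_{a_h} = a_h(v, v)^{1/2}`. -/
def aNorm (M : TetMesh Ω) (v : E3 → E3) : ℝ := Real.sqrt (M.aForm v v)

/-- `|||(v, q)|||_h`, whose square is `‖v‖_{a_h}² + ‖q‖_Ω² + h² ‖∇q‖_Ω²`. -/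
def tripleNorm (M : TetMesh Ω) (v : E3 → E3) (q : E3 → ℝ) : ℝ :=
  Real.sqrt (M.aNorm v ^ 2 + normL2 Ω q ^ 2 + M.meshSize ^ 2 * normGrad Ω q ^ 2)

end TetMesh

end RotatedQ1

end

namespace RotatedQ1

noncomputable section

section

/-! ### Tetrahedra and barycentric coordinates -/

/-! Cauchy-Schwarz on each cell bounds `a_h`, so everything rests on `b`. Bounding `(v, ∇q)_T`
directly would cost a global Friedrichs constant; the factor `h` is gained by subtracting from `v` a
field whose contribution to `b` sums to zero.

On a tetrahedron `T` with barycentric coordinates `λ_P`, let `m_P` be the mean of `v` over the face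
opposite to `P`. The lowest order Raviart-Thomas interpolant with these face means is `-∑_P
λ_P'(m_P) (x - P)`. Each field `x - P` has flux only through the face opposite to `P`. Hence
integration by parts against `q` leaves the face fluxes `faceInt`, weighted by `λ_P'(m_P)`. Over the
mesh these terms cancel (`sum_faceVec_eq_zero`): on an interior face the means of `v` and of `q`
agree from both sides while the area vectors `vol T • λ_P'` are opposite, and on a boundary face the
mean of `v` is zero.

The cancelling terms may therefore be added to `b`. For a constant field they reproduce the volume
term exactly (`interpolation_identity`), so on each cell only `v` minus its cell mean and the face
means minus the cell mean remain. Poincaré's inequality bounds the first by `diam T ‖∇v‖_T`, the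
divergence identity for `x - P` bounds the second, and shape regularity bounds `λ_P'` by a multiple
of `1 / diam T`. This is `local_estimate`; summation over the cells gives `abs_bForm_le`.

The face means need two inputs. For shape functions, symmetry of the reference tetrahedron shows
that the mean over a face equals the mean of the three edge midpoint values (`faceMean_refTet`), so
midpoint continuity is continuity of face means. For Sobolev functions no trace operator is used: a
face mean is a volume integral of `f` and its gradient. Its agreement from both sides is proved with
a field supported on the two adjacent tetrahedra, contracted into `Ω` and mollified
(`faceMean_eq_of_hasWeakGrad`); its vanishing on the boundary follows from approximation by test
functions. -/

/-- `T` is the vertex set of a nondegenerate tetrahedron. -/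
def IsTet (T : Finset E3) : Prop :=
  T.card = 4 ∧ AffineIndependent ℝ (fun x : T => (x : E3))

lemma IsTet.span_eq_top {T : Finset E3} (h : IsTet T) :
    affineSpan ℝ (Set.range (fun x : T => (x : E3))) = ⊤ := by
  rw [h.2.affineSpan_eq_top_iff_card_eq_finrank_add_one]
  simp [h.1]

/-- The vertices of a tetrahedron as an affine basis of space. -/
def IsTet.basis {T : Finset E3} (h : IsTet T) : AffineBasis T ℝ E3 :=
  ⟨fun x => x, h.2, h.span_eq_top⟩

@[simp] lemma IsTet.basis_apply {T : Finset E3} (h : IsTet T) (x : T) : h.basis x = (x : E3) := rfl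

open Classical in
/-- The barycentric coordinate of the tetrahedron `T` that belongs to the vertex `P`. -/
def bary (T : Finset E3) (P : E3) : E3 →ᵃ[ℝ] ℝ :=
  if h : IsTet T ∧ P ∈ T then h.1.basis.coord ⟨P, h.2⟩ else 0

/-- The vertices of the face of `T` opposite to the vertex `P`. -/
def face (T : Finset E3) (P : E3) : Set E3 := (T : Set E3) \ {P}

variable {T T' : Finset E3} {P P' Q : E3}

lemma IsTet.bary_eq (h : IsTet T) (hP : P ∈ T) : bary T P = h.basis.coord ⟨P, hP⟩ :=
  dif_pos ⟨h, hP⟩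

lemma IsTet.bary_self (h : IsTet T) (hP : P ∈ T) : bary T P P = 1 := by
  rw [h.bary_eq hP]; exact h.basis.coord_apply_eq ⟨P, hP⟩

lemma IsTet.bary_ne (h : IsTet T) (hP : P ∈ T) (hQ : Q ∈ T) (hne : Q ≠ P) : bary T P Q = 0 := by
  rw [h.bary_eq hP]
  exact h.basis.coord_apply_ne (i := ⟨P, hP⟩) (j := ⟨Q, hQ⟩) (fun e => hne (by simpa using e.symm))

lemma IsTet.bary_face (h : IsTet T) (hP : P ∈ T) (hQ : Q ∈ face T P) : bary T P Q = 0 :=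
  h.bary_ne hP hQ.1 hQ.2

lemma IsTet.range_basis (h : IsTet T) : Set.range h.basis = (T : Set E3) := by
  ext x; simp

lemma IsTet.convexHull_eq (h : IsTet T) :
    convexHull ℝ (T : Set E3) = {x | ∀ P ∈ T, 0 ≤ bary T P x} := by
  rw [← h.range_basis, h.basis.convexHull_eq_nonneg_coord]
  ext x
  constructor
  · intro hx P hP; rw [h.bary_eq hP]; exact hx _
  · rintro hx ⟨P, hP⟩; rw [← h.bary_eq hP]; exact hx P hP

lemma IsTet.cell_eq (h : IsTet T) : cell T = {x | ∀ P ∈ T, 0 < bary T P x} := by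
  rw [cell, ← h.range_basis, h.basis.interior_convexHull]
  ext x
  constructor
  · intro hx P hP; rw [h.bary_eq hP]; exact hx _
  · rintro hx ⟨P, hP⟩; rw [← h.bary_eq hP]; exact hx P hP

lemma IsTet.mem_convexHull (h : IsTet T) {x : E3} :
    x ∈ convexHull ℝ (T : Set E3) ↔ ∀ P ∈ T, 0 ≤ bary T P x := by
  rw [h.convexHull_eq]; rfl

lemma IsTet.mem_cell (h : IsTet T) {x : E3} : x ∈ cell T ↔ ∀ P ∈ T, 0 < bary T P x := by
  rw [h.cell_eq]; rfl

lemma IsTet.sum_bary (h : IsTet T) (x : E3) : ∑ P ∈ T, bary T P x = 1 := by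
  rw [← Finset.sum_coe_sort, ← h.basis.sum_coord_apply_eq_one x]
  exact Finset.sum_congr rfl fun P _ => by rw [h.bary_eq P.2]

lemma IsTet.sum_bary_smul (h : IsTet T) (x : E3) : ∑ P ∈ T, bary T P x • P = x := by
  rw [← Finset.sum_coe_sort]
  conv_rhs => rw [← h.basis.linear_combination_coord_eq_self x]
  exact Finset.sum_congr rfl fun P _ => by rw [h.bary_eq P.2]; rfl

lemma IsTet.ext_affine {V : Type*} [AddCommGroup V] [Module ℝ V] (h : IsTet T)
    {f g : E3 →ᵃ[ℝ] V} (hfg : ∀ P ∈ T, f P = g P) : f = g := by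
  apply AffineMap.ext_on h.span_eq_top
  rintro _ ⟨P, rfl⟩
  exact hfg P P.2

lemma IsTet.sum_linear (h : IsTet T) (u : E3) : ∑ P ∈ T, (bary T P).linear u = 0 := by
  have h1 := h.sum_bary u
  have h0 := h.sum_bary 0
  have : ∑ P ∈ T, (bary T P u - bary T P 0) = 0 := by
    rw [Finset.sum_sub_distrib, h1, h0, sub_self]
  rw [← this]
  refine Finset.sum_congr rfl fun P _ => ?_
  have := (bary T P).linearMap_vsub u 0
  simpa using this

/-- The linear part of the reproduction of points by barycentric coordinates. Together with
`IsTet.sum_linear` it gives `∑ λ_P'(u) (x - P) = -u`, so constant fields are combinations of the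
radial fields. -/
lemma IsTet.sum_linear_smul (h : IsTet T) (u : E3) : ∑ P ∈ T, (bary T P).linear u • P = u := by
  have h1 := h.sum_bary_smul u
  have h0 := h.sum_bary_smul 0
  have : ∑ P ∈ T, (bary T P u - bary T P 0) • P = u := by
    simp only [sub_smul, Finset.sum_sub_distrib, h1, h0, sub_zero]
  conv_rhs => rw [← this]
  refine Finset.sum_congr rfl fun P _ => ?_
  have := (bary T P).linearMap_vsub u 0
  rw [vsub_eq_sub, vsub_eq_sub, sub_zero] at this
  rw [this]

/-! ### Elementary facts on cells -/

lemma isCompact_convexHull_coe (T : Finset E3) : IsCompact (convexHull ℝ (T : Set E3)) :=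
  T.finite_toSet.isCompact_convexHull (𝕜 := ℝ)

lemma isOpen_cell (T : Finset E3) : IsOpen (cell T) := isOpen_interior

lemma cell_subset (T : Finset E3) : cell T ⊆ convexHull ℝ (T : Set E3) := interior_subset

lemma convex_cell (T : Finset E3) : Convex ℝ (cell T) := (convex_convexHull ℝ _).interior

lemma isBounded_cell (T : Finset E3) : Bornology.IsBounded (cell T) :=
  (isCompact_convexHull_coe T).isBounded.subset (cell_subset T)

lemma measurableSet_cell (T : Finset E3) : MeasurableSet (cell T) := (isOpen_cell T).measurableSet

lemma volume_cell_lt_top (T : Finset E3) : volume (cell T) < ⊤ := (isBounded_cell T).measure_lt_top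

instance isFiniteMeasure_restrict_cell (T : Finset E3) :
    IsFiniteMeasure ((volume : Measure E3).restrict (cell T)) :=
  ⟨by simpa using volume_cell_lt_top T⟩

lemma IsTet.cell_nonempty (h : IsTet T) : (cell T).Nonempty := by
  -- The barycentre: each of its four coordinates is `1 / 4`.
  refine ⟨∑ Q ∈ T, (1 / 4 : ℝ) • Q, h.mem_cell.2 fun P hP => ?_⟩
  have key : ∑ Q ∈ T, (1 / 4 : ℝ) • Q = Finset.affineCombination ℝ T id (fun _ => (1 / 4 : ℝ)) := by
    rw [Finset.affineCombination_eq_linear_combination]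
    · rfl
    · simp [h.1]
  rw [key, Finset.map_affineCombination _ _ _ (by simp [h.1]),
    Finset.affineCombination_eq_linear_combination _ _ _ (by simp [h.1])]
  have : ∑ i ∈ T, (1 / 4 : ℝ) • ((bary T P) ∘ id) i = 1 / 4 := by
    rw [Finset.sum_eq_single_of_mem P hP]
    · simp [h.bary_self hP]
    · intro Q hQ hne; simp [h.bary_ne hP hQ hne]
  rw [this]; norm_num

/-- The volume of a tetrahedron. -/
def vol (T : Finset E3) : ℝ := volume.real (cell T)

lemma IsTet.vol_pos (h : IsTet T) : 0 < vol T :=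
  ENNReal.toReal_pos ((isOpen_cell T).measure_pos _ h.cell_nonempty).ne' (volume_cell_lt_top T).ne

lemma IsTet.closure_cell (h : IsTet T) : closure (cell T) = convexHull ℝ (T : Set E3) := by
  have hc : Convex ℝ (convexHull ℝ (T : Set E3)) := convex_convexHull ℝ _
  rw [cell, hc.closure_interior_eq_closure_of_nonempty_interior h.cell_nonempty]
  exact (isCompact_convexHull_coe T).isClosed.closure_eq

lemma norm_sub_le_diam_convexHull {x y : E3} (hx : x ∈ convexHull ℝ (T : Set E3))
    (hy : y ∈ convexHull ℝ (T : Set E3)) :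
    ‖x - y‖ ≤ Metric.diam (convexHull ℝ (T : Set E3)) := by
  rw [← dist_eq_norm]
  exact Metric.dist_le_diam_of_mem (isCompact_convexHull_coe T).isBounded hx hy

/-! ### Affine changes of variables -/

/-- The factor by which an affine map changes volumes. -/
def jac (F : E3 ≃ᵃ[ℝ] E3) : ℝ := |LinearMap.det (F.linear : E3 →ₗ[ℝ] E3)|

lemma jac_pos (F : E3 ≃ᵃ[ℝ] E3) : 0 < jac F :=
  abs_pos.2 (LinearEquiv.isUnit_det' F.linear).ne_zero

/-- The linear part of an affine automorphism as a continuous linear map. -/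
def linCLM (F : E3 ≃ᵃ[ℝ] E3) : E3 →L[ℝ] E3 := LinearMap.toContinuousLinearMap (F.linear : E3 →ₗ[ℝ] E3)

lemma linCLM_sub (F : E3 ≃ᵃ[ℝ] E3) (x y : E3) : linCLM F (x - y) = F x - F y := by
  have := (F : E3 →ᵃ[ℝ] E3).linearMap_vsub x y
  simpa [linCLM] using this

lemma hasFDerivAt_affineEquiv (F : E3 ≃ᵃ[ℝ] E3) (x : E3) : HasFDerivAt F (linCLM F) x := by
  have h : (F : E3 → E3) = fun y => linCLM F y + F 0 := by
    funext y
    have := linCLM_sub F y 0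
    rw [sub_zero] at this
    rw [this]; abel
  rw [h]
  exact (linCLM F).hasFDerivAt.add_const _

lemma contDiff_affineEquiv (F : E3 ≃ᵃ[ℝ] E3) : ContDiff ℝ ∞ F := by
  have h : (F : E3 → E3) = fun y => linCLM F y + F 0 := by
    funext y
    have := linCLM_sub F y 0
    rw [sub_zero] at this
    rw [this]; abel
  rw [h]
  exact (linCLM F).contDiff.add contDiff_const

lemma integral_image_affineEquiv (F : E3 ≃ᵃ[ℝ] E3) {s : Set E3} (hs : MeasurableSet s)
    (f : E3 → ℝ) : ∫ x in F '' s, f x = jac F * ∫ x in s, f (F x) := by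
  rw [integral_image_eq_integral_abs_det_fderiv_smul volume hs
    (fun x _ => (hasFDerivAt_affineEquiv F x).hasFDerivWithinAt) F.injective.injOn]
  simp only [smul_eq_mul]
  rw [integral_const_mul]
  rfl

lemma image_convexHull_affineEquiv (F : E3 ≃ᵃ[ℝ] E3) (s : Set E3) :
    F '' convexHull ℝ s = convexHull ℝ (F '' s) :=
  (F : E3 →ᵃ[ℝ] E3).image_convexHull s

/-- An affine automorphism as a homeomorphism. -/
def affHomeo (F : E3 ≃ᵃ[ℝ] E3) : E3 ≃ₜ E3 where
  toEquiv := F.toEquiv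
  continuous_toFun := (contDiff_affineEquiv F).continuous
  continuous_invFun := (contDiff_affineEquiv F.symm).continuous

lemma image_cell (F : E3 ≃ᵃ[ℝ] E3) (hF : F '' (T : Set E3) = T') : F '' cell T = cell T' := by
  have := (affHomeo F).image_interior (convexHull ℝ (T : Set E3))
  have e : ∀ s, affHomeo F '' s = F '' s := fun s => rfl
  rw [e, e, image_convexHull_affineEquiv, hF] at this
  exact this

lemma vol_image (F : E3 ≃ᵃ[ℝ] E3) (hF : F '' (T : Set E3) = T') : vol T' = jac F * vol T := by
  have := integral_image_affineEquiv F (measurableSet_cell T) (fun _ => 1)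
  rw [image_cell F hF] at this
  simpa [vol] using this

/-! ### Shears between tetrahedra with a common face -/

/-- The affine map that fixes the face of `T` opposite to `P` and maps `P` to `P'`. -/
def shearMap (T : Finset E3) (P P' : E3) : E3 →ᵃ[ℝ] E3 :=
  AffineMap.id ℝ E3 + (LinearMap.toSpanSingleton ℝ E3 (P' - P)).toAffineMap.comp (bary T P)

lemma shearMap_apply (x : E3) : shearMap T P P' x = x + bary T P x • (P' - P) := by
  simp [shearMap]

lemma IsTet.shearMap_self (h : IsTet T) (hP : P ∈ T) : shearMap T P P' P = P' := by
  simp [shearMap_apply, h.bary_self hP]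

lemma IsTet.shearMap_face (h : IsTet T) (hP : P ∈ T) (hQ : Q ∈ face T P) :
    shearMap T P P' Q = Q := by
  simp [shearMap_apply, h.bary_face hP hQ]

/-- The two shears fix the common face and exchange `P` and `P'`, so their composition fixes four
affinely independent points. -/
lemma IsTet.shearMap_comp (h : IsTet T) (h' : IsTet T') (hP : P ∈ T) (hP' : P' ∈ T')
    (hF : face T P = face T' P') (x : E3) : shearMap T' P' P (shearMap T P P' x) = x := by
  have : (shearMap T' P' P).comp (shearMap T P P') = AffineMap.id ℝ E3 := by
    apply h.ext_affine
    intro Q hQ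
    by_cases hQP : Q = P
    · subst hQP
      simp [h.shearMap_self hP, h'.shearMap_self hP']
    · have hQF : Q ∈ face T P := ⟨hQ, hQP⟩
      simp [h.shearMap_face hP hQF, h'.shearMap_face hP' (hF ▸ hQF)]
  exact congrArg (fun f : E3 →ᵃ[ℝ] E3 => f x) this

/-- The shear between two tetrahedra with a common face. -/
def IsTet.shear (h : IsTet T) (h' : IsTet T') (hP : P ∈ T) (hP' : P' ∈ T')
    (hF : face T P = face T' P') : E3 ≃ᵃ[ℝ] E3 :=
  AffineEquiv.ofBijective (φ := shearMap T P P')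
    ⟨Function.LeftInverse.injective (h.shearMap_comp h' hP hP' hF),
      Function.RightInverse.surjective (h'.shearMap_comp h hP' hP hF.symm)⟩

lemma IsTet.shear_apply (h : IsTet T) (h' : IsTet T') (hP : P ∈ T) (hP' : P' ∈ T')
    (hF : face T P = face T' P') (x : E3) :
    h.shear h' hP hP' hF x = x + bary T P x • (P' - P) := shearMap_apply x

lemma insert_face (hP : P ∈ T) : insert P (face T P) = (T : Set E3) := by
  ext x; simp only [face, Set.mem_insert_iff, Set.mem_sdiff, Set.mem_singleton_iff, Finset.mem_coe]
  constructor
  · rintro (rfl | h); exacts [hP, h.1]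
  · intro h; by_cases e : x = P; exacts [Or.inl e, Or.inr ⟨h, e⟩]

lemma IsTet.shear_image (h : IsTet T) (h' : IsTet T') (hP : P ∈ T) (hP' : P' ∈ T')
    (hF : face T P = face T' P') : h.shear h' hP hP' hF '' (T : Set E3) = T' := by
  rw [← insert_face hP, Set.image_insert_eq, ← insert_face hP', ← hF]
  have e1 : h.shear h' hP hP' hF P = P' := h.shearMap_self hP
  have e2 : h.shear h' hP hP' hF '' face T P = face T P := by
    have : Set.EqOn (h.shear h' hP hP' hF) id (face T P) := fun Q hQ => h.shearMap_face hP hQ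
    rw [this.image_eq, Set.image_id]
  rw [e1, e2]

/-- The linear part is a transvection, with determinant `1 + λ_P'(P' - P)`, and `λ_P(P) = 1`. -/
lemma IsTet.jac_shear (h : IsTet T) (h' : IsTet T') (hP : P ∈ T) (hP' : P' ∈ T')
    (hF : face T P = face T' P') : jac (h.shear h' hP hP' hF) = |bary T P P'| := by
  have : ((h.shear h' hP hP' hF).linear : E3 →ₗ[ℝ] E3)
      = LinearMap.transvection (bary T P).linear (P' - P) := by
    have e : ((h.shear h' hP hP' hF).linear : E3 →ₗ[ℝ] E3) = (shearMap T P P').linear := rfl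
    rw [e]
    ext x
    simp [shearMap, LinearMap.transvection]
  rw [jac, this, LinearMap.transvection.det]
  congr 1
  have := (bary T P).linearMap_vsub P' P
  rw [vsub_eq_sub, vsub_eq_sub, h.bary_self hP] at this
  rw [this]; ring

/-- Barycentric coordinates that vanish on the same face are proportional. -/
lemma IsTet.bary_proportional (h : IsTet T) (h' : IsTet T') (hP : P ∈ T) (hP' : P' ∈ T')
    (hF : face T P = face T' P') : bary T' P' = bary T' P' P • bary T P := by
  apply h.ext_affine
  intro Q hQ
  by_cases hQP : Q = P
  · subst hQP; simp [h.bary_self hP]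
  · have hQF : Q ∈ face T P := ⟨hQ, hQP⟩
    simp [h.bary_face hP hQF, h'.bary_face hP' (hF ▸ hQF)]

lemma IsTet.bary_mul_bary (h : IsTet T) (h' : IsTet T') (hP : P ∈ T) (hP' : P' ∈ T')
    (hF : face T P = face T' P') : bary T' P' P * bary T P P' = 1 := by
  have := congrArg (fun f : E3 →ᵃ[ℝ] ℝ => f P') (h.bary_proportional h' hP hP' hF)
  simpa [h'.bary_self hP'] using this.symm

lemma IsTet.vol_eq (h : IsTet T) (h' : IsTet T') (hP : P ∈ T) (hP' : P' ∈ T')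
    (hF : face T P = face T' P') : vol T = |bary T' P' P| * vol T' := by
  rw [vol_image _ (h'.shear_image h hP' hP hF.symm), h'.jac_shear]

end

section

variable {T T' : Finset E3} {P P' Q : E3}

/-! ### Homotheties -/

/-- The homothety with centre `z` and factor `t`. -/
def homoth (z : E3) (t : ℝ) (ht : t ≠ 0) : E3 ≃ᵃ[ℝ] E3 :=
  AffineEquiv.homothetyUnitsMulHom z (Units.mk0 t ht)

lemma homoth_apply (z : E3) (t : ℝ) (ht : t ≠ 0) (x : E3) :
    homoth z t ht x = z + t • (x - z) := by
  simp [homoth, AffineMap.homothety_apply, add_comm]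

lemma homoth_linear (z : E3) (t : ℝ) (ht : t ≠ 0) :
    ((homoth z t ht).linear : E3 →ₗ[ℝ] E3) = t • LinearMap.id := by
  ext x : 1
  have h := linCLM_sub (homoth z t ht) x 0
  rw [homoth_apply, homoth_apply, sub_zero] at h
  have h2 : ((homoth z t ht).linear : E3 →ₗ[ℝ] E3) x = linCLM (homoth z t ht) x := rfl
  rw [h2, h, LinearMap.smul_apply, LinearMap.id_apply]
  module

lemma jac_homoth (z : E3) (t : ℝ) (ht : t ≠ 0) : jac (homoth z t ht) = |t| ^ 3 := by
  rw [jac, homoth_linear, LinearMap.det_smul, LinearMap.det_id]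
  simp [abs_pow]

/-! ### Face integrals as volume integrals -/

/-- The flux of `f` times the radial field `x - P` through the face of `T` opposite to `P`,
written as a volume integral; here `G` is the gradient of `f`. -/
def faceInt (T : Finset E3) (P : E3) (f : E3 → ℝ) (G : E3 → E3) : ℝ :=
  ∫ x in cell T, (3 * f x + inner ℝ (x - P) (G x))

/-- The mean value of `f` on the face of `T` opposite to `P`. -/
def faceMean (T : Finset E3) (P : E3) (f : E3 → ℝ) (G : E3 → E3) : ℝ :=
  faceInt T P f G / (3 * vol T)

lemma inner_gradient_eq (φ : E3 → ℝ) (x u : E3) : inner ℝ u (gradient φ x) = fderiv ℝ φ x u := by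
  rw [inner_gradient_right]; simp

/-- An affine map with `F P = P'` carries the radial field about `P` to the one about `P'`, so by
the chain rule the integrand is invariant and only the Jacobian factor is left. -/
lemma faceInt_comp {φ : E3 → ℝ} (hφ : Differentiable ℝ φ) (F : E3 ≃ᵃ[ℝ] E3)
    (hF : F '' (T : Set E3) = T') (hP : F P = P') :
    faceInt T' P' φ (gradient φ) = jac F * faceInt T P (φ ∘ F) (gradient (φ ∘ F)) := by
  rw [faceInt, ← image_cell F hF, integral_image_affineEquiv F (measurableSet_cell T)]
  congr 1
  refine setIntegral_congr_fun (measurableSet_cell T) fun x _ => ?_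
  have h := (hφ (F x)).hasFDerivAt.comp x (hasFDerivAt_affineEquiv F x)
  simp only [inner_gradient_eq, Function.comp_apply, h.fderiv, ContinuousLinearMap.comp_apply]
  rw [linCLM_sub, hP]

lemma faceMean_comp {φ : E3 → ℝ} (hφ : Differentiable ℝ φ) (F : E3 ≃ᵃ[ℝ] E3)
    (hF : F '' (T : Set E3) = T') (hP : F P = P') :
    faceMean T' P' φ (gradient φ) = faceMean T P (φ ∘ F) (gradient (φ ∘ F)) := by
  rw [faceMean, faceMean, faceInt_comp hφ F hF hP, vol_image F hF]
  have := (jac_pos F).ne'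
  rw [mul_left_comm, mul_div_mul_left _ _ this]

lemma continuous_gradient {φ : E3 → ℝ} (hφ : ContDiff ℝ 1 φ) : Continuous (gradient φ) := by
  have : gradient φ = fun x => (InnerProductSpace.toDual ℝ E3).symm (fderiv ℝ φ x) := rfl
  rw [this]
  exact (LinearIsometryEquiv.continuous _).comp (hφ.continuous_fderiv one_ne_zero)

lemma Continuous.integrableOn_cell {F : Type*} [NormedAddCommGroup F] {f : E3 → F}
    (hf : Continuous f) (T : Finset E3) : IntegrableOn f (cell T) :=
  (hf.continuousOn.integrableOn_compact (isCompact_convexHull_coe T)).mono_set (cell_subset T)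

lemma faceInt_add {f g : E3 → ℝ} {F G : E3 → E3}
    (hf : IntegrableOn (fun x => 3 * f x + inner ℝ (x - P) (F x)) (cell T))
    (hg : IntegrableOn (fun x => 3 * g x + inner ℝ (x - P) (G x)) (cell T)) :
    faceInt T P (f + g) (F + G) = faceInt T P f F + faceInt T P g G := by
  rw [faceInt, faceInt, faceInt, ← integral_add hf hg]
  congr 1; ext x
  simp only [Pi.add_apply, inner_add_right]; ring

lemma integrableOn_faceInt {φ : E3 → ℝ} (hφ : ContDiff ℝ 1 φ) (T : Finset E3) (P : E3) :
    IntegrableOn (fun x => 3 * φ x + inner ℝ (x - P) (gradient φ x)) (cell T) := by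
  refine Continuous.integrableOn_cell ?_ T
  have := continuous_gradient hφ
  have := hφ.continuous
  fun_prop

lemma gradient_add {φ ψ : E3 → ℝ} (hφ : Differentiable ℝ φ) (hψ : Differentiable ℝ ψ) :
    gradient (φ + ψ) = gradient φ + gradient ψ := by
  funext x
  simp only [gradient, Pi.add_apply]
  rw [fderiv_add (hφ x) (hψ x), map_add]

lemma gradient_const_smul {φ : E3 → ℝ} (hφ : Differentiable ℝ φ) (c : ℝ) :
    gradient (c • φ) = c • gradient φ := by
  funext x
  simp only [gradient, Pi.smul_apply]
  rw [fderiv_const_smul (hφ x), map_smulₛₗ]; simp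

lemma faceMean_add {φ ψ : E3 → ℝ} (hφ : ContDiff ℝ 1 φ) (hψ : ContDiff ℝ 1 ψ) :
    faceMean T P (φ + ψ) (gradient (φ + ψ))
      = faceMean T P φ (gradient φ) + faceMean T P ψ (gradient ψ) := by
  rw [gradient_add (hφ.differentiable one_ne_zero) (hψ.differentiable one_ne_zero), faceMean,
    faceInt_add (integrableOn_faceInt hφ T P) (integrableOn_faceInt hψ T P), add_div]
  rfl

lemma faceMean_smul {φ : E3 → ℝ} (hφ : Differentiable ℝ φ) (c : ℝ) :
    faceMean T P (c • φ) (gradient (c • φ)) = c * faceMean T P φ (gradient φ) := by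
  rw [gradient_const_smul hφ, faceMean, faceMean, mul_div_assoc', faceInt, faceInt,
    ← integral_const_mul]
  congr 2; ext x
  simp only [Pi.smul_apply, smul_eq_mul, inner_smul_right]; ring

/-- This fixes the normalisation: `x - P` has divergence 3, hence total flux `3 * vol T`. -/
lemma IsTet.faceMean_const (h : IsTet T) (c : ℝ) :
    faceMean T P (fun _ => c) (gradient (fun _ : E3 => c)) = c := by
  have h0 : ∀ x, gradient (fun _ : E3 => c) x = 0 := fun x => by simp [gradient]
  have := h.vol_pos
  simp only [faceMean, faceInt, h0, inner_zero_right, add_zero, setIntegral_const, smul_eq_mul]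
  change vol T * _ / _ = _
  field_simp

/-- Near the face opposite to `P` a point of the tetrahedron belongs to the homothetic copy with
centre `P`, unless its coordinate is small. -/
lemma IsTet.bary_le_of_notMem_homoth (h : IsTet T) (hP : P ∈ T) {t : ℝ} (ht : 0 < t) {x : E3}
    (hx : x ∈ cell T) (hxt : x ∉ homoth P t ht.ne' '' cell T) : bary T P x ≤ 1 - t := by
  by_contra! hlt
  apply hxt
  have hsymm : homoth P t ht.ne' (P + t⁻¹ • (x - P)) = x := by
    rw [homoth_apply]; simp [smul_smul, ht.ne']
  refine ⟨P + t⁻¹ • (x - P), h.mem_cell.2 fun Q hQ => ?_, hsymm⟩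
  have e : bary T Q (P + t⁻¹ • (x - P)) = bary T Q P + t⁻¹ * (bary T Q x - bary T Q P) := by
    have h1 := (bary T Q).map_vadd P (t⁻¹ • (x - P))
    have h2 := (bary T Q).linearMap_vsub x P
    simp only [vadd_eq_add, vsub_eq_sub, map_smul, smul_eq_mul] at h1 h2
    rw [add_comm P, h1, h2]; ring
  rw [e]
  have hpos := h.mem_cell.1 hx Q hQ
  by_cases hQP : Q = P
  · subst hQP
    rw [h.bary_self hQ]
    have : 0 < t⁻¹ * (t + (bary T Q x - 1)) := by
      apply mul_pos (inv_pos.2 ht); linarith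
    rw [mul_add, inv_mul_cancel₀ ht.ne'] at this
    linarith
  · rw [h.bary_ne hQ hP (Ne.symm hQP)]
    simp only [sub_zero, zero_add]
    positivity

lemma IsTet.homoth_image_subset (hP : P ∈ T) {t : ℝ} (ht : 0 < t) (ht1 : t < 1) :
    homoth P t ht.ne' '' cell T ⊆ cell T := by
  rintro _ ⟨x, hx, rfl⟩
  rw [homoth_apply]
  have hP' : P ∈ closure (convexHull ℝ (T : Set E3)) :=
    subset_closure (subset_convexHull ℝ _ hP)
  have := (convex_convexHull ℝ (T : Set E3)).combo_closure_interior_mem_interior hP' hx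
    (by linarith : (0:ℝ) ≤ 1 - t) ht (by ring)
  have e : P + t • (x - P) = (1 - t) • P + t • x := by module
  rw [e]; exact this

/-- A smooth function that vanishes on a face is bounded by the coordinate of that face. -/
lemma IsTet.exists_bound_bary (h : IsTet T) (hP : P ∈ T) {ψ : E3 → ℝ} (hψ : ContDiff ℝ 1 ψ)
    (h0 : ∀ x ∈ convexHull ℝ (face T P), ψ x = 0) :
    ∃ C, 0 ≤ C ∧ ∀ x ∈ cell T, bary T P x < 1 → |ψ x| ≤ C * bary T P x := by
  obtain ⟨L, hL⟩ := (isCompact_convexHull_coe T).exists_bound_of_continuousOn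
    (hψ.continuous_fderiv one_ne_zero).continuousOn
  have hL0 : 0 ≤ L := (norm_nonneg _).trans (hL P (subset_convexHull ℝ _ hP))
  refine ⟨L * Metric.diam (convexHull ℝ (T : Set E3)), by positivity, fun x hx hx1 => ?_⟩
  set l := bary T P x with hl
  have hl0 : 0 < l := h.mem_cell.1 hx P hP
  -- The central projection of `x` from `P` onto the opposite face, so that `x = l • P + (1 - l) •
  -- y`; the mean value inequality on the segment from `y` to `x` then gives the bound.
  set y : E3 := (1 - l)⁻¹ • (x - l • P) with hy
  have h1l : (0:ℝ) < 1 - l := by linarith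
  have hxy : x - y = l • (P - y) := by
    have : (1 - l) • y = x - l • P := by rw [hy, smul_smul, mul_inv_cancel₀ h1l.ne', one_smul]
    have h2 : x = (1 - l) • y + l • P := by rw [this]; abel
    nth_rewrite 1 [h2]; module
  have hyF : y ∈ convexHull ℝ (face T P) := by
    classical
    have hf : face T P = ((T.erase P : Finset E3) : Set E3) := by simp [face]
    have hs := h.sum_bary_smul x
    rw [← Finset.add_sum_erase T _ hP] at hs
    have hs1 := h.sum_bary x
    rw [← Finset.add_sum_erase T _ hP] at hs1
    have hy' : y = ∑ Q ∈ T.erase P, ((1 - l)⁻¹ * bary T Q x) • Q := by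
      have : x - l • P = ∑ Q ∈ T.erase P, bary T Q x • Q := by
        rw [eq_sub_of_add_eq' hs]
      rw [hy, this, Finset.smul_sum]
      simp only [smul_smul]
    rw [hy', hf]
    apply (convex_convexHull ℝ _).sum_mem
    · intro Q hQ
      have := h.mem_cell.1 hx Q (Finset.mem_of_mem_erase hQ)
      positivity
    · rw [← Finset.mul_sum, show ∑ Q ∈ T.erase P, bary T Q x = 1 - l by linarith, inv_mul_cancel₀ h1l.ne']
    · exact fun Q hQ => subset_convexHull ℝ _ hQ
  have hyT : y ∈ convexHull ℝ (T : Set E3) := convexHull_mono Set.sdiff_subset hyF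
  have hb := (convex_convexHull ℝ (T : Set E3)).norm_image_sub_le_of_norm_fderiv_le
    (fun z _ => hψ.differentiable one_ne_zero z) hL hyT (cell_subset T hx)
  rw [h0 y hyF, sub_zero, hxy, norm_smul, Real.norm_eq_abs, Real.norm_eq_abs, abs_of_pos hl0] at hb
  have hd := norm_sub_le_diam_convexHull (subset_convexHull ℝ (T : Set E3) hP) hyT
  calc |ψ x| ≤ L * (l * ‖P - y‖) := hb
    _ ≤ L * (l * Metric.diam (convexHull ℝ (T : Set E3))) := by gcongr
    _ = _ := by ring

/-- After a change of variables the left side is the integral of `ψ` over the copy of the cell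
dilated about `P` by `t`. Its derivative at `t = 1` only sees the thin layer at the opposite face,
which is why `faceInt` is a face functional. -/
lemma hasDerivAt_scaled_integral {ψ : E3 → ℝ} (hψ : ContDiff ℝ 1 ψ) (T : Finset E3) (P : E3) :
    HasDerivAt (fun t : ℝ => ∫ x in cell T, t ^ 3 * ψ (P + t • (x - P)))
      (faceInt T P ψ (gradient ψ)) 1 := by
  have hc := hψ.continuous
  have hc' := hψ.continuous_fderiv one_ne_zero
  set F' : ℝ → E3 → ℝ := fun t x =>
    3 * t ^ 2 * ψ (P + t • (x - P)) + t ^ 3 * fderiv ℝ ψ (P + t • (x - P)) (x - P) with hF'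
  have hF'c : Continuous (fun p : ℝ × E3 => F' p.1 p.2) := by
    simp only [hF']
    fun_prop
  obtain ⟨B, hB⟩ := ((isCompact_Icc (a := (0:ℝ)) (b := 2)).prod
    (isCompact_convexHull_coe T)).exists_bound_of_continuousOn hF'c.continuousOn
  have key := hasDerivAt_integral_of_dominated_loc_of_deriv_le
    (μ := volume.restrict (cell T)) (F := fun t x => t ^ 3 * ψ (P + t • (x - P))) (F' := F')
    (x₀ := (1:ℝ)) (s := Set.Icc 0 2) (bound := fun _ => B)
    (Icc_mem_nhds (by norm_num) (by norm_num))
    (Eventually.of_forall fun t => by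
      have : Continuous (fun x => t ^ 3 * ψ (P + t • (x - P))) := by fun_prop
      exact this.aestronglyMeasurable)
    (Continuous.integrableOn_cell (by fun_prop) T)
    (by
      have : Continuous (F' 1) := hF'c.comp (Continuous.prodMk_right 1)
      exact this.aestronglyMeasurable)
    ?_ (integrable_const B) ?_
  · have e : ∫ x in cell T, F' 1 x = faceInt T P ψ (gradient ψ) := by
      rw [faceInt]
      congr 1; ext x
      simp [hF']
    rw [← e]; exact key.2
  · refine (ae_restrict_iff' (measurableSet_cell T)).2 (Eventually.of_forall fun x hx t ht => ?_)
    exact hB (t, x) ⟨ht, cell_subset T hx⟩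
  · refine Eventually.of_forall fun x t _ => ?_
    have h1 : HasDerivAt (fun t : ℝ => P + t • (x - P)) (x - P) t := by
      simpa using ((hasDerivAt_id t).smul_const (x - P)).const_add P
    have h2 : HasDerivAt (fun t : ℝ => ψ (P + t • (x - P)))
        (fderiv ℝ ψ (P + t • (x - P)) (x - P)) t :=
      (hψ.differentiable one_ne_zero _).hasFDerivAt.comp_hasDerivAt t h1
    have h3 := (hasDerivAt_pow 3 t).mul h2
    exact h3.congr_deriv (by simp [hF'])

/-- Functions that vanish on a face have vanishing face integral. -/
lemma IsTet.faceInt_eq_zero (h : IsTet T) (hP : P ∈ T) {ψ : E3 → ℝ} (hψ : ContDiff ℝ 1 ψ)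
    (h0 : ∀ x ∈ convexHull ℝ (face T P), ψ x = 0) : faceInt T P ψ (gradient ψ) = 0 := by
  obtain ⟨C, hC, hCb⟩ := h.exists_bound_bary hP hψ h0
  have hD := hasDerivAt_scaled_integral hψ T P
  set E : ℝ → ℝ := fun t => ∫ x in cell T, t ^ 3 * ψ (P + t • (x - P)) with hE
  have hEt : ∀ t (ht : 0 < t), E t = ∫ x in homoth P t ht.ne' '' cell T, ψ x := by
    intro t ht
    rw [integral_image_affineEquiv _ (measurableSet_cell T), jac_homoth, abs_of_pos ht,
      ← integral_const_mul]
    simp only [homoth_apply, hE]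
  -- The layer between the cell and its contracted copy has volume `(1 - t ^ 3) * vol T`, and there
  -- `|ψ|` is at most `C * (1 - t)`. The increment is thus quadratic in `1 - t`.
  have hbound : ∀ t, 0 < t → t < 1 → |E t - E 1| ≤ C * (1 - t) * (3 * (1 - t) * vol T) := by
    intro t ht ht1
    have hsub := IsTet.homoth_image_subset hP ht ht1
    have hE1 : E 1 = ∫ x in cell T, ψ x := by simp [hE]
    have hmeas : MeasurableSet (homoth P t ht.ne' '' cell T) :=
      ((affHomeo (homoth P t ht.ne')).isOpenMap _ (isOpen_cell T)).measurableSet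
    have hint := Continuous.integrableOn_cell hψ.continuous T
    have hd := setIntegral_sdiff hmeas hint hsub
    rw [hEt t ht, hE1, abs_sub_comm, ← hd]
    have hv : volume.real (cell T \ homoth P t ht.ne' '' cell T) = (1 - t ^ 3) * vol T := by
      rw [measureReal_sdiff hsub hmeas (volume_cell_lt_top T).ne]
      have := integral_image_affineEquiv (homoth P t ht.ne') (measurableSet_cell T) (fun _ => 1)
      rw [jac_homoth, abs_of_pos ht] at this
      simp only [setIntegral_const, smul_eq_mul, mul_one] at this
      rw [this]
      change vol T - t ^ 3 * vol T = _
      ring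
    have hn := norm_setIntegral_le_of_norm_le_const (μ := volume) (f := ψ) (C := C * (1 - t))
      (s := cell T \ homoth P t ht.ne' '' cell T)
      ((measure_mono Set.sdiff_subset).trans_lt (volume_cell_lt_top T)) ?_
    · rw [Real.norm_eq_abs, hv] at hn
      refine hn.trans ?_
      have hV := h.vol_pos
      have h3 : 1 - t ^ 3 ≤ 3 * (1 - t) := by nlinarith [sq_nonneg t, mul_nonneg ht.le (sub_nonneg.2 ht1.le)]
      have : 0 ≤ 1 - t := by linarith
      gcongr
    · intro x hx
      have hle := h.bary_le_of_notMem_homoth hP ht hx.1 hx.2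
      refine (hCb x hx.1 (by linarith)).trans ?_
      gcongr
  -- The one-sided derivative from the left suffices, since the bound concerns contractions only.
  have hs := hasDerivWithinAt_iff_tendsto_slope.1 (hD.hasDerivWithinAt (s := Set.Iio 1))
  have hz : Tendsto (slope E 1) (𝓝[Set.Iio 1 \ {1}] 1) (𝓝 0) := by
    rw [Set.sdiff_singleton_eq_self (by simp)]
    have hlim : Tendsto (fun t : ℝ => C * (3 * (1 - t) * vol T)) (𝓝[<] 1) (𝓝 0) := by
      have : Continuous (fun t : ℝ => C * (3 * (1 - t) * vol T)) := by fun_prop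
      have := this.tendsto 1
      simp only [sub_self, mul_zero, zero_mul] at this
      exact this.mono_left nhdsWithin_le_nhds
    refine squeeze_zero_norm' ?_ hlim
    have : Set.Ioo (0:ℝ) 1 ∈ 𝓝[<] (1:ℝ) := Ioo_mem_nhdsLT (by norm_num)
    filter_upwards [this] with t ht
    have hb := hbound t ht.1 ht.2
    have h1t : 0 < 1 - t := by linarith [ht.2]
    rw [slope_def_field, Real.norm_eq_abs, abs_div, abs_sub_comm t 1, abs_of_pos h1t,
      div_le_iff₀ h1t]
    linarith
  have hne : (𝓝[Set.Iio 1 \ {1}] (1:ℝ)).NeBot := by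
    rw [Set.sdiff_singleton_eq_self (by simp)]; infer_instance
  exact tendsto_nhds_unique hs hz

lemma IsTet.faceMean_eq_zero (h : IsTet T) (hP : P ∈ T) {ψ : E3 → ℝ} (hψ : ContDiff ℝ 1 ψ)
    (h0 : ∀ x ∈ convexHull ℝ (face T P), ψ x = 0) : faceMean T P ψ (gradient ψ) = 0 := by
  rw [faceMean, h.faceInt_eq_zero hP hψ h0, zero_div]

/-- Two functions that agree on a face have the same mean value there. -/
lemma IsTet.faceMean_congr (h : IsTet T) (hP : P ∈ T) {φ ψ : E3 → ℝ} (hφ : ContDiff ℝ 1 φ)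
    (hψ : ContDiff ℝ 1 ψ) (h0 : ∀ x ∈ convexHull ℝ (face T P), φ x = ψ x) :
    faceMean T P φ (gradient φ) = faceMean T P ψ (gradient ψ) := by
  have e : φ = ψ + (φ + (-1 : ℝ) • ψ) := by ext x; simp
  have hd : ContDiff ℝ 1 (φ + (-1 : ℝ) • ψ) := hφ.add (contDiff_const.smul hψ)
  rw [e, faceMean_add hψ hd, h.faceMean_eq_zero hP hd fun x hx => by simp [h0 x hx], add_zero]

/-- The mean value of a smooth function on a common face of two tetrahedra does not depend on
the tetrahedron. -/
lemma IsTet.faceMean_eq_faceMean (h : IsTet T) (h' : IsTet T') (hP : P ∈ T) (hP' : P' ∈ T')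
    (hF : face T P = face T' P') {φ : E3 → ℝ} (hφ : ContDiff ℝ 1 φ) :
    faceMean T P φ (gradient φ) = faceMean T' P' φ (gradient φ) := by
  have hS := h.shear_apply h' hP hP' hF
  rw [faceMean_comp (hφ.differentiable one_ne_zero) _ (h.shear_image h' hP hP' hF)
    (P := P) (by rw [hS, h.bary_self hP]; simp)]
  -- The shear is the identity on the common face, so `φ` and its pullback have the same values
  -- there.
  refine h.faceMean_congr hP hφ
    (hφ.comp ((contDiff_affineEquiv _).of_le (by exact_mod_cast le_top))) fun x hx => ?_
  have hx0 : bary T P x = 0 := by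
    have : convexHull ℝ (face T P) ⊆ (bary T P) ⁻¹' {0} :=
      convexHull_min (fun Q hQ => h.bary_face hP hQ)
        ((convex_singleton (0:ℝ)).affine_preimage _)
    exact this hx
  simp [hS, hx0]

end

section

variable {T T' : Finset E3} {P P' Q : E3}

/-! ### Mean values of shape functions -/

lemma isTet_of_image (F : E3 ≃ᵃ[ℝ] E3) (hF : F '' (T : Set E3) = T') (h : IsTet T') : IsTet T := by
  constructor
  · have := congrArg Set.ncard hF
    rw [Set.ncard_image_of_injective _ F.injective, Set.ncard_coe_finset, Set.ncard_coe_finset,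
      h.1] at this
    exact this
  · have := (F.affineIndependent_set_of_eq_iff (s := (T : Set E3)))
    rw [hF] at this
    exact this.1 h.2

lemma finite_refVertices : refVertices.Finite := by unfold refVertices; exact Set.toFinite _

/-- The vertices of the reference tetrahedron as a finite set. -/
def refTet : Finset E3 := finite_refVertices.toFinset

lemma coe_refTet : (refTet : Set E3) = refVertices := finite_refVertices.coe_toFinset

lemma vec3_ext_iff (x y : E3) : x = y ↔ x 0 = y 0 ∧ x 1 = y 1 ∧ x 2 = y 2 := by
  constructor
  · rintro rfl; simp
  · rintro ⟨h0, h1, h2⟩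
    ext i; fin_cases i; exacts [h0, h1, h2]

/-! ### Symmetries of the reference tetrahedron -/

/-- The reflections `x ↦ (s₁ x₁, s₂ x₂, s₃ x₃)` with signs `s`. -/
def signEquiv (s : E3) (hs : ∀ i, s i * s i = 1) : E3 ≃ₗ[ℝ] E3 :=
  LinearEquiv.ofInvolutive
    { toFun := fun x => !₂[s 0 * x 0, s 1 * x 1, s 2 * x 2]
      map_add' := fun x y => by rw [vec3_ext_iff]; simp [mul_add]
      map_smul' := fun c x => by rw [vec3_ext_iff]; simp [mul_left_comm] }
    (fun x => by
      rw [vec3_ext_iff]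
      simp [← mul_assoc, hs])

/-- The exchange of the first two coordinates. -/
def swapEquiv : E3 ≃ₗ[ℝ] E3 :=
  LinearEquiv.ofInvolutive
    { toFun := fun x => !₂[x 1, x 0, x 2]
      map_add' := fun x y => by rw [vec3_ext_iff]; simp
      map_smul' := fun c x => by rw [vec3_ext_iff]; simp }
    (fun x => by rw [vec3_ext_iff]; simp)

/-- The exchange of the last two coordinates. -/
def swapEquiv' : E3 ≃ₗ[ℝ] E3 :=
  LinearEquiv.ofInvolutive
    { toFun := fun x => !₂[x 0, x 2, x 1]
      map_add' := fun x y => by rw [vec3_ext_iff]; simp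
      map_smul' := fun c x => by rw [vec3_ext_iff]; simp }
    (fun x => by rw [vec3_ext_iff]; simp)

lemma signEquiv_apply (s : E3) (hs : ∀ i, s i * s i = 1) (x : E3) :
    signEquiv s hs x = !₂[s 0 * x 0, s 1 * x 1, s 2 * x 2] := rfl

lemma swapEquiv_apply (x : E3) : swapEquiv x = !₂[x 1, x 0, x 2] := rfl

lemma swapEquiv'_apply (x : E3) : swapEquiv' x = !₂[x 0, x 2, x 1] := rfl

lemma image_eq_of_involution {S : E3 ≃ₗ[ℝ] E3} (hS : ∀ x, S (S x) = x) {A : Set E3}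
    (hA : ∀ x ∈ A, S x ∈ A) : S.toAffineEquiv '' A = A := by
  apply Set.Subset.antisymm
  · rintro _ ⟨x, hx, rfl⟩; exact hA x hx
  · intro x hx; exact ⟨S x, hA x hx, hS x⟩

lemma mem_refVertices (x : E3) : x ∈ refVertices ↔
    x = !₂[1, 1, 1] ∨ x = !₂[1, -1, -1] ∨ x = !₂[-1, 1, -1] ∨ x = !₂[-1, -1, 1] := Iff.rfl

lemma sq_of_mem_refVertices {s : E3} (hs : s ∈ refVertices) (i : Fin 3) : s i * s i = 1 := by
  rw [mem_refVertices] at hs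
  rcases hs with rfl | rfl | rfl | rfl <;> fin_cases i <;> simp

/-- The vertices are the sign vectors with product 1, a group under componentwise multiplication. -/
lemma signEquiv_image {s : E3} (hs : s ∈ refVertices) :
    (signEquiv s (sq_of_mem_refVertices hs)).toAffineEquiv '' refVertices = refVertices := by
  apply image_eq_of_involution
  · intro x; exact LinearEquiv.apply_symm_apply (signEquiv s (sq_of_mem_refVertices hs)) x
  · intro x hx
    rw [signEquiv_apply]
    rw [mem_refVertices] at hs hx ⊢
    rcases hs with rfl | rfl | rfl | rfl <;> rcases hx with rfl | rfl | rfl | rfl <;>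
      simp

lemma swapEquiv_image : swapEquiv.toAffineEquiv '' refVertices = refVertices := by
  apply image_eq_of_involution
  · intro x; exact LinearEquiv.apply_symm_apply swapEquiv x
  · intro x hx
    rw [swapEquiv_apply]
    rw [mem_refVertices] at hx ⊢
    rcases hx with rfl | rfl | rfl | rfl <;> simp

lemma swapEquiv'_image : swapEquiv'.toAffineEquiv '' refVertices = refVertices := by
  apply image_eq_of_involution
  · intro x; exact LinearEquiv.apply_symm_apply swapEquiv' x
  · intro x hx
    rw [swapEquiv'_apply]
    rw [mem_refVertices] at hx ⊢
    rcases hx with rfl | rfl | rfl | rfl <;> simp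

/-- Each generator of the space is mapped to a multiple of itself, because the squares do not see
signs. -/
lemma refSpace_comp_sign {s : E3} (hs : ∀ i, s i * s i = 1) {r : E3 → ℝ} (hr : r ∈ refSpace) :
    r ∘ signEquiv s hs ∈ refSpace := by
  have hle : refSpace ≤ refSpace.comap (LinearMap.funLeft ℝ ℝ (signEquiv s hs)) := by
    conv_lhs => rw [refSpace]
    rw [Submodule.span_le]
    have hsub : ∀ f ∈ ({fun _ => 1, fun x => x 0, fun x => x 1, fun x => x 2,
        fun x => x 0 ^ 2 - x 1 ^ 2, fun x => x 1 ^ 2 - x 2 ^ 2} : Set (E3 → ℝ)), f ∈ refSpace :=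
      fun f hf => Submodule.subset_span hf
    have hsq : ∀ i, s i ^ 2 = 1 := fun i => by rw [sq]; exact hs i
    have aux : ∀ f g : E3 → ℝ, f ∈ refSpace → ∀ c : ℝ, (∀ x, g x = c * f x) → g ∈ refSpace := by
      intro f g hf c hg
      have : g = c • f := by ext x; simp [hg]
      rw [this]; exact refSpace.smul_mem c hf
    rintro f (rfl | rfl | rfl | rfl | rfl | rfl)
    · exact aux _ _ (hsub (fun _ => 1) (by simp)) 1 fun x => by simp [LinearMap.funLeft]
    · exact aux _ _ (hsub (fun x => x 0) (by simp)) (s 0) fun x => by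
        simp [LinearMap.funLeft, signEquiv_apply]
    · exact aux _ _ (hsub (fun x => x 1) (by simp)) (s 1) fun x => by
        simp [LinearMap.funLeft, signEquiv_apply]
    · exact aux _ _ (hsub (fun x => x 2) (by simp)) (s 2) fun x => by
        simp [LinearMap.funLeft, signEquiv_apply]
    · exact aux _ _ (hsub (fun x => x 0 ^ 2 - x 1 ^ 2) (by simp)) 1 fun x => by
        simp [LinearMap.funLeft, signEquiv_apply, mul_pow, hsq]
    · exact aux _ _ (hsub (fun x => x 1 ^ 2 - x 2 ^ 2) (by simp)) 1 fun x => by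
        simp [LinearMap.funLeft, signEquiv_apply, mul_pow, hsq]
  exact hle hr

/-- The affine map of the reference tetrahedron can be chosen to map the first vertex to a given
vertex. -/
lemma IsShape.exists_normalized {p : E3 → ℝ} (hp : IsShape T p) (hP : P ∈ T) :
    ∃ F : E3 ≃ᵃ[ℝ] E3, F '' (refTet : Set E3) = T ∧ F !₂[1, 1, 1] = P ∧ p ∘ F ∈ refSpace := by
  obtain ⟨F, hF, hpF⟩ := hp
  obtain ⟨s, hs, rfl⟩ : P ∈ F '' refVertices := by rw [hF]; exact hP
  -- The reference vertex `s` over `P` doubles as the sign vector of a reflection that moves `(1, 1,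
  -- 1)` to `s`.
  refine ⟨(signEquiv s (sq_of_mem_refVertices hs)).toAffineEquiv.trans F, ?_, ?_, ?_⟩
  · rw [coe_refTet, AffineEquiv.coe_trans, Set.image_comp, signEquiv_image hs, hF]
  · have : signEquiv s (sq_of_mem_refVertices hs) !₂[1, 1, 1] = s := by
      rw [signEquiv_apply, vec3_ext_iff]; simp
    rw [AffineEquiv.coe_trans, Function.comp_apply]
    exact congrArg F this
  · exact refSpace_comp_sign (sq_of_mem_refVertices hs) hpF

lemma contDiff_coord (i : Fin 3) : ContDiff ℝ ∞ (fun x : E3 => x i) :=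
  (EuclideanSpace.proj i : E3 →L[ℝ] ℝ).contDiff

lemma contDiff_of_mem_refSpace {r : E3 → ℝ} (hr : r ∈ refSpace) : ContDiff ℝ ∞ r := by
  have h0 := contDiff_coord 0
  have h1 := contDiff_coord 1
  have h2 := contDiff_coord 2
  rw [refSpace] at hr
  induction hr using Submodule.span_induction with
  | mem f hf =>
    rcases hf with rfl | rfl | rfl | rfl | rfl | rfl
    · exact contDiff_const
    · exact h0
    · exact h1
    · exact h2
    · exact (h0.pow 2).sub (h1.pow 2)
    · exact (h1.pow 2).sub (h2.pow 2)
  | zero => exact contDiff_const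
  | add f g _ _ hf hg => exact hf.add hg
  | smul c f _ hf => exact contDiff_const.smul hf

lemma IsShape.contDiff {p : E3 → ℝ} (hp : IsShape T p) : ContDiff ℝ ∞ p := by
  obtain ⟨F, -, hF⟩ := hp
  have : p = (p ∘ F) ∘ F.symm := by ext x; simp
  rw [this]
  exact (contDiff_of_mem_refSpace hF).comp (contDiff_affineEquiv F.symm)

lemma one_le_infty : (1 : WithTop ℕ∞) ≤ ∞ := by exact_mod_cast le_top

lemma refTet_face : face refTet !₂[1, 1, 1]
    = {!₂[1, -1, -1], !₂[-1, 1, -1], !₂[-1, -1, 1]} := by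
  rw [face, coe_refTet, refVertices]
  have h1 : (!₂[1, -1, -1] : E3) ≠ !₂[1, 1, 1] := by rw [Ne, vec3_ext_iff]; norm_num
  have h2 : (!₂[-1, 1, -1] : E3) ≠ !₂[1, 1, 1] := by rw [Ne, vec3_ext_iff]; norm_num
  have h3 : (!₂[-1, -1, 1] : E3) ≠ !₂[1, 1, 1] := by rw [Ne, vec3_ext_iff]; norm_num
  ext x
  simp only [Set.mem_sdiff, Set.mem_insert_iff, Set.mem_singleton_iff]
  constructor
  · tauto
  · rintro (rfl | rfl | rfl) <;> simp [*]

/-- A symmetry that fixes the vertex `(1, 1, 1)` preserves the opposite face, hence means over it.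
-/
lemma faceMean_symm {S : E3 ≃ₗ[ℝ] E3} (hS : S.toAffineEquiv '' refVertices = refVertices)
    (h1 : S !₂[1, 1, 1] = !₂[1, 1, 1]) {f g : E3 → ℝ} (hf : ContDiff ℝ ∞ f)
    (hg : ∀ x, g x = f (S x)) :
    faceMean refTet !₂[1, 1, 1] g (gradient g) = faceMean refTet !₂[1, 1, 1] f (gradient f) := by
  have hg' : g = f ∘ S.toAffineEquiv := by ext x; exact hg x
  rw [hg']
  refine (faceMean_comp (hf.differentiable (by simp)) S.toAffineEquiv ?_ h1).symm
  rw [coe_refTet, hS]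

/-- On the reference tetrahedron the mean value of a shape function on a face is the mean of its
values at the three edge midpoints. -/
lemma faceMean_refTet (hR : IsTet refTet) {r : E3 → ℝ} (hr : r ∈ refSpace) :
    faceMean refTet !₂[1, 1, 1] r (gradient r)
      = (r !₂[-1, 0, 0] + r !₂[0, -1, 0] + r !₂[0, 0, -1]) / 3 := by
  set a : E3 := !₂[1, 1, 1] with ha
  have haR : a ∈ refTet := by
    rw [← Finset.mem_coe, coe_refTet, mem_refVertices]; exact Or.inl rfl
  have hs1 : swapEquiv a = a := by rw [swapEquiv_apply, vec3_ext_iff]; simp [ha]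
  have hs2 : swapEquiv' a = a := by rw [swapEquiv'_apply, vec3_ext_iff]; simp [ha]
  have c0 := contDiff_coord 0
  have c1 := contDiff_coord 1
  have c2 := contDiff_coord 2
  set m : (E3 → ℝ) → ℝ := fun f => faceMean refTet a f (gradient f) with hm
  -- Exchanging coordinates shows that the three coordinates have equal means; as they add up to
  -- `-1` on this face, each mean is `-1 / 3`, as at the midpoints.
  have e01 : m (fun x => x 0) = m (fun x => x 1) :=
    faceMean_symm swapEquiv_image hs1 c1 fun x => by simp [swapEquiv_apply]
  have e12 : m (fun x => x 1) = m (fun x => x 2) :=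
    faceMean_symm swapEquiv'_image hs2 c2 fun x => by simp [swapEquiv'_apply]
  have hsum : m (fun x => x 0) + m (fun x => x 1) + m (fun x => x 2) = -1 := by
    have h1 : m ((fun x => x 0) + (fun x => x 1) + (fun x => x 2)) = -1 := by
      rw [← hR.faceMean_const (P := a) (-1)]
      refine hR.faceMean_congr haR (((c0.add c1).add c2).of_le one_le_infty) contDiff_const ?_
      have : convexHull ℝ (face refTet a) ⊆ {x : E3 | x 0 + x 1 + x 2 = -1} := by
        rw [ha, refTet_face]
        refine convexHull_min ?_ ?_
        · rintro x (rfl | rfl | rfl) <;> simp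
        · intro x hx y hy s t _ _ hst
          simp only [Set.mem_ofPred_eq] at hx hy ⊢
          simp only [PiLp.add_apply, PiLp.smul_apply, smul_eq_mul]
          linear_combination s * hx + t * hy - hst
      intro x hx
      exact this hx
    have h2 := faceMean_add (T := refTet) (P := a)
      ((c0.add c1).of_le one_le_infty) (c2.of_le one_le_infty)
    have h3 := faceMean_add (T := refTet) (P := a)
      (c0.of_le one_le_infty) (c1.of_le one_le_infty)
    change m ((fun x => x 0) + (fun x => x 1) + (fun x => x 2))
      = m ((fun x => x 0) + (fun x => x 1)) + m (fun x => x 2) at h2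
    change m ((fun x => x 0) + (fun x => x 1)) = m (fun x => x 0) + m (fun x => x 1) at h3
    linarith
  -- The exchange of two coordinates reverses the sign of the function but preserves its mean.
  have sq1 : m (fun x => x 0 ^ 2 - x 1 ^ 2) = 0 := by
    have cd : ContDiff ℝ ∞ (fun x : E3 => x 0 ^ 2 - x 1 ^ 2) := (c0.pow 2).sub (c1.pow 2)
    have h1 : m ((-1 : ℝ) • (fun x => x 0 ^ 2 - x 1 ^ 2)) = m (fun x => x 0 ^ 2 - x 1 ^ 2) :=
      faceMean_symm swapEquiv_image hs1 cd fun x => by simp [swapEquiv_apply]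
    have h2 := faceMean_smul (T := refTet) (P := a) (cd.differentiable (by simp)) (-1)
    change m _ = -1 * m _ at h2
    linarith
  have sq2 : m (fun x => x 1 ^ 2 - x 2 ^ 2) = 0 := by
    have cd : ContDiff ℝ ∞ (fun x : E3 => x 1 ^ 2 - x 2 ^ 2) := (c1.pow 2).sub (c2.pow 2)
    have h1 : m ((-1 : ℝ) • (fun x => x 1 ^ 2 - x 2 ^ 2)) = m (fun x => x 1 ^ 2 - x 2 ^ 2) :=
      faceMean_symm swapEquiv'_image hs2 cd fun x => by simp [swapEquiv'_apply]
    have h2 := faceMean_smul (T := refTet) (P := a) (cd.differentiable (by simp)) (-1)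
    change m _ = -1 * m _ at h2
    linarith
  change m r = _
  rw [refSpace] at hr
  induction hr using Submodule.span_induction with
  | mem f hf =>
    rcases hf with rfl | rfl | rfl | rfl | rfl | rfl
    · have : m (fun _ => 1) = 1 := hR.faceMean_const 1
      rw [this]; norm_num
    · simp; linarith
    · simp; linarith
    · simp; linarith
    · rw [sq1]; simp
    · rw [sq2]; simp
  | zero =>
    have : m 0 = 0 := hR.faceMean_const 0
    rw [this]; simp
  | add f g hf hg ihf ihg =>
    have := faceMean_add (T := refTet) (P := a) ((contDiff_of_mem_refSpace hf).of_le one_le_infty)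
      ((contDiff_of_mem_refSpace hg).of_le one_le_infty)
    change m _ = m _ + m _ at this
    rw [this, ihf, ihg]; simp only [Pi.add_apply]; ring
  | smul c f hf ih =>
    have := faceMean_smul (T := refTet) (P := a)
      ((contDiff_of_mem_refSpace hf).differentiable (by simp)) c
    change m _ = c * m _ at this
    rw [this, ih]; simp only [Pi.smul_apply, smul_eq_mul]; ring

/-- The mean value of a shape function on a face is the mean of its values at the midpoints of the
edges of that face. -/
lemma IsShape.faceMean_eq (hT : IsTet T) {p : E3 → ℝ} (hp : IsShape T p) (hP : P ∈ T) :
    ∃ A B C : E3, A ≠ B ∧ B ≠ C ∧ C ≠ A ∧ face T P = {A, B, C} ∧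
      faceMean T P p (gradient p)
        = (p (midpoint ℝ A B) + p (midpoint ℝ B C) + p (midpoint ℝ C A)) / 3 := by
  obtain ⟨F, hF, hFP, hpF⟩ := hp.exists_normalized hP
  have hR := isTet_of_image F hF hT
  have hmid : ∀ x y z : E3, midpoint ℝ x y = z → midpoint ℝ (F x) (F y) = F z := by
    rintro x y _ rfl
    exact ((F : E3 →ᵃ[ℝ] E3).map_midpoint x y).symm
  have hmm : ∀ x y z : E3, (∀ i, (x i + y i) / 2 = z i) → midpoint ℝ x y = z := by
    intro x y z h
    rw [midpoint_eq_smul_add]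
    ext i
    rw [← h i]
    simp; ring
  refine ⟨F !₂[1, -1, -1], F !₂[-1, 1, -1], F !₂[-1, -1, 1], ?_, ?_, ?_, ?_, ?_⟩
  · rw [F.injective.ne_iff, Ne, vec3_ext_iff]; norm_num
  · rw [F.injective.ne_iff, Ne, vec3_ext_iff]; norm_num
  · rw [F.injective.ne_iff, Ne, vec3_ext_iff]; norm_num
  · rw [face, ← hF, ← hFP, ← Set.image_singleton, ← Set.image_sdiff F.injective]
    change F '' face refTet !₂[1, 1, 1] = _
    rw [refTet_face, Set.image_insert_eq, Set.image_insert_eq, Set.image_singleton]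
  · rw [faceMean_comp (hp.contDiff.differentiable (by simp)) F hF hFP, faceMean_refTet hR hpF,
      hmid _ _ !₂[0, 0, -1] (hmm _ _ _ fun i => by fin_cases i <;> simp),
      hmid _ _ !₂[-1, 0, 0] (hmm _ _ _ fun i => by fin_cases i <;> simp),
      hmid _ _ !₂[0, -1, 0] (hmm _ _ _ fun i => by fin_cases i <;> simp)]
    simp only [Function.comp_apply]; ring

lemma IsShape.faceMean_eq_zero (hT : IsTet T) {p : E3 → ℝ} (hp : IsShape T p) (hP : P ∈ T)
    (h0 : ∀ x ∈ face T P, ∀ y ∈ face T P, x ≠ y → p (midpoint ℝ x y) = 0) :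
    faceMean T P p (gradient p) = 0 := by
  obtain ⟨A, B, C, hAB, hBC, hCA, hF, he⟩ := hp.faceMean_eq hT hP
  have hA : A ∈ face T P := by rw [hF]; simp
  have hB : B ∈ face T P := by rw [hF]; simp
  have hC : C ∈ face T P := by rw [hF]; simp
  rw [he, h0 A hA B hB hAB, h0 B hB C hC hBC, h0 C hC A hA hCA]; norm_num

lemma IsShape.faceMean_eq_faceMean (hT : IsTet T) (hT' : IsTet T') {p p' : E3 → ℝ}
    (hp : IsShape T p) (hp' : IsShape T' p') (hP : P ∈ T) (hP' : P' ∈ T')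
    (hFF : face T P = face T' P')
    (h0 : ∀ x ∈ face T P, ∀ y ∈ face T P, x ≠ y →
      p (midpoint ℝ x y) = p' (midpoint ℝ x y)) :
    faceMean T P p (gradient p) = faceMean T' P' p' (gradient p') := by
  obtain ⟨A, B, C, hAB, hBC, hCA, hF, he⟩ := hp.faceMean_eq hT hP
  obtain ⟨A', B', C', hAB', hBC', hCA', hF', he'⟩ := hp'.faceMean_eq hT' hP'
  have hA : A ∈ face T P := by rw [hF]; simp
  have hB : B ∈ face T P := by rw [hF]; simp
  have hC : C ∈ face T P := by rw [hF]; simp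
  rw [he, he', h0 A hA B hB hAB, h0 B hB C hC hBC, h0 C hC A hA hCA]
  rw [hFF, hF'] at hA hB hC
  simp only [Set.mem_insert_iff, Set.mem_singleton_iff] at hA hB hC
  -- Both triples list the same face. Cyclic relabellings only permute the three summands; the
  -- others also reverse the edges, which needs symmetry of the midpoint.
  have s1 := midpoint_comm (R := ℝ) A' B'
  have s2 := midpoint_comm (R := ℝ) B' C'
  have s3 := midpoint_comm (R := ℝ) C' A'
  rcases hA with rfl | rfl | rfl <;> rcases hB with rfl | rfl | rfl <;>
    first
    | exact absurd rfl hAB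
    | (rcases hC with rfl | rfl | rfl <;>
        first
        | exact absurd rfl hBC
        | exact absurd rfl hCA
        | ring1
        | (rw [s1, s2, s3]; ring1))

end

section

variable {T T' : Finset E3} {P P' Q : E3} {U V : Set E3}

/-! ### Weak gradients -/

lemma gradient_coord (φ : E3 → ℝ) (x : E3) (i : Fin 3) :
    gradient φ x i = fderiv ℝ φ x (EuclideanSpace.single i 1) := by
  rw [← inner_gradient_eq, EuclideanSpace.inner_single_left]; simp

lemma MemH1.hasWeakGrad {f : E3 → ℝ} (h : MemH1 U f) : HasWeakGrad U f (weakGrad U f) := by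
  rw [weakGrad, dif_pos h]; exact h.choose_spec

lemma memLp_coord {μ : Measure E3} {G : E3 → E3} (hG : MemLp G 2 μ) (i : Fin 3) :
    MemLp (fun x => G x i) 2 μ :=
  (EuclideanSpace.proj i : E3 →L[ℝ] ℝ).comp_memLp' hG

lemma IsTest.gradient_continuous {φ : E3 → ℝ} (h : IsTest U φ) : Continuous (gradient φ) :=
  continuous_gradient (h.1.of_le one_le_infty)

lemma IsTest.memLp {φ : E3 → ℝ} (h : IsTest U φ) (μ : Measure E3) [IsFiniteMeasureOnCompacts μ] :
    MemLp φ 2 μ :=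
  h.1.continuous.memLp_of_hasCompactSupport h.2.1

lemma IsTest.hasCompactSupport_gradient {φ : E3 → ℝ} (h : IsTest U φ) :
    HasCompactSupport (gradient φ) := by
  have := h.2.1.fderiv ℝ
  exact this.comp_left (g := (InnerProductSpace.toDual ℝ E3).symm) (map_zero _)

lemma IsTest.memLp_gradient {φ : E3 → ℝ} (h : IsTest U φ) (μ : Measure E3)
    [IsFiniteMeasureOnCompacts μ] : MemLp (gradient φ) 2 μ :=
  h.gradient_continuous.memLp_of_hasCompactSupport h.hasCompactSupport_gradient

lemma IsTest.eq_zero {φ : E3 → ℝ} (h : IsTest U φ) {x : E3} (hx : x ∉ U) : φ x = 0 :=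
  image_eq_zero_of_notMem_tsupport fun h' => hx (h.2.2 h')

lemma IsTest.gradient_eq_zero {φ : E3 → ℝ} (h : IsTest U φ) {x : E3} (hx : x ∉ U) :
    gradient φ x = 0 := by
  have : fderiv ℝ φ x = 0 := by
    by_contra hne
    exact hx (h.2.2 (support_fderiv_subset ℝ hne))
  simp [gradient, this]

/-- The weak gradient is unique up to null sets. -/
lemma HasWeakGrad.ae_unique (hU : IsOpen U) {f : E3 → ℝ} {G G' : E3 → E3}
    (h : HasWeakGrad U f G) (h' : HasWeakGrad U f G') : G =ᵐ[volume.restrict U] G' := by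
  have key : ∀ i : Fin 3, ∀ᵐ x ∂volume.restrict U, G x i = G' x i := by
    intro i
    have hG := memLp_coord h.memLp_grad i
    have hG' := memLp_coord h'.memLp_grad i
    have hloc : LocallyIntegrableOn (fun x => G x i - G' x i) U := by
      have := (hG.sub hG').locallyIntegrable (by norm_num)
      exact locallyIntegrableOn_of_locallyIntegrable_restrict this
    have := hU.ae_eq_zero_of_integral_contDiff_smul_eq_zero (μ := volume) hloc ?_
    · rw [ae_restrict_iff' hU.measurableSet]
      filter_upwards [this] with x hx hxU
      exact sub_eq_zero.1 (hx hxU)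
    · intro g hg hgc hgU
      have ht : IsTest U g := ⟨hg, hgc, hgU⟩
      have e1 := h.integral_eq g ht i
      have e2 := h'.integral_eq g ht i
      rw [e1, neg_inj] at e2
      have hi : Integrable (fun x => G x i * g x) (volume.restrict U) :=
        hG.integrable_mul (ht.memLp _)
      have hi' : Integrable (fun x => G' x i * g x) (volume.restrict U) :=
        hG'.integrable_mul (ht.memLp _)
      have : ∫ x in U, g x • (G x i - G' x i) = 0 := by
        have e : ∀ x, g x • (G x i - G' x i) = G x i * g x - G' x i * g x := fun x => by
          simp only [smul_eq_mul]; ring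
        simp only [e]
        rw [integral_sub hi hi', e2, sub_self]
      rw [← this]
      refine (setIntegral_eq_integral_of_forall_compl_eq_zero fun x hx => ?_).symm
      rw [ht.eq_zero hx, zero_smul]
  filter_upwards [key 0, key 1, key 2] with x h0 h1 h2
  rw [vec3_ext_iff]; exact ⟨h0, h1, h2⟩

/-- A test function on `V` is a test function on `U`, and both integrands vanish off `V`. -/
lemma HasWeakGrad.mono {f : E3 → ℝ} {G : E3 → E3} (h : HasWeakGrad U f G) (hVU : V ⊆ U) :
    HasWeakGrad V f G where
  memLp_fun := h.memLp_fun.mono_measure (Measure.restrict_mono hVU le_rfl)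
  memLp_grad := h.memLp_grad.mono_measure (Measure.restrict_mono hVU le_rfl)
  integral_eq φ hφ i := by
    have := h.integral_eq φ ⟨hφ.1, hφ.2.1, hφ.2.2.trans hVU⟩ i
    have e1 : ∀ W, V ⊆ W → ∫ x in W, f x * gradient φ x i = ∫ x, f x * gradient φ x i :=
      fun W hW => setIntegral_eq_integral_of_forall_compl_eq_zero fun x hx => by
        rw [hφ.gradient_eq_zero fun h' => hx (hW h')]; simp
    have e2 : ∀ W, V ⊆ W → ∫ x in W, G x i * φ x = ∫ x, G x i * φ x :=
      fun W hW => setIntegral_eq_integral_of_forall_compl_eq_zero fun x hx => by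
        rw [hφ.eq_zero fun h' => hx (hW h')]; simp
    rw [e1 U hVU, e2 U hVU] at this
    rw [e1 V subset_rfl, e2 V subset_rfl, this]

lemma HasWeakGrad.congr {f f' : E3 → ℝ} {G G' : E3 → E3} (h : HasWeakGrad U f G)
    (hf : f =ᵐ[volume.restrict U] f') (hG : G =ᵐ[volume.restrict U] G') : HasWeakGrad U f' G' where
  memLp_fun := (memLp_congr_ae hf).1 h.memLp_fun
  memLp_grad := (memLp_congr_ae hG).1 h.memLp_grad
  integral_eq φ hφ i := by
    have e1 : ∫ x in U, f' x * gradient φ x i = ∫ x in U, f x * gradient φ x i :=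
      integral_congr_ae (by filter_upwards [hf] with x hx; rw [hx])
    have e2 : ∫ x in U, G' x i * φ x = ∫ x in U, G x i * φ x :=
      integral_congr_ae (by filter_upwards [hG] with x hx; rw [hx])
    rw [e1, e2, h.integral_eq φ hφ i]

lemma HasWeakGrad.add {f g : E3 → ℝ} {F G : E3 → E3} (hf : HasWeakGrad U f F)
    (hg : HasWeakGrad U g G) : HasWeakGrad U (f + g) (F + G) where
  memLp_fun := hf.memLp_fun.add hg.memLp_fun
  memLp_grad := hf.memLp_grad.add hg.memLp_grad
  integral_eq φ hφ i := by
    have h1 := hφ.memLp (volume.restrict U)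
    have h2 := memLp_coord (hφ.memLp_gradient (volume.restrict U)) i
    have e1 := hf.integral_eq φ hφ i
    have e2 := hg.integral_eq φ hφ i
    have i1 : Integrable (fun x => f x * gradient φ x i) (volume.restrict U) :=
      hf.memLp_fun.integrable_mul h2
    have i2 : Integrable (fun x => g x * gradient φ x i) (volume.restrict U) :=
      hg.memLp_fun.integrable_mul h2
    have i3 : Integrable (fun x => F x i * φ x) (volume.restrict U) :=
      (memLp_coord hf.memLp_grad i).integrable_mul h1
    have i4 : Integrable (fun x => G x i * φ x) (volume.restrict U) :=
      (memLp_coord hg.memLp_grad i).integrable_mul h1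
    simp only [Pi.add_apply, PiLp.add_apply, add_mul]
    rw [integral_add i1 i2, integral_add i3 i4, e1, e2]
    ring

lemma Continuous.memLp_cell {F : Type*} [NormedAddCommGroup F] {f : E3 → F}
    (hf : Continuous f) (T : Finset E3) : MemLp f 2 (volume.restrict (cell T)) := by
  have : MemLp f 2 (volume.restrict (convexHull ℝ (T : Set E3))) := by
    obtain ⟨C, hC⟩ := (isCompact_convexHull_coe T).exists_bound_of_continuousOn hf.continuousOn
    have : IsFiniteMeasure ((volume : Measure E3).restrict (convexHull ℝ (T : Set E3))) :=
      ⟨by simpa using (isCompact_convexHull_coe T).measure_lt_top⟩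
    refine MemLp.of_bound ?_ C ?_
    · exact hf.continuousOn.aestronglyMeasurable_of_isCompact (isCompact_convexHull_coe T)
        (isCompact_convexHull_coe T).measurableSet
    · rw [ae_restrict_iff' (isCompact_convexHull_coe T).measurableSet]
      exact Eventually.of_forall hC
  exact this.mono_measure (Measure.restrict_mono (cell_subset T) le_rfl)

lemma hasWeakGrad_of_contDiff {p : E3 → ℝ} (hp : ContDiff ℝ 1 p) (T : Finset E3) :
    HasWeakGrad (cell T) p (gradient p) where
  memLp_fun := Continuous.memLp_cell hp.continuous T
  memLp_grad := Continuous.memLp_cell (continuous_gradient hp) T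
  integral_eq φ hφ i := by
    have hp' := hp.continuous_fderiv one_ne_zero
    have hφ' := hφ.1.continuous_fderiv (by simp)
    have hpc := hp.continuous
    have hφc := hφ.1.continuous
    have s1 : HasCompactSupport fun x => fderiv ℝ φ x (EuclideanSpace.single i (1:ℝ)) :=
      hφ.2.1.fderiv_apply ℝ _
    simp only [gradient_coord]
    -- The test function has compact support in the cell, so the integrals extend to the whole
    -- space, where no boundary term arises.
    rw [setIntegral_eq_integral_of_forall_compl_eq_zero, setIntegral_eq_integral_of_forall_compl_eq_zero]
    · refine integral_mul_fderiv_eq_neg_fderiv_mul_of_integrable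
        (Continuous.integrable_of_hasCompactSupport (by fun_prop) hφ.2.1.mul_left)
        (Continuous.integrable_of_hasCompactSupport (by fun_prop) s1.mul_left)
        (Continuous.integrable_of_hasCompactSupport (by fun_prop) hφ.2.1.mul_left)
        (fun x _ => hp.differentiable one_ne_zero x)
        (fun x _ => hφ.1.differentiable (by simp) x)
    · intro x hx; rw [hφ.eq_zero hx, mul_zero]
    · intro x hx; rw [← gradient_coord, hφ.gradient_eq_zero hx]; simp

/-! ### Integration by parts against discontinuous fields -/

lemma integrable_of_bounded_of_compact {f : E3 → ℝ} (hf : Measurable f) {B : ℝ}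
    (hB : ∀ x, |f x| ≤ B) {K : Set E3} (hK : IsCompact K) (h0 : ∀ x ∉ K, f x = 0) :
    Integrable f := by
  rw [← integrableOn_iff_integrable_of_support_subset (s := K)]
  · exact Measure.integrableOn_of_bounded hK.measure_lt_top.ne hf.aestronglyMeasurable
      (Eventually.of_forall hB)
  · intro x hx; by_contra h; exact hx (h0 x h)

/-- The normalised bump is nonnegative with integral 1, so mollification is an average. The bound
supplies the majorants for dominated convergence. -/
lemma convolution_bump_bound (η : ContDiffBump (0 : E3)) {f : E3 → ℝ} {B : ℝ} (hB : ∀ x, |f x| ≤ B)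
    (x : E3) :
    |(convolution (η.normed volume) f (ContinuousLinearMap.lsmul ℝ ℝ) volume) x| ≤ B := by
  rw [convolution_def]
  have h : ∀ t, ‖(ContinuousLinearMap.lsmul ℝ ℝ) (η.normed volume t) (f (x - t))‖
      ≤ η.normed volume t * B := by
    intro t
    rw [ContinuousLinearMap.lsmul_apply, smul_eq_mul, norm_mul, Real.norm_eq_abs,
      abs_of_nonneg (η.nonneg_normed t)]
    exact mul_le_mul_of_nonneg_left (hB _) (η.nonneg_normed t)
  have := norm_integral_le_of_norm_le (η.integrable_normed.mul_const B) (Eventually.of_forall h)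
  rwa [integral_mul_const, η.integral_normed, one_mul] at this

/-- A bounded vector field `ψ` with compact support in `U` and distributional divergence `D` may
be used for integration by parts of functions in `H¹(U)`. -/
lemma HasWeakGrad.integral_field_eq_zero (hUf : volume U ≠ ⊤) (hU : IsOpen U)
    {q : E3 → ℝ} {G : E3 → E3} (hq : HasWeakGrad U q G) {ψ : E3 → E3} {D : E3 → ℝ} {K : Set E3}
    (hK : IsCompact K) (hKU : K ⊆ U) (hψm : Measurable ψ) (hDm : Measurable D) {B : ℝ}
    (hψB : ∀ x i, |ψ x i| ≤ B) (hDB : ∀ x, |D x| ≤ B) (hψK : ∀ x ∉ K, ψ x = 0)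
    (hDK : ∀ x ∉ K, D x = 0)
    (hdiv : ∀ φ : E3 → ℝ, ContDiff ℝ 1 φ → ∫ x, (fderiv ℝ φ x (ψ x) + D x * φ x) = 0) :
    ∫ x in U, (inner ℝ (ψ x) (G x) + D x * q x) = 0 := by
  -- Mollifying with radius at most `δ` keeps the support in a compact subset of `U`.
  obtain ⟨δ, hδ, hδU⟩ := hK.exists_cthickening_subset_open hU hKU
  -- The outer radius is twice the inner one: almost everywhere convergence of the mollifications
  -- needs shrinking radii with bounded ratio.
  let η : ℕ → ContDiffBump (0 : E3) := fun n =>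
    { rIn := δ / (2 * (n + 1))
      rOut := δ / (n + 1)
      rIn_pos := by positivity
      rIn_lt_rOut := by
        apply div_lt_div_of_pos_left hδ (by positivity)
        have : (0:ℝ) ≤ n := n.cast_nonneg
        linarith }
  have hη_lim : Tendsto (fun n => (η n).rOut) atTop (𝓝 0) := by
    have := (tendsto_one_div_add_atTop_nhds_zero_nat (𝕜 := ℝ)).const_mul δ
    simpa [η, div_eq_mul_inv] using this
  have hη_ratio : ∀ᶠ n in atTop, (η n).rOut ≤ 2 * (η n).rIn := by
    refine Eventually.of_forall fun n => le_of_eq ?_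
    simp only [η]; field_simp
  have hη_le : ∀ n, (η n).rOut ≤ δ := fun n => by
    simp only [η]
    apply div_le_self hδ.le
    have : (0:ℝ) ≤ n := n.cast_nonneg
    linarith
  let c : ℕ → (E3 → ℝ) → E3 → ℝ := fun n f =>
    convolution ((η n).normed volume) f (ContinuousLinearMap.lsmul ℝ ℝ) volume
  have hψc : ∀ i : Fin 3, Measurable fun x => ψ x i := fun i =>
    (EuclideanSpace.proj i : E3 →L[ℝ] ℝ).measurable.comp hψm
  have hψint : ∀ i : Fin 3, Integrable fun x => ψ x i := fun i =>
    integrable_of_bounded_of_compact (hψc i) (fun x => hψB x i) hK fun x hx => by rw [hψK x hx]; rfl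
  have hDint : Integrable D := integrable_of_bounded_of_compact hDm hDB hK hDK
  have htest : ∀ n (i : Fin 3), IsTest U (c n fun x => ψ x i) := by
    intro n i
    have hsub : Function.support (c n fun x => ψ x i) ⊆ Metric.cthickening δ K := by
      refine (support_convolution_subset _).trans ?_
      rintro _ ⟨a, ha, b, hb, rfl⟩
      rw [(η n).support_normed_eq] at ha
      have hbK : b ∈ K := by
        by_contra h; apply hb; simp [hψK b h]
      refine Metric.mem_cthickening_of_dist_le _ b δ K hbK ?_
      rw [mem_ball_zero_iff] at ha
      simpa [dist_eq_norm] using ha.le.trans (hη_le n)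
    have hts : tsupport (c n fun x => ψ x i) ⊆ Metric.cthickening δ K :=
      closure_minimal hsub Metric.isClosed_cthickening
    refine ⟨?_, ?_, hts.trans hδU⟩
    · exact (η n).hasCompactSupport_normed.contDiff_convolution_left _ (n := ⊤)
        ((η n).contDiff_normed) (hψint i).locallyIntegrable
    · exact HasCompactSupport.of_support_subset_isCompact hK.cthickening hsub
  -- Mollification commutes with the distributional divergence: the derivative falls on the bump,
  -- and `hdiv` is applied to the reflected bump `t ↦ η(x - t)`, whose gradient carries the opposite
  -- sign.
  have hdivc : ∀ n x, ∑ i : Fin 3, gradient (c n fun x => ψ x i) x i = c n D x := by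
    intro n x
    have hηd : ContDiff ℝ 1 ((η n).normed (volume : Measure E3)) := (η n).contDiff_normed
    have hηf := hηd.continuous_fderiv one_ne_zero
    have e1 : ∀ i : Fin 3, gradient (c n fun x => ψ x i) x i
        = ∫ t, fderiv ℝ ((η n).normed volume) (x - t) (EuclideanSpace.single i 1) * ψ t i := by
      intro i
      rw [gradient_coord]
      have := ((η n).hasCompactSupport_normed (μ := (volume : Measure E3))).hasFDerivAt_convolution_left
        (ContinuousLinearMap.lsmul ℝ ℝ) hηd (hψint i).locallyIntegrable x
      rw [this.fderiv, convolution_eq_swap]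
      rw [ContinuousLinearMap.integral_apply]
      · rfl
      · have hcv := ((η n).hasCompactSupport_normed (μ := (volume : Measure E3))).fderiv ℝ
          |>.convolutionExists_left ((ContinuousLinearMap.lsmul ℝ ℝ).precompL E3) hηf
            (hψint i).locallyIntegrable x
        exact hcv.integrable_swap
    have hint : ∀ i : Fin 3, Integrable fun t =>
        fderiv ℝ ((η n).normed volume) (x - t) (EuclideanSpace.single i 1) * ψ t i := by
      intro i
      have hs : HasCompactSupport fun t =>
          fderiv ℝ ((η n).normed (volume : Measure E3)) t (EuclideanSpace.single i (1:ℝ)) :=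
        ((η n).hasCompactSupport_normed).fderiv_apply ℝ _
      have hcv := hs.convolutionExists_left (ContinuousLinearMap.lsmul ℝ ℝ) (by fun_prop)
        (hψint i).locallyIntegrable x
      exact hcv.integrable_swap
    simp only [e1]
    rw [← integral_finsetSum _ fun i _ => hint i]
    have e2 : ∀ t, ∑ i : Fin 3, fderiv ℝ ((η n).normed volume) (x - t)
        (EuclideanSpace.single i 1) * ψ t i = fderiv ℝ ((η n).normed volume) (x - t) (ψ t) := by
      intro t
      have : ψ t = ∑ i : Fin 3, ψ t i • EuclideanSpace.single i (1:ℝ) := by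
        rw [vec3_ext_iff]; simp [Fin.sum_univ_three]
      conv_rhs => rw [this, map_sum]
      simp only [map_smul, smul_eq_mul, mul_comm]
    simp only [e2]
    have hφ : ContDiff ℝ 1 fun t => (η n).normed volume (x - t) :=
      hηd.comp (contDiff_const.sub contDiff_id)
    have key := hdiv _ hφ
    have e3 : ∀ t u, fderiv ℝ (fun t => (η n).normed volume (x - t)) t u
        = -fderiv ℝ ((η n).normed volume) (x - t) u := by
      intro t u
      have h1 : HasFDerivAt (fun t : E3 => x - t) (-ContinuousLinearMap.id ℝ E3) t :=
        (hasFDerivAt_id t).const_sub x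
      have := (hηd.differentiable one_ne_zero (x - t)).hasFDerivAt.comp t h1
      have e := this.fderiv
      rw [Function.comp_def] at e
      rw [e]; simp
    simp only [e3] at key
    have hint1 : Integrable fun t => fderiv ℝ ((η n).normed volume) (x - t) (ψ t) := by
      simp only [← e2]
      exact integrable_finsetSum _ fun i _ => hint i
    have hint2 : Integrable fun t => D t * (η n).normed volume (x - t) := by
      have hcv := ((η n).hasCompactSupport_normed (μ := (volume : Measure E3))).convolutionExists_left
        (ContinuousLinearMap.lsmul ℝ ℝ) (η n).continuous_normed hDint.locallyIntegrable x
      have := hcv.integrable_swap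
      simpa [mul_comm] using this
    have hneg : Integrable fun t => -fderiv ℝ ((η n).normed volume) (x - t) (ψ t) := hint1.neg
    rw [integral_add hneg hint2, integral_neg] at key
    have e4 : c n D x = ∫ t, D t * (η n).normed volume (x - t) := by
      change convolution _ _ _ _ x = _
      rw [convolution_eq_swap]
      simp [mul_comm]
    rw [e4]; linarith
  have hfin : IsFiniteMeasure ((volume : Measure E3).restrict U) := ⟨by simpa using hUf.lt_top⟩
  have hq1 : Integrable q (volume.restrict U) := hq.memLp_fun.integrable (by norm_num)
  have hG1 : ∀ i : Fin 3, Integrable (fun x => G x i) (volume.restrict U) := fun i =>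
    (memLp_coord hq.memLp_grad i).integrable (by norm_num)
  have hcmeas : ∀ n f, Integrable f → AEStronglyMeasurable (c n f) (volume.restrict U) := by
    intro n f hf
    have : ContDiff ℝ (0 : ℕ∞) (c n f) :=
      (η n).hasCompactSupport_normed.contDiff_convolution_left _
        ((η n).contDiff_normed) hf.locallyIntegrable
    exact this.continuous.aestronglyMeasurable
  -- The mollified components are test functions on `U`, so the defining identity of the weak
  -- gradient applies to each of them.
  have hn : ∀ n, ∫ x in U, (∑ i : Fin 3, G x i * c n (fun x => ψ x i) x + q x * c n D x) = 0 := by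
    intro n
    have hGi : ∀ i : Fin 3, Integrable (fun x => G x i * c n (fun x => ψ x i) x)
        (volume.restrict U) := fun i =>
      (memLp_coord hq.memLp_grad i).integrable_mul ((htest n i).memLp _)
    have hqi : ∀ i : Fin 3, Integrable (fun x => q x * gradient (c n fun x => ψ x i) x i)
        (volume.restrict U) := fun i =>
      hq.memLp_fun.integrable_mul (memLp_coord ((htest n i).memLp_gradient _) i)
    simp only [← hdivc, Finset.mul_sum]
    rw [integral_add (integrable_finsetSum _ fun i _ => hGi i)
      (integrable_finsetSum _ fun i _ => hqi i), integral_finsetSum _ fun i _ => hGi i,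
      integral_finsetSum _ fun i _ => hqi i, ← Finset.sum_add_distrib]
    refine Finset.sum_eq_zero fun i _ => ?_
    rw [hq.integral_eq _ (htest n i) i]; ring
  have hlim : ∀ f, Integrable f → ∀ᵐ x ∂(volume.restrict U),
      Tendsto (fun n => c n f x) atTop (𝓝 (f x)) := fun f hf =>
    ae_restrict_of_ae (ContDiffBump.ae_convolution_tendsto_right_of_locallyIntegrable hη_lim
      hη_ratio hf.locallyIntegrable)
  have hT := tendsto_integral_of_dominated_convergence (μ := volume.restrict U)
    (F := fun n x => ∑ i : Fin 3, G x i * c n (fun x => ψ x i) x + q x * c n D x)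
    (f := fun x => ∑ i : Fin 3, G x i * ψ x i + q x * D x)
    (fun x => ∑ i : Fin 3, |G x i| * B + |q x| * B) ?_ ?_ ?_ ?_
  · simp only [hn] at hT
    have := tendsto_nhds_unique hT tendsto_const_nhds
    rw [← this]
    congr 1; ext x
    simp [PiLp.inner_apply, mul_comm]
  · intro n
    refine AEStronglyMeasurable.add ?_ (hq1.1.mul (hcmeas n _ hDint))
    exact Finset.aestronglyMeasurable_fun_sum _ fun i _ => (hG1 i).1.mul (hcmeas n _ (hψint i))
  · exact (integrable_finsetSum _ fun i _ => (hG1 i).abs.mul_const B).add (hq1.abs.mul_const B)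
  · intro n
    refine Eventually.of_forall fun x => ?_
    refine (norm_add_le _ _).trans (add_le_add ((norm_sum_le _ _).trans
      (Finset.sum_le_sum fun i _ => ?_)) ?_)
    · rw [norm_mul]
      exact mul_le_mul_of_nonneg_left (convolution_bump_bound _ (fun x => hψB x i) x) (norm_nonneg _)
    · rw [norm_mul]
      exact mul_le_mul_of_nonneg_left (convolution_bump_bound _ hDB x) (norm_nonneg _)
  · filter_upwards [hlim _ hDint, ae_all_iff.2 fun i => hlim _ (hψint i)] with x h1 h2
    exact (tendsto_finsetSum _ fun i _ => tendsto_const_nhds.mul (h2 i)).add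
      (tendsto_const_nhds.mul h1)

end

section

variable {T T' : Finset E3} {P P' Q : E3} {Ω : Set E3}

/-! ### Geometry of faces -/

lemma finite_face (T : Finset E3) (P : E3) : (face T P).Finite := T.finite_toSet.sdiff

lemma IsTet.face_nonempty (h : IsTet T) : (face T P).Nonempty := by
  by_contra hne
  rw [Set.not_nonempty_iff_eq_empty, face, Set.sdiff_eq_empty] at hne
  have := Set.ncard_le_ncard hne
  rw [Set.ncard_coe_finset, Set.ncard_singleton, h.1] at this
  omega

/-- A relatively interior point of the convex hull of a finite set. -/
lemma exists_center {A : Set E3} (hA : A.Finite) (hne : A.Nonempty) :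
    ∃ z ∈ convexHull ℝ A, ∀ f : E3 →ᵃ[ℝ] ℝ, (∀ Q ∈ A, 0 ≤ f Q) → (∃ Q ∈ A, 0 < f Q) → 0 < f z := by
  lift A to Finset E3 using hA
  have hc : (0:ℝ) < A.card := by
    have : 0 < A.card := Finset.card_pos.2 hne
    exact_mod_cast this
  have hw : ∑ Q ∈ A, (A.card : ℝ)⁻¹ = 1 := by simp [hc.ne']
  -- The centroid gives positive weight to every point of `A`.
  refine ⟨∑ Q ∈ A, (A.card : ℝ)⁻¹ • Q, ?_, ?_⟩
  · exact (convex_convexHull ℝ _).sum_mem (fun _ _ => by positivity) hw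
      fun Q hQ => subset_convexHull ℝ _ hQ
  · intro f h0 hex
    have key : ∑ Q ∈ A, (A.card : ℝ)⁻¹ • Q
        = Finset.affineCombination ℝ A id (fun _ => (A.card : ℝ)⁻¹) := by
      rw [Finset.affineCombination_eq_linear_combination _ _ _ hw]; rfl
    rw [key, Finset.map_affineCombination _ _ _ hw,
      Finset.affineCombination_eq_linear_combination _ _ _ hw]
    refine Finset.sum_pos' (fun Q hQ => ?_) ?_
    · exact mul_nonneg (by positivity) (h0 Q hQ)
    · obtain ⟨Q, hQ, hpos⟩ := hex
      exact ⟨Q, hQ, mul_pos (by positivity) hpos⟩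

lemma affine_homoth (f : E3 →ᵃ[ℝ] ℝ) (z x : E3) (t : ℝ) :
    f (z + t • (x - z)) = (1 - t) * f z + t * f x := by
  have h1 := f.map_vadd z (t • (x - z))
  have h2 := f.linearMap_vsub x z
  simp only [vadd_eq_add, vsub_eq_sub, map_smul, smul_eq_mul] at h1 h2
  rw [add_comm z, h1, h2]; ring

lemma continuous_bary (T : Finset E3) (P : E3) : Continuous (bary T P) :=
  AffineMap.continuous_of_finiteDimensional _

lemma IsTet.bary_nonneg_of_mem_face (h : IsTet T) (hQ : Q ∈ T) {A : E3} (hA : A ∈ T) :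
    0 ≤ bary T Q A := by
  by_cases e : A = Q
  · rw [e, h.bary_self hQ]; norm_num
  · rw [h.bary_ne hQ hA e]

/-- The centre of a face has positive coordinates except for the opposite vertex. -/
lemma IsTet.exists_face_center (h : IsTet T) (h' : IsTet T')
    (hF : face T P = face T' P') :
    ∃ z ∈ convexHull ℝ (face T P), (∀ Q ∈ face T P, 0 < bary T Q z) ∧
      ∀ Q ∈ face T P, 0 < bary T' Q z := by
  obtain ⟨z, hz, hpos⟩ := exists_center (finite_face T P) h.face_nonempty
  refine ⟨z, hz, fun Q hQ => ?_, fun Q hQ => ?_⟩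
  · exact hpos _ (fun A hA => h.bary_nonneg_of_mem_face hQ.1 hA.1)
      ⟨Q, hQ, by rw [h.bary_self hQ.1]; norm_num⟩
  · have hQ' := hF ▸ hQ
    refine hpos _ (fun A hA => ?_) ⟨Q, hQ, by rw [h'.bary_self hQ'.1]; norm_num⟩
    rw [hF] at hA
    exact h'.bary_nonneg_of_mem_face hQ'.1 hA.1

lemma bary_eq_zero_of_mem_convexHull {A : Set E3} (f : E3 →ᵃ[ℝ] ℝ) (h : ∀ Q ∈ A, f Q = 0) {x : E3}
    (hx : x ∈ convexHull ℝ A) : f x = 0 := by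
  have : convexHull ℝ A ⊆ f ⁻¹' {0} :=
    convexHull_min (fun Q hQ => h Q hQ) ((convex_singleton (0:ℝ)).affine_preimage _)
  exact this hx

lemma IsTet.mem_convexHull_face (h : IsTet T) (hP : P ∈ T) {x : E3}
    (hx : x ∈ convexHull ℝ (T : Set E3)) (h0 : bary T P x = 0) : x ∈ convexHull ℝ (face T P) := by
  classical
  have hf : face T P = ((T.erase P : Finset E3) : Set E3) := by simp [face]
  have hs := h.sum_bary_smul x
  rw [← Finset.add_sum_erase T _ hP, h0, zero_smul, zero_add] at hs
  have hs1 := h.sum_bary x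
  rw [← Finset.add_sum_erase T _ hP, h0, zero_add] at hs1
  rw [hf, ← hs]
  exact (convex_convexHull ℝ _).sum_mem
    (fun Q hQ => h.mem_convexHull.1 hx Q (Finset.mem_of_mem_erase hQ)) hs1
    fun Q hQ => subset_convexHull ℝ _ hQ

/-! ### Adjacency in a conforming mesh -/

namespace TetMesh

variable {M : TetMesh Ω}

lemma isTet (M : TetMesh Ω) (hT : T ∈ M.tets) : IsTet T := ⟨M.card_eq T hT, M.indep T hT⟩

lemma isOpen (M : TetMesh Ω) : IsOpen Ω := by
  rw [← M.interior_iUnion]; exact isOpen_interior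

lemma convexHull_subset_iUnion (M : TetMesh Ω) (hT : T ∈ M.tets) :
    convexHull ℝ (T : Set E3) ⊆ ⋃ T ∈ M.tets, convexHull ℝ (T : Set E3) :=
  Set.subset_biUnion_of_mem (u := fun T : Finset E3 => convexHull ℝ (T : Set E3)) hT

lemma cell_subset (M : TetMesh Ω) (hT : T ∈ M.tets) : cell T ⊆ Ω := by
  rw [← M.interior_iUnion]
  exact interior_mono (M.convexHull_subset_iUnion hT)

lemma isCompact_iUnion (M : TetMesh Ω) :
    IsCompact (⋃ T ∈ M.tets, convexHull ℝ (T : Set E3)) :=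
  M.tets.isCompact_biUnion fun T _ => isCompact_convexHull_coe T

lemma volume_lt_top (M : TetMesh Ω) : volume Ω < ⊤ := by
  exact (measure_mono (M.interior_iUnion.symm.subset.trans interior_subset)).trans_lt
    M.isCompact_iUnion.measure_lt_top

lemma convexHull_subset_closure (M : TetMesh Ω) (hT : T ∈ M.tets) :
    convexHull ℝ (T : Set E3) ⊆ closure Ω := by
  rw [← (M.isTet hT).closure_cell]
  exact closure_mono (M.cell_subset hT)

lemma eq_of_subset (M : TetMesh Ω) (hT : T ∈ M.tets) (hT' : T' ∈ M.tets) (h : T ⊆ T') : T = T' :=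
  Finset.eq_of_subset_of_card_le h (by rw [(M.isTet hT).1, (M.isTet hT').1])

/-- Some vertex `Q` of `T` is missing from `T'`. Its coordinate vanishes on the hull of the common
vertices, which contains the intersection, but it is positive inside `T`. -/
lemma disjoint_cells (M : TetMesh Ω) (hT : T ∈ M.tets) (hT' : T' ∈ M.tets) (hne : T ≠ T') :
    Disjoint (cell T) (cell T') := by
  rw [Set.disjoint_left]
  intro x hx hx'
  have hmem := M.inter_subset T hT T' hT'
    ⟨RotatedQ1.cell_subset T hx, RotatedQ1.cell_subset T' hx'⟩
  obtain ⟨Q, hQ, hQ'⟩ : ∃ Q ∈ T, Q ∉ T' := by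
    by_contra! hall
    exact hne (M.eq_of_subset hT hT' hall)
  have h0 := bary_eq_zero_of_mem_convexHull (bary T Q)
    (fun A hA => (M.isTet hT).bary_ne hQ hA.1 fun e => hQ' (by rw [← e]; exact hA.2)) hmem
  exact ((M.isTet hT).mem_cell.1 hx Q hQ).ne' h0

/-- Different tetrahedra of a mesh lie on different sides of a common face. -/
lemma bary_neg (M : TetMesh Ω) (hT : T ∈ M.tets) (hT' : T' ∈ M.tets) (hne : T ≠ T') (hP : P ∈ T)
    (hP' : P' ∈ T') (hF : face T P = face T' P') : bary T' P' P < 0 := by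
  have h := M.isTet hT
  have h' := M.isTet hT'
  by_contra! hge
  have hpos : 0 < bary T' P' P := by
    refine lt_of_le_of_ne hge fun e => ?_
    have := h.bary_mul_bary h' hP hP' hF
    rw [← e] at this; norm_num at this
  obtain ⟨z, hz, hz1, hz2⟩ := h.exists_face_center h' hF
  -- If `P` were on the inner side of the face for `T'`, a short move from the face centre towards
  -- `P` would stay inside `T'` as well as `T`.
  have hev : ∀ᶠ t : ℝ in 𝓝[>] 0, ∀ Q ∈ T', 0 < bary T' Q (z + t • (P - z)) := by
    rw [Filter.eventually_all_finset]
    intro Q hQ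
    by_cases e : Q = P'
    · subst e
      filter_upwards [self_mem_nhdsWithin] with t ht
      have hz0 : bary T' Q z = 0 :=
        bary_eq_zero_of_mem_convexHull _ (fun A hA => h'.bary_face hQ (hF ▸ hA)) hz
      rw [affine_homoth, hz0, mul_zero, zero_add]
      exact mul_pos ht hpos
    · have hQF : Q ∈ face T P := by rw [hF]; exact ⟨hQ, e⟩
      have hc : Continuous fun t : ℝ => bary T' Q (z + t • (P - z)) :=
        (continuous_bary T' Q).comp (by fun_prop)
      have := hc.tendsto 0
      simp only [zero_smul, add_zero] at this
      exact nhdsWithin_le_nhds (this.eventually (lt_mem_nhds (hz2 Q hQF)))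
  have hsm : ∀ᶠ t : ℝ in 𝓝[>] 0, t < 1 := nhdsWithin_le_nhds (gt_mem_nhds one_pos)
  obtain ⟨t, ht, ht1, ht0⟩ := (hev.and (hsm.and self_mem_nhdsWithin)).exists
  have ht0 : 0 < t := ht0
  have hxT : z + t • (P - z) ∈ convexHull ℝ (T : Set E3) := by
    have hzT : z ∈ convexHull ℝ (T : Set E3) := convexHull_mono Set.sdiff_subset hz
    have := convex_convexHull ℝ (T : Set E3) hzT (subset_convexHull ℝ _ hP)
      (by linarith : (0:ℝ) ≤ 1 - t) ht0.le (by ring)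
    convert this using 1; module
  have hxT' := h'.mem_convexHull.2 fun Q hQ => (ht Q hQ).le
  have hPT' : P ∉ T' := by
    intro hPT'
    apply hne
    refine M.eq_of_subset hT hT' fun Q hQ => ?_
    by_cases e : Q = P
    · rwa [e]
    · have : Q ∈ face T P := ⟨hQ, e⟩
      rw [hF] at this; exact this.1
  -- Conformity puts the moved point into the hull of the common vertices. There the coordinate of
  -- `P` is zero, whereas the move has made it equal to `t`.
  have h0 := bary_eq_zero_of_mem_convexHull (bary T P)
    (fun A hA => h.bary_ne hP hA.1 fun e => hPT' (by rw [← e]; exact hA.2))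
    (M.inter_subset T hT T' hT' ⟨hxT, hxT'⟩)
  have hz0 : bary T P z = 0 :=
    bary_eq_zero_of_mem_convexHull _ (fun A hA => h.bary_face hP hA) hz
  rw [affine_homoth, hz0, h.bary_self hP] at h0
  linarith

/-- The area vectors of a common face of two tetrahedra are opposite. -/
lemma vol_mul_linear (M : TetMesh Ω) (hT : T ∈ M.tets) (hT' : T' ∈ M.tets) (hne : T ≠ T')
    (hP : P ∈ T) (hP' : P' ∈ T') (hF : face T P = face T' P') (u : E3) :
    vol T * (bary T P).linear u = -(vol T' * (bary T' P').linear u) := by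
  have h := M.isTet hT
  have h' := M.isTet hT'
  have hneg := M.bary_neg hT hT' hne hP hP' hF
  rw [h.vol_eq h' hP hP' hF, abs_of_neg hneg]
  have e : (bary T' P').linear u = bary T' P' P * (bary T P).linear u := by
    conv_lhs => rw [h.bary_proportional h' hP hP' hF]
    simp
  rw [e]; ring

/-- At most two tetrahedra share a face. -/
lemma eq_of_face_eq (M : TetMesh Ω) {T'' : Finset E3} {P'' : E3} (hT : T ∈ M.tets)
    (hT' : T' ∈ M.tets) (hT'' : T'' ∈ M.tets) (hP : P ∈ T) (hP' : P' ∈ T') (hP'' : P'' ∈ T'')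
    (h1 : T ≠ T') (h2 : T ≠ T'') (hF : face T P = face T' P') (hF' : face T P = face T'' P'') :
    T' = T'' := by
  by_contra hne
  have n1 := M.bary_neg hT hT' h1 hP hP' hF
  have n2 := M.bary_neg hT hT'' h2 hP hP'' hF'
  have n3 := M.bary_neg hT' hT'' hne hP' hP'' (hF.symm.trans hF')
  -- A third tetrahedron is impossible by signs: proportionality makes a negative number the product
  -- of two negative ones.
  have e := congrArg (fun f : E3 →ᵃ[ℝ] ℝ => f P)
    ((M.isTet hT').bary_proportional (M.isTet hT'') hP' hP'' (hF.symm.trans hF'))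
  simp only [AffineMap.coe_smul, Pi.smul_apply, smul_eq_mul] at e
  nlinarith [mul_pos_of_neg_of_neg n3 n1]

lemma vertex_eq_of_face_eq (hP : P ∈ T) (hF : face T P = face T P') : P = P' := by
  by_contra hne
  have : P ∈ face T P' := ⟨hP, hne⟩
  rw [← hF] at this
  exact this.2 rfl

/-- `T'` has four vertices and contains the three of the face, so exactly one is left over; it is
the opposite vertex. -/
lemma exists_face_eq (M : TetMesh Ω) (hT : T ∈ M.tets) (hT' : T' ∈ M.tets) (hne : T ≠ T')
    (hP : P ∈ T) (hsub : face T P ⊆ T') : ∃ P' ∈ T', face T' P' = face T P := by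
  classical
  have hf : face T P = ((T.erase P : Finset E3) : Set E3) := by simp [face]
  have hPT' : P ∉ T' := by
    intro hPT'
    apply hne
    refine M.eq_of_subset hT hT' fun Q hQ => ?_
    by_cases e : Q = P
    · rwa [e]
    · exact hsub ⟨hQ, e⟩
  rw [hf] at hsub ⊢
  have hsub' : T.erase P ⊆ T' := by exact_mod_cast hsub
  have hcard : (T' \ T.erase P).card = 1 := by
    rw [Finset.card_sdiff_of_subset hsub', Finset.card_erase_of_mem hP, (M.isTet hT).1,
      (M.isTet hT').1]
  obtain ⟨P', hP'⟩ := Finset.card_eq_one.1 hcard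
  have hmem : P' ∈ T' \ T.erase P := by rw [hP']; exact Finset.mem_singleton_self _
  refine ⟨P', (Finset.mem_sdiff.1 hmem).1, ?_⟩
  ext x
  simp only [face, Set.mem_sdiff, Finset.mem_coe, Set.mem_singleton_iff]
  constructor
  · rintro ⟨hx, hxP⟩
    by_contra hx'
    have : x ∈ T' \ T.erase P := Finset.mem_sdiff.2 ⟨hx, hx'⟩
    rw [hP', Finset.mem_singleton] at this
    exact hxP this
  · intro hx
    refine ⟨hsub' hx, ?_⟩
    rintro rfl
    exact (Finset.mem_sdiff.1 hmem).2 hx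

/-- A face that belongs to one tetrahedron only lies outside `Ω`. -/
lemma notMem_of_boundary_face (M : TetMesh Ω) (hT : T ∈ M.tets) (hP : P ∈ T)
    (hb : ∀ T' ∈ M.tets, T' ≠ T → ∀ P' ∈ T', face T' P' ≠ face T P) {x : E3}
    (hx : x ∈ convexHull ℝ (face T P)) : x ∉ Ω := by
  have h := M.isTet hT
  -- Relatively interior points come first. If such an `x` were in `Ω`, leaving `T` across the face
  -- would remain in `Ω`, hence meet some other tetrahedron containing `x`, and conformity would
  -- force that one to contain the whole face.
  have hrel : ∀ x ∈ convexHull ℝ (face T P), (∀ Q ∈ face T P, 0 < bary T Q x) → x ∉ Ω := by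
    intro x hx hpos hxΩ
    have hx0 : bary T P x = 0 :=
      bary_eq_zero_of_mem_convexHull _ (fun A hA => h.bary_face hP hA) hx
    have hc : Continuous fun t : ℝ => x + (-t) • (P - x) := by fun_prop
    have hlim : Tendsto (fun t : ℝ => x + (-t) • (P - x)) (𝓝[>] 0) (𝓝 x) := by
      have := hc.tendsto 0
      simp only [neg_zero, zero_smul, add_zero] at this
      exact this.mono_left nhdsWithin_le_nhds
    have hev : ∀ᶠ t : ℝ in 𝓝[>] 0, x + (-t) • (P - x) ∈ Ω :=
      hlim.eventually (M.isOpen.mem_nhds hxΩ)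
    have hnot : ∀ᶠ t : ℝ in 𝓝[>] 0, x + (-t) • (P - x) ∉ convexHull ℝ (T : Set E3) := by
      filter_upwards [self_mem_nhdsWithin] with t ht hmem
      have := h.mem_convexHull.1 hmem P hP
      rw [affine_homoth, hx0, h.bary_self hP] at this
      have : 0 < t := ht
      linarith
    -- There are finitely many tetrahedra, so a single one contains points of the ray arbitrarily
    -- close to `x`; being closed, it contains `x`.
    obtain ⟨T', hT', hfreq⟩ : ∃ T' ∈ M.tets,
        ∃ᶠ t : ℝ in 𝓝[>] 0, x + (-t) • (P - x) ∈ convexHull ℝ (T' : Set E3) := by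
      by_contra! hcon
      have hall : ∀ᶠ t : ℝ in 𝓝[>] 0, ∀ T' ∈ M.tets,
          x + (-t) • (P - x) ∉ convexHull ℝ (T' : Set E3) := by
        rw [Filter.eventually_all_finset]
        exact hcon
      obtain ⟨t, h1, h2⟩ := (hall.and hev).exists
      rw [← M.interior_iUnion] at h2
      obtain ⟨T', hT', hmem⟩ := Set.mem_iUnion₂.1 (interior_subset h2)
      exact h1 T' hT' hmem
    have hne : T' ≠ T := by
      rintro rfl
      obtain ⟨t, h1, h2⟩ := (hfreq.and_eventually hnot).exists
      exact h2 h1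
    have hxT' : x ∈ convexHull ℝ (T' : Set E3) :=
      (isCompact_convexHull_coe T').isClosed.mem_of_frequently_of_tendsto hfreq hlim
    have hxT : x ∈ convexHull ℝ (T : Set E3) := convexHull_mono Set.sdiff_subset hx
    have hmem := M.inter_subset T hT T' hT' ⟨hxT, hxT'⟩
    have hsub : face T P ⊆ T' := by
      intro Q hQ
      by_contra hQ'
      have := bary_eq_zero_of_mem_convexHull (bary T Q)
        (fun A hA => h.bary_ne hQ.1 hA.1 fun e => hQ' (by rw [← e]; exact hA.2)) hmem
      exact (hpos Q hQ).ne' this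
    obtain ⟨P', hP', hF⟩ := M.exists_face_eq hT hT' hne.symm hP hsub
    exact hb T' hT' hne P' hP' hF
  intro hxΩ
  -- An arbitrary face point in the open set `Ω` can be moved slightly towards the face centre,
  -- which makes it relatively interior without leaving `Ω`.
  obtain ⟨z, hz, hz1, -⟩ := h.exists_face_center h (P := P) rfl
  have hc : Continuous fun t : ℝ => x + t • (z - x) := by fun_prop
  have hlim : Tendsto (fun t : ℝ => x + t • (z - x)) (𝓝[>] 0) (𝓝 x) := by
    have := hc.tendsto 0
    simp only [zero_smul, add_zero] at this
    exact this.mono_left nhdsWithin_le_nhds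
  have hsm : ∀ᶠ t : ℝ in 𝓝[>] 0, t < 1 := nhdsWithin_le_nhds (gt_mem_nhds one_pos)
  obtain ⟨t, htΩ, ht1, ht0⟩ :=
    ((hlim.eventually (M.isOpen.mem_nhds hxΩ)).and (hsm.and self_mem_nhdsWithin)).exists
  have ht0 : 0 < t := ht0
  refine hrel _ ?_ ?_ htΩ
  · have := convex_convexHull ℝ (face T P) hx hz
      (by linarith : (0:ℝ) ≤ 1 - t) ht0.le (by ring)
    convert this using 1; module
  · intro Q hQ
    rw [affine_homoth]
    have h1 := h.mem_convexHull.1 (convexHull_mono Set.sdiff_subset hx) Q hQ.1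
    have h2 := mul_pos ht0 (hz1 Q hQ)
    have h3 : 0 ≤ (1 - t) * bary T Q x := mul_nonneg (by linarith) h1
    linarith

/-- Two tetrahedra with a common face, contracted towards the centre of the face, lie in `Ω`. -/
lemma homoth_subset (M : TetMesh Ω) (hT : T ∈ M.tets) (hT' : T' ∈ M.tets) (hne : T ≠ T')
    (hP : P ∈ T) (hP' : P' ∈ T') (hF : face T P = face T' P') {z : E3}
    (hz : z ∈ convexHull ℝ (face T P)) (hz1 : ∀ Q ∈ face T P, 0 < bary T Q z)
    (hz2 : ∀ Q ∈ face T P, 0 < bary T' Q z) {s : ℝ} (hs : 0 < s) (hs1 : s < 1) {y : E3}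
    (hy : y ∈ convexHull ℝ (T : Set E3)) : z + s • (y - z) ∈ Ω := by
  have h := M.isTet hT
  have h' := M.isTet hT'
  have hz0 : bary T P z = 0 :=
    bary_eq_zero_of_mem_convexHull _ (fun A hA => h.bary_face hP hA) hz
  have hpos : ∀ Q ∈ face T P, 0 < bary T Q (z + s • (y - z)) := by
    intro Q hQ
    rw [affine_homoth]
    have h1 := mul_pos (sub_pos.2 hs1) (hz1 Q hQ)
    have h2 := mul_nonneg hs.le (h.mem_convexHull.1 hy Q hQ.1)
    linarith
  have hyP := h.mem_convexHull.1 hy P hP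
  rcases hyP.lt_or_eq with hlt | heq
  · apply M.cell_subset hT
    rw [h.mem_cell]
    intro Q hQ
    by_cases e : Q = P
    · subst e
      rw [affine_homoth, hz0, mul_zero, zero_add]
      exact mul_pos hs hlt
    · exact hpos Q ⟨hQ, e⟩
  · have hyF := h.mem_convexHull_face hP hy heq.symm
    have hyT' : y ∈ convexHull ℝ (T' : Set E3) := by
      rw [hF] at hyF; exact convexHull_mono Set.sdiff_subset hyF
    -- An open set around the relative interior of the face that is covered by `T` and `T'`: the
    -- sign of the coordinate of `P` decides which of the two contains a given point.
    set N : Set E3 := {x | ∀ Q ∈ face T P, 0 < bary T Q x ∧ 0 < bary T' Q x} with hN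
    have hNopen : IsOpen N := by
      have : N = ⋂ Q ∈ face T P, {x | 0 < bary T Q x ∧ 0 < bary T' Q x} := by
        ext x; simp [hN]
      rw [this]
      exact (finite_face T P).isOpen_biInter fun Q _ =>
        (isOpen_lt continuous_const (continuous_bary T Q)).inter
          (isOpen_lt continuous_const (continuous_bary T' Q))
    have hNsub : N ⊆ ⋃ T ∈ M.tets, convexHull ℝ (T : Set E3) := by
      intro x hx
      rcases le_or_gt 0 (bary T P x) with hge | hlt
      · refine M.convexHull_subset_iUnion hT (h.mem_convexHull.2 fun Q hQ => ?_)
        by_cases e : Q = P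
        · rwa [e]
        · exact (hx Q ⟨hQ, e⟩).1.le
      · refine M.convexHull_subset_iUnion hT' (h'.mem_convexHull.2 fun Q hQ => ?_)
        by_cases e : Q = P'
        · subst e
          rw [h.bary_proportional h' hP hQ hF]
          simp only [AffineMap.coe_smul, Pi.smul_apply, smul_eq_mul]
          exact (mul_pos_of_neg_of_neg (M.bary_neg hT hT' hne hP hQ hF) hlt).le
        · have : Q ∈ face T P := by rw [hF]; exact ⟨hQ, e⟩
          exact (hx Q this).2.le
    rw [← M.interior_iUnion]
    refine interior_maximal hNsub hNopen fun Q hQ => ⟨hpos Q hQ, ?_⟩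
    rw [affine_homoth]
    have hQ' := hF ▸ hQ
    have h1 := mul_pos (sub_pos.2 hs1) (hz2 Q hQ)
    have h2 := mul_nonneg hs.le (h'.mem_convexHull.1 hyT' Q hQ'.1)
    linarith

end TetMesh

end

section

variable {T T' : Finset E3} {P P' Q : E3} {Ω : Set E3}

/-! ### Face means of functions in `H¹(Ω)` -/

/-- The radial field on `T` whose flux passes through the face opposite to `P` only. -/
def fluxField (T : Finset E3) (P : E3) : E3 → E3 :=
  (cell T).indicator fun x => (3 * vol T)⁻¹ • (x - P)

/-- The divergence of the radial field. -/
def fluxDiv (T : Finset E3) : E3 → ℝ := (cell T).indicator fun _ => (vol T)⁻¹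

lemma fluxField_integrand (h : IsTet T) (P : E3) (q : E3 → ℝ) (G : E3 → E3) :
    (fun x => inner ℝ (fluxField T P x) (G x) + fluxDiv T x * q x)
      = (cell T).indicator fun x => (3 * vol T)⁻¹ * (3 * q x + inner ℝ (x - P) (G x)) := by
  funext x
  have hV := h.vol_pos.ne'
  by_cases hx : x ∈ cell T
  · simp only [fluxField, fluxDiv, Set.indicator_of_mem hx, real_inner_smul_left]
    field_simp; ring
  · simp [fluxField, fluxDiv, Set.indicator_of_notMem hx]

lemma integral_fluxField (h : IsTet T) (P : E3) (q : E3 → ℝ) (G : E3 → E3) {U : Set E3}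
    (hU : cell T ⊆ U) :
    ∫ x in U, (inner ℝ (fluxField T P x) (G x) + fluxDiv T x * q x) = faceMean T P q G := by
  rw [fluxField_integrand h, setIntegral_indicator (measurableSet_cell T),
    Set.inter_eq_right.2 hU, integral_const_mul, faceMean, faceInt, div_eq_inv_mul]

lemma integrable_fluxField (h : IsTet T) (P : E3) (q : E3 → ℝ) (G : E3 → E3) {U : Set E3}
    (hi : IntegrableOn (fun x => 3 * q x + inner ℝ (x - P) (G x)) (cell T)) :
    IntegrableOn (fun x => inner ℝ (fluxField T P x) (G x) + fluxDiv T x * q x) U := by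
  rw [fluxField_integrand h]
  exact ((integrable_indicator_iff (measurableSet_cell T)).2 (hi.const_mul _)).integrableOn

lemma measurable_fluxField (T : Finset E3) (P : E3) : Measurable (fluxField T P) :=
  Measurable.indicator (by fun_prop) (measurableSet_cell T)

lemma measurable_fluxDiv (T : Finset E3) : Measurable (fluxDiv T) :=
  measurable_const.indicator (measurableSet_cell T)

lemma norm_fluxField_le (h : IsTet T) (hP : P ∈ T) (x : E3) :
    ‖fluxField T P x‖ ≤ (3 * vol T)⁻¹ * Metric.diam (convexHull ℝ (T : Set E3)) := by
  have hV := h.vol_pos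
  by_cases hx : x ∈ cell T
  · rw [fluxField, Set.indicator_of_mem hx, norm_smul, Real.norm_eq_abs, abs_of_pos (by positivity)]
    gcongr
    exact norm_sub_le_diam_convexHull (cell_subset T hx) (subset_convexHull ℝ _ hP)
  · rw [fluxField, Set.indicator_of_notMem hx, norm_zero]
    have := Metric.diam_nonneg (s := convexHull ℝ (T : Set E3))
    positivity

lemma abs_fluxDiv_le (h : IsTet T) (x : E3) : |fluxDiv T x| ≤ (vol T)⁻¹ := by
  have hV := h.vol_pos
  by_cases hx : x ∈ cell T
  · rw [fluxDiv, Set.indicator_of_mem hx, abs_of_pos (by positivity)]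
  · rw [fluxDiv, Set.indicator_of_notMem hx, abs_zero]; positivity

lemma continuousAt_fluxField {x : E3} (hx : x ∉ frontier (cell T)) :
    ContinuousAt (fluxField T P) x :=
  ContinuousOn.continuousAt_indicator (by fun_prop) hx

lemma continuousAt_fluxDiv {x : E3} (hx : x ∉ frontier (cell T)) :
    ContinuousAt (fluxDiv T) x :=
  ContinuousOn.continuousAt_indicator (by fun_prop) hx

lemma HasWeakGrad.integrableOn_faceInt {q : E3 → ℝ} {G : E3 → E3} {U : Set E3}
    (hq : HasWeakGrad U q G) (hU : cell T ⊆ U) :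
    IntegrableOn (fun x => 3 * q x + inner ℝ (x - P) (G x)) (cell T) := by
  have hq' := hq.mono hU
  have h1 : Integrable q (volume.restrict (cell T)) := hq'.memLp_fun.integrable (by norm_num)
  have h2 : Integrable G (volume.restrict (cell T)) := hq'.memLp_grad.integrable (by norm_num)
  refine (h1.const_mul 3).add ?_
  refine Integrable.mono' (h2.norm.const_mul (Metric.diam (insert P (cell T)))) ?_ ?_
  · exact (by fun_prop : Continuous fun x : E3 => x - P).aestronglyMeasurable.inner h2.1
  · rw [ae_restrict_iff' (measurableSet_cell T)]
    refine Eventually.of_forall fun x hx => (norm_inner_le_norm _ _).trans ?_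
    gcongr
    rw [← dist_eq_norm]
    exact Metric.dist_le_diam_of_mem ((isBounded_cell T).insert P) (Set.mem_insert_of_mem _ hx)
      (Set.mem_insert _ _)

lemma linCLM_homoth (z : E3) (t : ℝ) (ht : t ≠ 0) (u : E3) : linCLM (homoth z t ht) u = t • u := by
  have h := linCLM_sub (homoth z t ht) u 0
  rw [homoth_apply, homoth_apply, sub_zero] at h
  rw [h]; module

/-- The difference of the radial fields of two tetrahedra with a common face, contracted towards
`z`, satisfies the divergence theorem. -/
lemma scaled_field_divergence (h : IsTet T) (h' : IsTet T') (hP : P ∈ T) (hP' : P' ∈ T')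
    (hF : face T P = face T' P') (z : E3) {s : ℝ} (hs : s ≠ 0) {φ : E3 → ℝ} (hφ : ContDiff ℝ 1 φ) :
    ∫ x, (fderiv ℝ φ x (fluxField T P (z + s⁻¹ • (x - z)) - fluxField T' P' (z + s⁻¹ • (x - z)))
      + s⁻¹ * (fluxDiv T (z + s⁻¹ • (x - z)) - fluxDiv T' (z + s⁻¹ • (x - z))) * φ x) = 0 := by
  set F := homoth z s hs with hFdef
  set f : E3 → ℝ := fun x => fderiv ℝ φ x
      (fluxField T P (z + s⁻¹ • (x - z)) - fluxField T' P' (z + s⁻¹ • (x - z)))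
      + s⁻¹ * (fluxDiv T (z + s⁻¹ • (x - z)) - fluxDiv T' (z + s⁻¹ • (x - z))) * φ x with hf
  have hchange := integral_image_affineEquiv F MeasurableSet.univ f
  rw [Set.image_univ, F.surjective.range_eq, setIntegral_univ] at hchange
  rw [hchange]
  have hφF : ContDiff ℝ 1 (φ ∘ F) := hφ.comp ((contDiff_affineEquiv F).of_le one_le_infty)
  -- Substituting `x = F y` removes the contraction from the fields and moves it to `φ ∘ F`. The
  -- integral becomes a difference of two face means of one smooth function on the common face.
  have hint : ∀ y, f (F y) = s⁻¹ *
      ((inner ℝ (fluxField T P y) (gradient (φ ∘ F) y) + fluxDiv T y * (φ ∘ F) y)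
      - (inner ℝ (fluxField T' P' y) (gradient (φ ∘ F) y) + fluxDiv T' y * (φ ∘ F) y)) := by
    intro y
    have hinv : z + s⁻¹ • (F y - z) = y := by
      rw [hFdef, homoth_apply]; simp [smul_smul, hs]
    have hd := ((hφ.differentiable one_ne_zero (F y)).hasFDerivAt.comp y
      (hasFDerivAt_affineEquiv F y)).fderiv
    have hlin : ∀ u, linCLM F u = s • u := linCLM_homoth z s hs
    simp only [hf, hinv, inner_gradient_eq, hd, ContinuousLinearMap.comp_apply, hlin, map_smul,
      map_sub, smul_eq_mul, Function.comp_apply]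
    field_simp
    ring
  simp only [hint]
  have i1 := integrable_fluxField (U := Set.univ) h P _ _ (integrableOn_faceInt hφF T P)
  have i2 := integrable_fluxField (U := Set.univ) h' P' _ _ (integrableOn_faceInt hφF T' P')
  have e1 := integral_fluxField h P (φ ∘ F) (gradient (φ ∘ F)) (Set.subset_univ (cell T))
  have e2 := integral_fluxField h' P' (φ ∘ F) (gradient (φ ∘ F)) (Set.subset_univ (cell T'))
  rw [integral_const_mul, integral_sub i1 i2, e1, e2,
    h.faceMean_eq_faceMean h' hP hP' hF hφF, sub_self, mul_zero, mul_zero]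

namespace TetMesh

/-- The mean value of a function in `H¹(Ω)` on an interior face is the same from both sides. -/
lemma faceMean_eq_of_hasWeakGrad (M : TetMesh Ω) (hT : T ∈ M.tets) (hT' : T' ∈ M.tets)
    (hne : T ≠ T') (hP : P ∈ T) (hP' : P' ∈ T') (hF : face T P = face T' P') {q : E3 → ℝ}
    {G : E3 → E3} (hq : HasWeakGrad Ω q G) : faceMean T P q G = faceMean T' P' q G := by
  have h := M.isTet hT
  have h' := M.isTet hT'
  obtain ⟨z, hz, hz1, hz2⟩ := h.exists_face_center h' hF
  have hz1' : ∀ Q ∈ face T' P', 0 < bary T' Q z := fun Q hQ => hz2 Q (hF ▸ hQ)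
  have hz2' : ∀ Q ∈ face T' P', 0 < bary T Q z := fun Q hQ => hz1 Q (hF ▸ hQ)
  have hz' : z ∈ convexHull ℝ (face T' P') := hF ▸ hz
  -- Both radial fields have outward flux 1 through the common face and are tangential to their
  -- other faces. Their difference has a continuous normal component, so its distributional
  -- divergence is the piecewise constant function `Δ`, with no part on the faces.
  set Ψ : E3 → E3 := fun y => fluxField T P y - fluxField T' P' y with hΨ
  set Δ : E3 → ℝ := fun y => fluxDiv T y - fluxDiv T' y with hΔ
  obtain ⟨B, hB0, hΨB, hΔB⟩ : ∃ B, 0 ≤ B ∧ (∀ y, ‖Ψ y‖ ≤ B) ∧ ∀ y, |Δ y| ≤ B := by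
    have d1 := norm_fluxField_le h hP
    have d2 := norm_fluxField_le h' hP'
    have d3 := abs_fluxDiv_le h
    have d4 := abs_fluxDiv_le h'
    have hB1 : ∀ y, ‖Ψ y‖ ≤ _ := fun y => (norm_sub_le _ _).trans (add_le_add (d1 y) (d2 y))
    have hB2 : ∀ y, |Δ y| ≤ _ := fun y => (abs_sub _ _).trans (add_le_add (d3 y) (d4 y))
    exact ⟨_, ((norm_nonneg _).trans (hB1 0)).trans (le_max_left _ _),
      fun y => (hB1 y).trans (le_max_left _ _), fun y => (hB2 y).trans (le_max_right _ _)⟩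
  -- The support of `Ψ` touches the boundary of `T ∪ T'`, so the field is contracted before it is
  -- tested. The offset 2 keeps the factor at least `1 / 2`, hence its inverse at most 2, uniformly
  -- in `n`.
  let s : ℕ → ℝ := fun n => 1 - 1 / ((n : ℝ) + 2)
  have hs_half : ∀ n, 1 / 2 ≤ s n := fun n => by
    have : (1:ℝ) / (n + 2) ≤ 1 / 2 := by
      apply one_div_le_one_div_of_le (by norm_num)
      have : (0:ℝ) ≤ n := n.cast_nonneg
      linarith
    simp only [s]; linarith
  have hs_pos : ∀ n, 0 < s n := fun n => by linarith [hs_half n]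
  have hs_lt : ∀ n, s n < 1 := fun n => by
    have : (0:ℝ) < 1 / (n + 2) := by positivity
    simp only [s]; linarith
  have hs_lim : Tendsto s atTop (𝓝 1) := by
    have h1 : Tendsto (fun n : ℕ => 1 / (((n + 1 : ℕ) : ℝ) + 1)) atTop (𝓝 0) :=
      (tendsto_one_div_add_atTop_nhds_zero_nat (𝕜 := ℝ)).comp (tendsto_add_atTop_nat 1)
    have h2 := tendsto_const_nhds (x := (1:ℝ)).sub h1
    rw [sub_zero] at h2
    refine h2.congr fun n => ?_
    simp only [s]; push_cast; ring_nf
  let g : ℕ → E3 → E3 := fun n x => z + (s n)⁻¹ • (x - z)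
  have hg : ∀ n, Continuous (g n) := fun n => by simp only [g]; fun_prop
  have hg_inv : ∀ n x, z + s n • (g n x - z) = x := fun n x => by
    simp only [g, add_sub_cancel_left, smul_smul, mul_inv_cancel₀ (hs_pos n).ne', one_smul]
    abel
  have hinv_le : ∀ n, (s n)⁻¹ ≤ 2 := fun n => by
    rw [inv_le_comm₀ (hs_pos n) (by norm_num)]; linarith [hs_half n]
  have hzero : ∀ n, ∫ x in Ω, (inner ℝ (Ψ (g n x)) (G x) + (s n)⁻¹ * Δ (g n x) * q x) = 0 := by
    intro n
    have hsub : ∀ y ∈ convexHull ℝ (T : Set E3) ∪ convexHull ℝ (T' : Set E3),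
        z + s n • (y - z) ∈ Ω := by
      rintro y (hy | hy)
      · exact M.homoth_subset hT hT' hne hP hP' hF hz hz1 hz2 (hs_pos n) (hs_lt n) hy
      · exact M.homoth_subset hT' hT hne.symm hP' hP hF.symm hz' hz1' hz2' (hs_pos n) (hs_lt n) hy
    set K := (fun y => z + s n • (y - z)) ''
      (convexHull ℝ (T : Set E3) ∪ convexHull ℝ (T' : Set E3)) with hK
    have hKc : IsCompact K :=
      ((isCompact_convexHull_coe T).union (isCompact_convexHull_coe T')).image (by fun_prop)
    have hoff : ∀ x ∉ K, g n x ∉ cell T ∧ g n x ∉ cell T' := by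
      intro x hx
      constructor
      · exact fun hc => hx ⟨g n x, Or.inl (RotatedQ1.cell_subset T hc), hg_inv n x⟩
      · exact fun hc => hx ⟨g n x, Or.inr (RotatedQ1.cell_subset T' hc), hg_inv n x⟩
    have hΨm : Measurable Ψ := (measurable_fluxField T P).sub (measurable_fluxField T' P')
    have hΔm : Measurable Δ := (measurable_fluxDiv T).sub (measurable_fluxDiv T')
    refine hq.integral_field_eq_zero M.volume_lt_top.ne M.isOpen hKc ?_
      (hΨm.comp (hg n).measurable) ((hΔm.comp (hg n).measurable).const_mul _) (B := 2 * B)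
      ?_ ?_ ?_ ?_ ?_
    · rintro _ ⟨y, hy, rfl⟩; exact hsub y hy
    · intro x i
      have := (PiLp.norm_apply_le (Ψ (g n x)) i).trans (hΨB _)
      exact this.trans (by linarith)
    · intro x
      rw [abs_mul, abs_of_pos (inv_pos.2 (hs_pos n))]
      exact mul_le_mul (hinv_le n) (hΔB _) (abs_nonneg _) (by norm_num)
    · intro x hx
      simp [hΨ, fluxField, Set.indicator_of_notMem (hoff x hx).1,
        Set.indicator_of_notMem (hoff x hx).2]
    · intro x hx
      simp [hΔ, fluxDiv, Set.indicator_of_notMem (hoff x hx).1,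
        Set.indicator_of_notMem (hoff x hx).2]
    · intro φ hφ
      exact scaled_field_divergence h h' hP hP' hF z (hs_pos n).ne' hφ
  have hfin : IsFiniteMeasure ((volume : Measure E3).restrict Ω) :=
    ⟨by simpa using M.volume_lt_top⟩
  have hq1 : Integrable q (volume.restrict Ω) := hq.memLp_fun.integrable (by norm_num)
  have hG1 : Integrable G (volume.restrict Ω) := hq.memLp_grad.integrable (by norm_num)
  have hΨm : Measurable Ψ := (measurable_fluxField T P).sub (measurable_fluxField T' P')
  have hΔm : Measurable Δ := (measurable_fluxDiv T).sub (measurable_fluxDiv T')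
  have hlim := tendsto_integral_of_dominated_convergence (μ := volume.restrict Ω)
    (F := fun n x => inner ℝ (Ψ (g n x)) (G x) + (s n)⁻¹ * Δ (g n x) * q x)
    (f := fun x => inner ℝ (Ψ x) (G x) + Δ x * q x)
    (fun x => B * ‖G x‖ + 2 * B * |q x|) ?_ ?_ ?_ ?_
  · simp only [hzero] at hlim
    have h0 := tendsto_nhds_unique hlim tendsto_const_nhds
    have i1 := integrable_fluxField (U := Ω) h P _ _
      (hq.integrableOn_faceInt (P := P) (M.cell_subset hT))
    have i2 := integrable_fluxField (U := Ω) h' P' _ _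
      (hq.integrableOn_faceInt (P := P') (M.cell_subset hT'))
    have e1 := integral_fluxField h P q G (M.cell_subset hT)
    have e2 := integral_fluxField h' P' q G (M.cell_subset hT')
    have e3 : ∀ x, inner ℝ (Ψ x) (G x) + Δ x * q x =
        (inner ℝ (fluxField T P x) (G x) + fluxDiv T x * q x)
        - (inner ℝ (fluxField T' P' x) (G x) + fluxDiv T' x * q x) := by
      intro x; simp only [hΨ, hΔ, inner_sub_left]; ring
    simp only [e3] at h0
    rw [integral_sub i1 i2, e1, e2] at h0
    linarith
  · intro n
    exact ((hΨm.comp (hg n).measurable).aestronglyMeasurable.inner hG1.1).add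
      (((hΔm.comp (hg n).measurable).const_mul _).aestronglyMeasurable.mul hq1.1)
  · exact (hG1.norm.const_mul B).add (hq1.abs.const_mul (2 * B))
  · intro n
    refine Eventually.of_forall fun x => (norm_add_le _ _).trans (add_le_add ?_ ?_)
    · exact (norm_inner_le_norm _ _).trans (by gcongr; exact hΨB _)
    · rw [Real.norm_eq_abs, abs_mul, abs_mul, abs_of_pos (inv_pos.2 (hs_pos n))]
      gcongr
      · exact hinv_le n
      · exact hΔB _
  -- Convex sets have null frontier, and off the frontiers of the two cells the fields are
  -- continuous, so the contracted fields converge almost everywhere.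
  · have hfr : ∀ S : Finset E3, ∀ᵐ x ∂(volume.restrict Ω), x ∉ frontier (cell S) := fun S =>
      ae_restrict_of_ae (measure_eq_zero_iff_ae_notMem.1 ((convex_cell S).addHaar_frontier volume))
    filter_upwards [hfr T, hfr T'] with x hx hx'
    have hgx : Tendsto (fun n => g n x) atTop (𝓝 x) := by
      have := (tendsto_const_nhds (x := z)).add ((hs_lim.inv₀ one_ne_zero).smul_const (x - z))
      simpa [g] using this
    have c1 : ContinuousAt Ψ x := (continuousAt_fluxField hx).sub (continuousAt_fluxField hx')
    have c2 : ContinuousAt Δ x := (continuousAt_fluxDiv hx).sub (continuousAt_fluxDiv hx')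
    have l1 : Tendsto (fun n => Ψ (g n x)) atTop (𝓝 (Ψ x)) := c1.tendsto.comp hgx
    have l2 : Tendsto (fun n => Δ (g n x)) atTop (𝓝 (Δ x)) := c2.tendsto.comp hgx
    have l3 := ((hs_lim.inv₀ one_ne_zero).mul l2).mul_const (q x)
    rw [inv_one, one_mul] at l3
    exact (l1.inner tendsto_const_nhds).add l3

end TetMesh

end

section

variable {T T' : Finset E3} {P P' Q : E3} {Ω : Set E3}

/-! ### Real-valued `L²` norms -/

/-- The `L²` norm as a real number. -/
def l2 {F : Type*} [NormedAddCommGroup F] (μ : Measure E3) (f : E3 → F) : ℝ :=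
  Real.sqrt (∫ x, ‖f x‖ ^ 2 ∂μ)

section
variable {F : Type*} [NormedAddCommGroup F] {μ : Measure E3}

lemma l2_nonneg (f : E3 → F) : 0 ≤ l2 μ f := Real.sqrt_nonneg _

lemma l2_sq (f : E3 → F) : l2 μ f ^ 2 = ∫ x, ‖f x‖ ^ 2 ∂μ :=
  Real.sq_sqrt (integral_nonneg fun _ => by positivity)

lemma l2_eq_toReal {f : E3 → F} (hf : MemLp f 2 μ) : l2 μ f = (eLpNorm f 2 μ).toReal := by
  rw [hf.eLpNorm_eq_integral_rpow_norm (by norm_num) (by norm_num), ENNReal.toReal_ofReal]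
  · simp [l2, Real.sqrt_eq_rpow]
  · positivity

lemma l2_add_le {f g : E3 → F} (hf : MemLp f 2 μ) (hg : MemLp g 2 μ) :
    l2 μ (f + g) ≤ l2 μ f + l2 μ g := by
  rw [l2_eq_toReal hf, l2_eq_toReal hg, l2_eq_toReal (hf.add hg),
    ← ENNReal.toReal_add hf.eLpNorm_ne_top hg.eLpNorm_ne_top]
  exact ENNReal.toReal_mono (ENNReal.add_ne_top.2 ⟨hf.eLpNorm_ne_top, hg.eLpNorm_ne_top⟩)
    (eLpNorm_add_le hf.1 hg.1 (by norm_num))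

lemma l2_congr {f g : E3 → F} (h : f =ᵐ[μ] g) : l2 μ f = l2 μ g := by
  rw [l2, l2, integral_congr_ae (by filter_upwards [h] with x hx; rw [hx])]

lemma tendsto_l2 {f : E3 → F} {φ : ℕ → E3 → F} (hf : MemLp f 2 μ) (hφ : ∀ n, MemLp (φ n) 2 μ)
    (h : Tendsto (fun n => eLpNorm (f - φ n) 2 μ) atTop (𝓝 0)) :
    Tendsto (fun n => l2 μ (f - φ n)) atTop (𝓝 0) := by
  have := (ENNReal.tendsto_toReal ENNReal.zero_ne_top).comp h
  rw [ENNReal.toReal_zero] at this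
  exact this.congr fun n => (l2_eq_toReal (hf.sub (hφ n))).symm

/-- The Cauchy-Schwarz inequality. -/
lemma integral_norm_mul_norm_le {F' : Type*} [NormedAddCommGroup F'] {f : E3 → F} {g : E3 → F'}
    (hf : MemLp f 2 μ) (hg : MemLp g 2 μ) : ∫ x, ‖f x‖ * ‖g x‖ ∂μ ≤ l2 μ f * l2 μ g := by
  have := integral_mul_norm_le_Lp_mul_Lq (μ := μ) (f := fun x => ‖f x‖) (g := fun x => ‖g x‖)
    Real.HolderConjugate.two_two (by simpa using hf.norm) (by simpa using hg.norm)
  simpa [l2, Real.sqrt_eq_rpow] using this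

lemma integrable_norm_mul_norm {F' : Type*} [NormedAddCommGroup F'] {f : E3 → F} {g : E3 → F'}
    (hf : MemLp f 2 μ) (hg : MemLp g 2 μ) : Integrable (fun x => ‖f x‖ * ‖g x‖) μ :=
  hf.norm.integrable_mul hg.norm

lemma integral_norm_le_l2 [IsFiniteMeasure μ] {f : E3 → F} (hf : MemLp f 2 μ) :
    ∫ x, ‖f x‖ ∂μ ≤ Real.sqrt (μ.real Set.univ) * l2 μ f := by
  have := integral_norm_mul_norm_le (memLp_const (1:ℝ)) hf (μ := μ)
  simpa [l2] using this

lemma abs_integral_inner_le {f g : E3 → E3} (hf : MemLp f 2 μ) (hg : MemLp g 2 μ) :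
    |∫ x, inner ℝ (f x) (g x) ∂μ| ≤ l2 μ f * l2 μ g := by
  rw [← Real.norm_eq_abs]
  exact (norm_integral_le_of_norm_le (integrable_norm_mul_norm hf hg)
    (Eventually.of_forall fun x => norm_inner_le_norm (f x) (g x))).trans
    (integral_norm_mul_norm_le hf hg)

lemma integrable_inner {f g : E3 → E3} (hf : MemLp f 2 μ) (hg : MemLp g 2 μ) :
    Integrable (fun x => inner ℝ (f x) (g x)) μ :=
  (integrable_norm_mul_norm hf hg).mono' (hf.1.inner hg.1)
    (Eventually.of_forall fun x => norm_inner_le_norm (f x) (g x))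

lemma abs_integral_mul_le {f g : E3 → ℝ} (hf : MemLp f 2 μ) (hg : MemLp g 2 μ) :
    |∫ x, f x * g x ∂μ| ≤ l2 μ f * l2 μ g := by
  rw [← Real.norm_eq_abs]
  exact (norm_integral_le_of_norm_le (integrable_norm_mul_norm hf hg)
    (Eventually.of_forall fun x => (norm_mul (f x) (g x)).le)).trans
    (integral_norm_mul_norm_le hf hg)

end

lemma measureReal_restrict_cell (T : Finset E3) :
    ((volume : Measure E3).restrict (cell T)).real Set.univ = vol T := by
  simp [vol]

/-- The measure on a cell. -/
abbrev cellMeasure (T : Finset E3) : Measure E3 := (volume : Measure E3).restrict (cell T)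

lemma abs_integral_radial_le {G : E3 → E3} (hG : MemLp G 2 (cellMeasure T)) {d : ℝ}
    (hd : ∀ x ∈ cell T, ‖x - P‖ ≤ d) :
    |∫ x in cell T, inner ℝ (x - P) (G x)| ≤ d * (Real.sqrt (vol T) * l2 (cellMeasure T) G) := by
  have h1 := integral_norm_le_l2 hG
  rw [measureReal_restrict_cell] at h1
  -- A point of the cell forces `0 ≤ d`; for an empty cell both sides vanish.
  by_cases hne : (cell T).Nonempty
  · obtain ⟨y, hy⟩ := hne
    have hd0 : 0 ≤ d := (norm_nonneg _).trans (hd y hy)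
    rw [← Real.norm_eq_abs]
    refine (norm_integral_le_of_norm_le ((hG.integrable (by norm_num)).norm.const_mul d) ?_).trans ?_
    · rw [ae_restrict_iff' (measurableSet_cell T)]
      refine Eventually.of_forall fun x hx => (norm_inner_le_norm _ _).trans ?_
      gcongr
      exact hd x hx
    · rw [integral_const_mul]; gcongr
  · rw [Set.not_nonempty_iff_eq_empty] at hne
    simp [vol, hne]

lemma faceInt_sub {f g : E3 → ℝ} {F G : E3 → E3} (hf : MemLp f 2 (cellMeasure T))
    (hg : MemLp g 2 (cellMeasure T)) (hF : MemLp F 2 (cellMeasure T))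
    (hG : MemLp G 2 (cellMeasure T)) :
    faceInt T P f F - faceInt T P g G = 3 * (∫ x in cell T, (f - g) x)
      + ∫ x in cell T, inner ℝ (x - P) ((F - G) x) := by
  have hx : MemLp (fun x : E3 => x - P) 2 (cellMeasure T) :=
    Continuous.memLp_cell (by fun_prop) T
  have i1 : Integrable f (cellMeasure T) := hf.integrable (by norm_num)
  have i2 : Integrable g (cellMeasure T) := hg.integrable (by norm_num)
  simp only [Pi.sub_apply, inner_sub_right]
  rw [faceInt, faceInt, integral_add (i1.const_mul 3) (integrable_inner hx hF),
    integral_add (i2.const_mul 3) (integrable_inner hx hG), integral_sub i1 i2,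
    integral_sub (integrable_inner hx hF) (integrable_inner hx hG), integral_const_mul,
    integral_const_mul]
  ring

/-- Face integrals depend continuously on the function in `H¹`. -/
lemma tendsto_faceInt {f : E3 → ℝ} {G : E3 → E3} {φ : ℕ → E3 → ℝ} {γ : ℕ → E3 → E3}
    (hf : MemLp f 2 (cellMeasure T)) (hG : MemLp G 2 (cellMeasure T))
    (hφ : ∀ n, MemLp (φ n) 2 (cellMeasure T)) (hγ : ∀ n, MemLp (γ n) 2 (cellMeasure T))
    (h1 : Tendsto (fun n => l2 (cellMeasure T) (f - φ n)) atTop (𝓝 0))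
    (h2 : Tendsto (fun n => l2 (cellMeasure T) (G - γ n)) atTop (𝓝 0)) :
    Tendsto (fun n => faceInt T P (φ n) (γ n)) atTop (𝓝 (faceInt T P f G)) := by
  rw [tendsto_iff_dist_tendsto_zero]
  set d := Metric.diam (insert P (cell T))
  have hd : ∀ x ∈ cell T, ‖x - P‖ ≤ d := fun x hx => by
    rw [← dist_eq_norm]
    exact Metric.dist_le_diam_of_mem ((isBounded_cell T).insert P) (Set.mem_insert_of_mem _ hx)
      (Set.mem_insert _ _)
  have hb : Tendsto (fun n => 3 * (Real.sqrt (vol T) * l2 (cellMeasure T) (f - φ n))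
      + d * (Real.sqrt (vol T) * l2 (cellMeasure T) (G - γ n))) atTop (𝓝 0) := by
    have := ((h1.const_mul (Real.sqrt (vol T))).const_mul 3).add
      ((h2.const_mul (Real.sqrt (vol T))).const_mul d)
    simpa using this
  refine squeeze_zero (fun _ => dist_nonneg) (fun n => ?_) hb
  rw [dist_comm, Real.dist_eq, faceInt_sub hf (hφ n) hG (hγ n)]
  refine (abs_add_le _ _).trans (add_le_add ?_ (abs_integral_radial_le (hG.sub (hγ n)) hd))
  rw [abs_mul, abs_of_pos (by norm_num : (0:ℝ) < 3)]
  have := integral_norm_le_l2 (hf.sub (hφ n))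
  rw [measureReal_restrict_cell] at this
  have h3 := (norm_integral_le_integral_norm (f - φ n) (μ := cellMeasure T)).trans this
  rw [Real.norm_eq_abs] at h3
  linarith

/-- The function `f` with gradient `G` is a limit of smooth functions in `H¹` of the cell. -/
def SmoothLimit (T : Finset E3) (f : E3 → ℝ) (G : E3 → E3) : Prop :=
  MemLp f 2 (cellMeasure T) ∧ MemLp G 2 (cellMeasure T) ∧ ∃ φ : ℕ → E3 → ℝ,
    (∀ n, ContDiff ℝ 1 (φ n)) ∧
    Tendsto (fun n => l2 (cellMeasure T) (f - φ n)) atTop (𝓝 0) ∧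
    Tendsto (fun n => l2 (cellMeasure T) (G - gradient (φ n))) atTop (𝓝 0)

lemma eLpNorm_tendsto_mono {F : Type*} [NormedAddCommGroup F] {f : ℕ → E3 → F} {μ ν : Measure E3}
    (h : μ ≤ ν) (hf : Tendsto (fun n => eLpNorm (f n) 2 ν) atTop (𝓝 0)) :
    Tendsto (fun n => eLpNorm (f n) 2 μ) atTop (𝓝 0) :=
  tendsto_of_tendsto_of_tendsto_of_le_of_le tendsto_const_nhds hf (fun _ => bot_le)
    fun _ => eLpNorm_mono_measure _ h

namespace TetMesh

lemma exists_approx (M : TetMesh Ω) {w : E3 → ℝ} (hw : MemH10 Ω w) :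
    ∃ φ : ℕ → E3 → ℝ, (∀ n, IsTest Ω (φ n)) ∧ ∀ T ∈ M.tets,
      Tendsto (fun n => l2 (cellMeasure T) (w - φ n)) atTop (𝓝 0) ∧
      Tendsto (fun n => l2 (cellMeasure T) (weakGrad Ω w - gradient (φ n))) atTop (𝓝 0) := by
  obtain ⟨hw1, φ, hφ, h1, h2⟩ := hw
  refine ⟨φ, hφ, fun T hT => ?_⟩
  have hm : cellMeasure T ≤ volume.restrict Ω := Measure.restrict_mono (M.cell_subset hT) le_rfl
  have hg := hw1.hasWeakGrad
  exact ⟨tendsto_l2 (hg.memLp_fun.mono_measure hm) (fun n => (hφ n).memLp _)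
      (eLpNorm_tendsto_mono hm h1),
    tendsto_l2 (hg.memLp_grad.mono_measure hm) (fun n => (hφ n).memLp_gradient _)
      (eLpNorm_tendsto_mono hm h2)⟩

/-- Functions in `H¹₀(Ω)` have mean value zero on boundary faces. -/
lemma faceMean_eq_zero_of_memH10 (M : TetMesh Ω) (hT : T ∈ M.tets) (hP : P ∈ T)
    (hb : ∀ T' ∈ M.tets, T' ≠ T → ∀ P' ∈ T', face T' P' ≠ face T P) {w : E3 → ℝ}
    (hw : MemH10 Ω w) : faceMean T P w (weakGrad Ω w) = 0 := by
  obtain ⟨φ, hφ, hlim⟩ := M.exists_approx hw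
  have hg := hw.1.hasWeakGrad.mono (M.cell_subset hT)
  have ht := tendsto_faceInt (P := P) hg.memLp_fun hg.memLp_grad (fun n => (hφ n).memLp _)
    (fun n => (hφ n).memLp_gradient _) (hlim T hT).1 (hlim T hT).2
  have h0 : ∀ n, faceInt T P (φ n) (gradient (φ n)) = 0 := fun n =>
    (M.isTet hT).faceInt_eq_zero hP ((hφ n).1.of_le one_le_infty) fun x hx =>
      (hφ n).eq_zero (M.notMem_of_boundary_face hT hP hb hx)
  simp only [h0] at ht
  rw [faceMean, tendsto_nhds_unique ht tendsto_const_nhds, zero_div]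

/-- Membership in `H¹₀(Ω)` provides smooth approximants and shape functions are smooth already, so
Poincaré's inequality reaches `W + W_h` without a density theorem on the cell. -/
lemma smoothLimit_add (M : TetMesh Ω) (hT : T ∈ M.tets) {w p : E3 → ℝ} (hw : MemH10 Ω w)
    (hp : ContDiff ℝ 1 p) : SmoothLimit T (w + p) (weakGrad Ω w + gradient p) := by
  obtain ⟨φ, hφ, hlim⟩ := M.exists_approx hw
  have hg := (hw.1.hasWeakGrad.mono (M.cell_subset hT)).add (hasWeakGrad_of_contDiff hp T)
  refine ⟨hg.memLp_fun, hg.memLp_grad, fun n => φ n + p,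
    fun n => ((hφ n).1.of_le one_le_infty).add hp, ?_, ?_⟩
  · simpa only [add_sub_add_right_eq_sub] using (hlim T hT).1
  · have : ∀ n, gradient (φ n + p) = gradient (φ n) + gradient p := fun n =>
      gradient_add ((hφ n).1.differentiable (by simp)) (hp.differentiable one_ne_zero)
    simpa only [this, add_sub_add_right_eq_sub] using (hlim T hT).2

end TetMesh

end

section

variable {T T' : Finset E3} {P P' Q : E3} {Ω : Set E3}

/-! ### The Poincaré inequality on a tetrahedron -/

lemma lintegral_image_affineEquiv (F : E3 ≃ᵃ[ℝ] E3) {s : Set E3} (hs : MeasurableSet s)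
    (f : E3 → ENNReal) (hf : Measurable f) :
    ∫⁻ x in F '' s, f x = ENNReal.ofReal (jac F) * ∫⁻ x in s, f (F x) := by
  rw [lintegral_image_eq_lintegral_abs_det_fderiv_mul volume hs
    (fun x _ => (hasFDerivAt_affineEquiv F x).hasFDerivWithinAt) F.injective.injOn]
  have hm : Measurable fun x => f (F x) := hf.comp (contDiff_affineEquiv F).continuous.measurable
  rw [lintegral_const_mul _ hm]
  rfl

/-- The homothety about `x` maps the convex cell into itself, with Jacobian `t ^ 3 ≥ 1 / 8`. -/
lemma lintegral_segment_le {x : E3} (hx : x ∈ cell T) {t : ℝ} (ht : 1 / 2 ≤ t) (ht1 : t ≤ 1)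
    {g : E3 → ENNReal} (hg : Measurable g) :
    ∫⁻ y in cell T, g (x + t • (y - x)) ≤ 8 * ∫⁻ y in cell T, g y := by
  have ht0 : 0 < t := by linarith
  have hsub : homoth x t ht0.ne' '' cell T ⊆ cell T := by
    rintro _ ⟨y, hy, rfl⟩
    rw [homoth_apply]
    have := convex_cell T hx hy (by linarith : (0:ℝ) ≤ 1 - t) ht0.le (by ring)
    convert this using 1; module
  have h1 := lintegral_image_affineEquiv (homoth x t ht0.ne') (measurableSet_cell T) g hg
  rw [jac_homoth, abs_of_pos ht0] at h1
  simp only [homoth_apply x t ht0.ne' _] at h1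
  have h2 : ENNReal.ofReal (t ^ 3) * ∫⁻ y in cell T, g (x + t • (y - x)) ≤ ∫⁻ y in cell T, g y := by
    rw [← h1]
    exact lintegral_mono_set (by simpa only [homoth_apply] using hsub)
  have h8 : (1 : ENNReal) ≤ 8 * ENNReal.ofReal (t ^ 3) := by
    have : (8 : ENNReal) = ENNReal.ofReal 8 := by simp
    rw [this, ← ENNReal.ofReal_mul (by norm_num), ← ENNReal.ofReal_one]
    apply ENNReal.ofReal_le_ofReal
    have : (1 / 2 : ℝ) ^ 3 ≤ t ^ 3 := by gcongr
    linarith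
  calc ∫⁻ y in cell T, g (x + t • (y - x))
      = 1 * ∫⁻ y in cell T, g (x + t • (y - x)) := (one_mul _).symm
    _ ≤ 8 * ENNReal.ofReal (t ^ 3) * ∫⁻ y in cell T, g (x + t • (y - x)) := by gcongr
    _ ≤ 8 * ∫⁻ y in cell T, g y := by rw [mul_assoc]; gcongr

/-- For `t ≤ 1 / 2` the roles of `x` and `y` are exchanged, which turns the factor into `1 - t ≥ 1 /
2` and avoids the degenerating Jacobian. -/
lemma lintegral_lintegral_segment_le {t : ℝ} (ht0 : 0 ≤ t) (ht1 : t ≤ 1)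
    {g : E3 → ENNReal} (hg : Measurable g) :
    ∫⁻ x in cell T, ∫⁻ y in cell T, g (x + t • (y - x))
      ≤ 8 * (∫⁻ y in cell T, g y) * volume (cell T) := by
  rcases le_total (1 / 2) t with ht | ht
  · calc ∫⁻ x in cell T, ∫⁻ y in cell T, g (x + t • (y - x))
        ≤ ∫⁻ _ in cell T, 8 * ∫⁻ y in cell T, g y :=
          setLIntegral_mono measurable_const fun x hx => lintegral_segment_le hx ht ht1 hg
      _ = _ := by simp
  · rw [lintegral_lintegral_swap]
    · calc ∫⁻ y in cell T, ∫⁻ x in cell T, g (x + t • (y - x))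
          ≤ ∫⁻ _ in cell T, 8 * ∫⁻ y in cell T, g y := by
            refine setLIntegral_mono measurable_const fun y hy => ?_
            have e : ∀ x, x + t • (y - x) = y + (1 - t) • (x - y) := fun x => by module
            simp only [e]
            exact lintegral_segment_le hy (by linarith) (by linarith) hg
        _ = _ := by simp
    · refine (hg.comp ?_).aemeasurable
      fun_prop

lemma sq_sub_le_integral_segment {f : E3 → ℝ} (hf : ContDiff ℝ 1 f) (x y : E3) :
    (f x - f y) ^ 2 ≤ ‖y - x‖ ^ 2 * ∫ t in (0:ℝ)..1, ‖gradient f (x + t • (y - x))‖ ^ 2 := by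
  have hgc := continuous_gradient hf
  have hfc := hf.continuous_fderiv one_ne_zero
  have hder : ∀ t : ℝ, HasDerivAt (fun t : ℝ => f (x + t • (y - x)))
      (fderiv ℝ f (x + t • (y - x)) (y - x)) t := by
    intro t
    have h1 : HasDerivAt (fun t : ℝ => x + t • (y - x)) (y - x) t := by
      simpa using ((hasDerivAt_id t).smul_const (y - x)).const_add x
    exact (hf.differentiable one_ne_zero _).hasFDerivAt.comp_hasDerivAt t h1
  set u : ℝ → ℝ := fun t => fderiv ℝ f (x + t • (y - x)) (y - x) with hu
  have huc : Continuous u := by simp only [hu]; fun_prop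
  have hftc : ∫ t in (0:ℝ)..1, u t = f y - f x := by
    rw [intervalIntegral.integral_eq_sub_of_hasDerivAt (fun t _ => hder t)
      (huc.intervalIntegrable _ _)]
    simp
  set c := f y - f x with hc
  -- The square of the mean is bounded by the mean of the square because the variance of the
  -- directional derivative is nonnegative.
  have hvar : 0 ≤ ∫ t in (0:ℝ)..1, (u t - c) ^ 2 :=
    intervalIntegral.integral_nonneg zero_le_one fun _ _ => sq_nonneg _
  have hexp : ∫ t in (0:ℝ)..1, (u t - c) ^ 2 = (∫ t in (0:ℝ)..1, u t ^ 2) - c ^ 2 := by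
    have e : ∀ t, (u t - c) ^ 2 = u t ^ 2 - (2 * c * u t - c ^ 2) := fun t => by ring
    simp only [e]
    have c1 : Continuous fun t => u t ^ 2 := by fun_prop
    have c2 : Continuous fun t => 2 * c * u t := by fun_prop
    have c3 : Continuous fun t => 2 * c * u t - c ^ 2 := by fun_prop
    rw [intervalIntegral.integral_sub (c1.intervalIntegrable _ _) (c3.intervalIntegrable _ _),
      intervalIntegral.integral_sub (c2.intervalIntegrable _ _)
      (continuous_const.intervalIntegrable _ _), intervalIntegral.integral_const_mul, hftc]
    simp; ring
  have hle : ∫ t in (0:ℝ)..1, u t ^ 2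
      ≤ ∫ t in (0:ℝ)..1, ‖y - x‖ ^ 2 * ‖gradient f (x + t • (y - x))‖ ^ 2 := by
    refine intervalIntegral.integral_mono_on zero_le_one (Continuous.intervalIntegrable (by fun_prop) _ _)
      (Continuous.intervalIntegrable (by fun_prop) _ _) fun t _ => ?_
    simp only [hu, ← inner_gradient_eq]
    rw [← mul_pow, ← sq_abs]
    gcongr
    exact abs_real_inner_le_norm _ _
  rw [intervalIntegral.integral_const_mul] at hle
  have : (f x - f y) ^ 2 = c ^ 2 := by rw [hc]; ring
  linarith

/-- The mean value on a cell. -/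
def cellMean (T : Finset E3) (f : E3 → ℝ) : ℝ := (∫ x in cell T, f x) / vol T

/-- The difference is the average of `f x - f y` over `y`, and Cauchy-Schwarz is applied against the
constant 1. -/
lemma IsTet.sq_sub_cellMean_le (h : IsTet T) {f : E3 → ℝ} (hf : Continuous f) (x : E3) :
    (f x - cellMean T f) ^ 2 ≤ (vol T)⁻¹ * ∫ y in cell T, (f x - f y) ^ 2 := by
  have hV := h.vol_pos
  have hc : Continuous fun y => f x - f y := by fun_prop
  have h1 := abs_integral_mul_le (memLp_const (1:ℝ)) (Continuous.memLp_cell hc T)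
    (μ := cellMeasure T)
  have e1 : l2 (cellMeasure T) (fun _ => (1:ℝ)) = Real.sqrt (vol T) := by
    simp [l2, vol]
  have e2 : ∫ y in cell T, (f x - f y) = vol T * (f x - cellMean T f) := by
    rw [integral_sub (integrable_const _) (Continuous.integrableOn_cell hf T), cellMean]
    simp only [setIntegral_const, smul_eq_mul]
    change vol T * _ - _ = _
    field_simp
  simp only [one_mul] at h1
  rw [e1, e2] at h1
  have h2 := pow_le_pow_left₀ (abs_nonneg _) h1 2
  rw [sq_abs, mul_pow, mul_pow, Real.sq_sqrt hV.le, l2_sq] at h2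
  simp only [Real.norm_eq_abs, sq_abs] at h2
  rw [← div_eq_inv_mul, le_div_iff₀ hV]
  have : vol T * ((f x - cellMean T f) ^ 2 * vol T)
      ≤ vol T * ∫ y in cell T, (f x - f y) ^ 2 := by linarith
  exact le_of_mul_le_mul_left this hV

lemma lintegral_difference_le {f : E3 → ℝ} (hf : ContDiff ℝ 1 f) {d : ℝ}
    (hd : ∀ x ∈ cell T, ∀ y ∈ cell T, ‖y - x‖ ≤ d) :
    ∫⁻ x in cell T, ∫⁻ y in cell T, ENNReal.ofReal ((f x - f y) ^ 2)
      ≤ ENNReal.ofReal (d ^ 2)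
        * (8 * (∫⁻ y in cell T, ENNReal.ofReal (‖gradient f y‖ ^ 2)) * volume (cell T)) := by
  have hgc := continuous_gradient hf
  set g : E3 → ENNReal := fun y => ENNReal.ofReal (‖gradient f y‖ ^ 2) with hg
  have hgm : Measurable g := by
    apply ENNReal.measurable_ofReal.comp
    exact (by fun_prop : Continuous fun y => ‖gradient f y‖ ^ 2).measurable
  set ν : Measure ℝ := volume.restrict (Set.Ioc 0 1) with hν
  have hpt : ∀ x ∈ cell T, ∀ y ∈ cell T, ENNReal.ofReal ((f x - f y) ^ 2)
      ≤ ENNReal.ofReal (d ^ 2) * ∫⁻ t, g (x + t • (y - x)) ∂ν := by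
    intro x hx y hy
    have hc : Continuous fun t : ℝ => ‖gradient f (x + t • (y - x))‖ ^ 2 := by fun_prop
    have h1 := sq_sub_le_integral_segment hf x y
    rw [intervalIntegral.integral_of_le zero_le_one] at h1
    have hi : Integrable (fun t : ℝ => ‖gradient f (x + t • (y - x))‖ ^ 2) ν :=
      (hc.integrableOn_Icc).mono_set Set.Ioc_subset_Icc_self
    rw [← ofReal_integral_eq_lintegral_ofReal hi (Eventually.of_forall fun _ => by positivity),
      ← ENNReal.ofReal_mul (by positivity)]
    apply ENNReal.ofReal_le_ofReal
    refine h1.trans ?_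
    gcongr
    exact hd x hx y hy
  have hxm : ∀ x : E3, Measurable fun p : E3 × ℝ => g (x + p.2 • (p.1 - x)) := fun x =>
    hgm.comp (by fun_prop)
  calc ∫⁻ x in cell T, ∫⁻ y in cell T, ENNReal.ofReal ((f x - f y) ^ 2)
      ≤ ∫⁻ x in cell T, ∫⁻ y in cell T, ENNReal.ofReal (d ^ 2) * ∫⁻ t, g (x + t • (y - x)) ∂ν := by
        refine setLIntegral_mono' (measurableSet_cell T) fun x hx => ?_
        exact setLIntegral_mono' (measurableSet_cell T) fun y hy => hpt x hx y hy
    _ = ∫⁻ x in cell T, ENNReal.ofReal (d ^ 2) *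
          ∫⁻ t, (∫⁻ y in cell T, g (x + t • (y - x))) ∂ν := by
        refine lintegral_congr fun x => ?_
        rw [lintegral_const_mul _ (hxm x).lintegral_prod_right',
          lintegral_lintegral_swap (hxm x).aemeasurable]
    _ = ENNReal.ofReal (d ^ 2) * ∫⁻ t, (∫⁻ x in cell T, ∫⁻ y in cell T, g (x + t • (y - x))) ∂ν := by
        have hm : Measurable fun p : E3 × ℝ => ∫⁻ y in cell T, g (p.1 + p.2 • (y - p.1)) := by
          have hm' : Measurable fun q : (E3 × ℝ) × E3 => g (q.1.1 + q.1.2 • (q.2 - q.1.1)) :=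
            hgm.comp (by fun_prop)
          exact hm'.lintegral_prod_right'
        rw [lintegral_const_mul _ hm.lintegral_prod_right', lintegral_lintegral_swap hm.aemeasurable]
    _ ≤ ENNReal.ofReal (d ^ 2) * ∫⁻ _, 8 * (∫⁻ y in cell T, g y) * volume (cell T) ∂ν := by
        refine mul_le_mul_right ?_ _
        exact setLIntegral_mono' measurableSet_Ioc fun t ht =>
          lintegral_lintegral_segment_le ht.1.le ht.2 hgm
    _ = _ := by simp [hν]

/-- Differences are integrated along segments inside the convex cell. The factors `vol T` cancel,
which leaves the constant 8 for the squares; it is rounded up to `3 ^ 2`. Only convexity and the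
diameter enter, not the shape of the cell. -/
lemma IsTet.poincare_smooth (h : IsTet T) {f : E3 → ℝ} (hf : ContDiff ℝ 1 f) {d : ℝ} (hd0 : 0 ≤ d)
    (hd : ∀ x ∈ cell T, ∀ y ∈ cell T, ‖y - x‖ ≤ d) :
    l2 (cellMeasure T) (fun x => f x - cellMean T f)
      ≤ 3 * d * l2 (cellMeasure T) (gradient f) := by
  have hV := h.vol_pos
  have hfc := hf.continuous
  have hgc := continuous_gradient hf
  apply Real.sqrt_le_iff.2
  refine ⟨mul_nonneg (by positivity) (l2_nonneg _), ?_⟩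
  rw [mul_pow, l2_sq]
  have i1 : Integrable (fun x => ‖f x - cellMean T f‖ ^ 2) (cellMeasure T) :=
    Continuous.integrableOn_cell (by fun_prop) T
  have i2 : Integrable (fun x => ‖gradient f x‖ ^ 2) (cellMeasure T) :=
    Continuous.integrableOn_cell (by fun_prop) T
  have key : ENNReal.ofReal (∫ x in cell T, ‖f x - cellMean T f‖ ^ 2)
      ≤ ENNReal.ofReal (8 * d ^ 2 * ∫ x in cell T, ‖gradient f x‖ ^ 2) := by
    rw [ofReal_integral_eq_lintegral_ofReal i1 (Eventually.of_forall fun _ => by positivity)]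
    calc ∫⁻ x in cell T, ENNReal.ofReal (‖f x - cellMean T f‖ ^ 2)
        ≤ ∫⁻ x in cell T, ENNReal.ofReal (vol T)⁻¹ *
            ∫⁻ y in cell T, ENNReal.ofReal ((f x - f y) ^ 2) := by
          refine lintegral_mono fun x => ?_
          have i3 : Integrable (fun y => (f x - f y) ^ 2) (cellMeasure T) :=
            Continuous.integrableOn_cell (by fun_prop) T
          rw [← ofReal_integral_eq_lintegral_ofReal i3 (Eventually.of_forall fun _ => by positivity),
            ← ENNReal.ofReal_mul (by positivity)]
          apply ENNReal.ofReal_le_ofReal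
          rw [Real.norm_eq_abs, sq_abs]
          exact h.sq_sub_cellMean_le hfc x
      _ = ENNReal.ofReal (vol T)⁻¹ *
            ∫⁻ x in cell T, ∫⁻ y in cell T, ENNReal.ofReal ((f x - f y) ^ 2) := by
          rw [lintegral_const_mul]
          have : Measurable fun p : E3 × E3 => ENNReal.ofReal ((f p.1 - f p.2) ^ 2) :=
            ENNReal.measurable_ofReal.comp
              (by fun_prop : Continuous fun p : E3 × E3 => (f p.1 - f p.2) ^ 2).measurable
          exact this.lintegral_prod_right'
      _ ≤ ENNReal.ofReal (vol T)⁻¹ * (ENNReal.ofReal (d ^ 2)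
          * (8 * (∫⁻ y in cell T, ENNReal.ofReal (‖gradient f y‖ ^ 2)) * volume (cell T))) := by
          gcongr
          exact lintegral_difference_le hf hd
      _ = _ := by
          have e8 : (8 : ENNReal) = ENNReal.ofReal 8 := by simp
          have eV : volume (cell T) = ENNReal.ofReal (vol T) :=
            (ENNReal.ofReal_toReal (volume_cell_lt_top T).ne).symm
          have hi0 : 0 ≤ ∫ x in cell T, ‖gradient f x‖ ^ 2 :=
            integral_nonneg fun _ => by positivity
          rw [← ofReal_integral_eq_lintegral_ofReal i2 (Eventually.of_forall fun _ => by positivity),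
            e8, eV, ← ENNReal.ofReal_mul (by norm_num), ← ENNReal.ofReal_mul (by positivity),
            ← ENNReal.ofReal_mul (by positivity), ← ENNReal.ofReal_mul (by positivity)]
          congr 1
          field_simp
  have hi0 : 0 ≤ ∫ x in cell T, ‖gradient f x‖ ^ 2 := integral_nonneg fun _ => by positivity
  rw [ENNReal.ofReal_le_ofReal_iff (by positivity)] at key
  refine key.trans ?_
  have : 0 ≤ d ^ 2 * ∫ x in cell T, ‖gradient f x‖ ^ 2 := by positivity
  nlinarith

lemma abs_cellMean_mul_le (h : IsTet T) {f : E3 → ℝ} (hf : MemLp f 2 (cellMeasure T)) :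
    Real.sqrt (vol T) * |cellMean T f| ≤ l2 (cellMeasure T) f := by
  have hV := h.vol_pos
  have h1 := integral_norm_le_l2 hf
  rw [measureReal_restrict_cell] at h1
  have h2 := (norm_integral_le_integral_norm f (μ := cellMeasure T)).trans h1
  rw [Real.norm_eq_abs] at h2
  rw [cellMean, abs_div, abs_of_pos hV, mul_div_assoc', div_le_iff₀ hV]
  calc Real.sqrt (vol T) * |∫ x in cell T, f x|
      ≤ Real.sqrt (vol T) * (Real.sqrt (vol T) * l2 (cellMeasure T) f) := by gcongr
    _ = l2 (cellMeasure T) f * vol T := by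
        rw [← mul_assoc, Real.mul_self_sqrt hV.le, mul_comm]

lemma l2_const (T : Finset E3) (c : ℝ) :
    l2 (cellMeasure T) (fun _ => c) = Real.sqrt (vol T) * |c| := by
  have : l2 (cellMeasure T) (fun _ => c) = Real.sqrt (vol T * c ^ 2) := by
    simp [l2, vol]
  rw [this, Real.sqrt_mul (by exact ENNReal.toReal_nonneg), Real.sqrt_sq_eq_abs]

/-- The Poincaré inequality. -/
lemma SmoothLimit.poincare (h : IsTet T) {f : E3 → ℝ} {G : E3 → E3} (hf : SmoothLimit T f G)
    {d : ℝ} (hd0 : 0 ≤ d) (hd : ∀ x ∈ cell T, ∀ y ∈ cell T, ‖y - x‖ ≤ d) :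
    l2 (cellMeasure T) (fun x => f x - cellMean T f) ≤ 3 * d * l2 (cellMeasure T) G := by
  obtain ⟨hfm, hGm, φ, hφ, h1, h2⟩ := hf
  have hφm : ∀ n, MemLp (φ n) 2 (cellMeasure T) := fun n =>
    Continuous.memLp_cell (hφ n).continuous T
  have hgm : ∀ n, MemLp (gradient (φ n)) 2 (cellMeasure T) := fun n =>
    Continuous.memLp_cell (continuous_gradient (hφ n)) T
  have hb : ∀ n, l2 (cellMeasure T) (fun x => f x - cellMean T f)
      ≤ 2 * l2 (cellMeasure T) (f - φ n)
        + 3 * d * (l2 (cellMeasure T) G + l2 (cellMeasure T) (G - gradient (φ n))) := by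
    intro n
    have e : (fun x => f x - cellMean T f) = (f - φ n) + ((fun x => φ n x - cellMean T (φ n))
        + fun _ => -cellMean T (f - φ n)) := by
      funext x
      have : cellMean T (f - φ n) = cellMean T f - cellMean T (φ n) := by
        have := integral_sub (hfm.integrable (by norm_num)) ((hφm n).integrable (by norm_num))
        simp only [cellMean, Pi.sub_apply]
        rw [this, sub_div]
      simp only [Pi.add_apply, Pi.sub_apply, this]; ring
    have m1 : MemLp (f - φ n) 2 (cellMeasure T) := hfm.sub (hφm n)
    have m2 : MemLp (fun x => φ n x - cellMean T (φ n)) 2 (cellMeasure T) :=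
      (hφm n).sub (memLp_const _)
    have m3 : MemLp (fun _ : E3 => -cellMean T (f - φ n)) 2 (cellMeasure T) := memLp_const _
    have p1 := h.poincare_smooth (hφ n) hd0 hd
    have p2 := abs_cellMean_mul_le h m1
    have p3 : l2 (cellMeasure T) (gradient (φ n))
        ≤ l2 (cellMeasure T) G + l2 (cellMeasure T) (G - gradient (φ n)) := by
      have hneg : l2 (cellMeasure T) (-(G - gradient (φ n)))
          = l2 (cellMeasure T) (G - gradient (φ n)) := by simp only [l2, Pi.neg_apply, norm_neg]
      have := l2_add_le hGm (hGm.sub (hgm n)).neg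
      rw [hneg] at this
      simpa using this
    have p4 : 3 * d * l2 (cellMeasure T) (gradient (φ n)) ≤
        3 * d * (l2 (cellMeasure T) G + l2 (cellMeasure T) (G - gradient (φ n))) := by gcongr
    rw [e]
    refine (l2_add_le m1 (m2.add m3)).trans ?_
    have p5 := l2_add_le m2 m3
    rw [l2_const T (-cellMean T (f - φ n)), abs_neg] at p5
    linarith
  have hlim := (h1.const_mul 2).add (((tendsto_const_nhds (x := l2 (cellMeasure T) G)).add h2).const_mul
    (3 * d))
  simp only [mul_zero, add_zero, zero_add] at hlim
  exact ge_of_tendsto' hlim hb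

end

section

variable {T T' : Finset E3} {P P' Q : E3} {Ω : Set E3}

/-! ### The estimate on one tetrahedron -/

lemma IsTet.bary_le_one (h : IsTet T) (hP : P ∈ T) {x : E3} (hx : x ∈ convexHull ℝ (T : Set E3)) :
    bary T P x ≤ 1 := by
  rw [← h.sum_bary x]
  exact Finset.single_le_sum (f := fun Q => bary T Q x) (h.mem_convexHull.1 hx) hP

/-- On the inscribed ball the coordinate stays in `[0, 1]`, so a move of length `ρ / 2` changes it
by at most 1. Half the radius is used because the ball is open. -/
lemma IsTet.linear_bound (h : IsTet T) (hP : P ∈ T) {c : E3} {ρ : ℝ} (hρ : 0 < ρ)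
    (hball : Metric.ball c ρ ⊆ convexHull ℝ (T : Set E3)) (u : E3) :
    ρ * |(bary T P).linear u| ≤ 2 * ‖u‖ := by
  by_cases hu : u = 0
  · simp [hu]
  have hu0 : 0 < ‖u‖ := norm_pos_iff.2 hu
  set t : ℝ := ρ / (2 * ‖u‖) with ht
  have ht0 : 0 < t := by positivity
  have htu : t * ‖u‖ = ρ / 2 := by rw [ht]; field_simp
  have h1 : c ∈ convexHull ℝ (T : Set E3) := hball (Metric.mem_ball_self hρ)
  have h2 : t • u + c ∈ convexHull ℝ (T : Set E3) := by
    apply hball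
    rw [mem_ball_iff_norm, add_sub_cancel_right, norm_smul, Real.norm_eq_abs, abs_of_pos ht0, htu]
    linarith
  have e : t * (bary T P).linear u = bary T P (t • u + c) - bary T P c := by
    have := (bary T P).map_vadd c (t • u)
    simp only [vadd_eq_add, map_smul, smul_eq_mul] at this
    rw [this]; ring
  have hb : |t * (bary T P).linear u| ≤ 1 := by
    rw [e, abs_le]
    have a1 := h.bary_le_one hP h1
    have a2 := h.bary_le_one hP h2
    have a3 := h.mem_convexHull.1 h1 P hP
    have a4 := h.mem_convexHull.1 h2 P hP
    constructor <;> linarith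
  rw [abs_mul, abs_of_pos ht0] at hb
  have h3 : ρ * |(bary T P).linear u| = 2 * ‖u‖ * (t * |(bary T P).linear u|) := by
    rw [ht]; field_simp
  rw [h3]
  nlinarith

/-- The vector of the face means of the components. -/
def faceVec (T : Finset E3) (P : E3) (v : E3 → E3) (G : Fin 3 → E3 → E3) : E3 :=
  WithLp.toLp 2 fun i => faceMean T P (fun x => v x i) (G i)

/-- The vector of the mean values of the components. -/
def meanVec (T : Finset E3) (v : E3 → E3) : E3 :=
  WithLp.toLp 2 fun i => cellMean T fun x => v x i

/-- The norm `‖∇v‖_T`. -/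
def elemNorm (T : Finset E3) (G : Fin 3 → E3 → E3) : ℝ :=
  Real.sqrt (∑ i, l2 (cellMeasure T) (G i) ^ 2)

lemma l2_le_elemNorm (T : Finset E3) (G : Fin 3 → E3 → E3) (i : Fin 3) :
    l2 (cellMeasure T) (G i) ≤ elemNorm T G := by
  apply Real.le_sqrt_of_sq_le
  exact Finset.single_le_sum (f := fun i => l2 (cellMeasure T) (G i) ^ 2)
    (fun i _ => sq_nonneg _) (Finset.mem_univ i)

lemma elemNorm_nonneg (T : Finset E3) (G : Fin 3 → E3 → E3) : 0 ≤ elemNorm T G := Real.sqrt_nonneg _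

lemma norm_le_sum_abs (u : E3) : ‖u‖ ≤ ∑ i, |u i| := by
  have : u = ∑ i : Fin 3, u i • EuclideanSpace.single i (1:ℝ) := by
    rw [vec3_ext_iff]; simp [Fin.sum_univ_three]
  conv_lhs => rw [this]
  refine (norm_sum_le _ _).trans (Finset.sum_le_sum fun i _ => ?_)
  rw [norm_smul]; simp

lemma faceInt_eq {q : E3 → ℝ} {g : E3 → E3} (hq : MemLp q 2 (cellMeasure T))
    (hg : MemLp g 2 (cellMeasure T)) :
    faceInt T P q g = 3 * (∫ x in cell T, q x) + ∫ x in cell T, inner ℝ (x - P) (g x) := by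
  have hx : MemLp (fun x : E3 => x - P) 2 (cellMeasure T) :=
    Continuous.memLp_cell (by fun_prop) T
  rw [faceInt, integral_add ((hq.integrable (by norm_num)).const_mul 3) (integrable_inner hx hg),
    integral_const_mul]

lemma norm_sub_vertex_le (hP : P ∈ T) {x : E3} (hx : x ∈ cell T) :
    ‖x - P‖ ≤ Metric.diam (convexHull ℝ (T : Set E3)) :=
  norm_sub_le_diam_convexHull (cell_subset T hx) (subset_convexHull ℝ _ hP)

lemma abs_faceInt_le (hP : P ∈ T) {q : E3 → ℝ} {g : E3 → E3} (hq : MemLp q 2 (cellMeasure T))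
    (hg : MemLp g 2 (cellMeasure T)) :
    |faceInt T P q g| ≤ Real.sqrt (vol T) * (3 * l2 (cellMeasure T) q
      + Metric.diam (convexHull ℝ (T : Set E3)) * l2 (cellMeasure T) g) := by
  rw [faceInt_eq hq hg]
  have h1 := integral_norm_le_l2 hq
  rw [measureReal_restrict_cell] at h1
  have h2 := (norm_integral_le_integral_norm q (μ := cellMeasure T)).trans h1
  rw [Real.norm_eq_abs] at h2
  have h3 := abs_integral_radial_le hg fun x hx => norm_sub_vertex_le hP hx
  refine (abs_add_le _ _).trans ?_
  rw [abs_mul, abs_of_pos (by norm_num : (0:ℝ) < 3)]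
  linarith

/-- The term `3 * f` in the face flux produces exactly the cell mean; the difference is the radial
gradient term, of order `diam T`. -/
lemma IsTet.faceMean_sub_cellMean (h : IsTet T) (hP : P ∈ T) {f : E3 → ℝ} {G : E3 → E3}
    (hf : MemLp f 2 (cellMeasure T)) (hG : MemLp G 2 (cellMeasure T)) :
    Real.sqrt (vol T) * |faceMean T P f G - cellMean T f|
      ≤ Metric.diam (convexHull ℝ (T : Set E3)) * l2 (cellMeasure T) G / 3 := by
  have hV := h.vol_pos
  have e : faceMean T P f G - cellMean T f
      = (∫ x in cell T, inner ℝ (x - P) (G x)) / (3 * vol T) := by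
    rw [faceMean, cellMean, faceInt_eq hf hG]; field_simp; ring
  have h1 := abs_integral_radial_le hG fun x hx => norm_sub_vertex_le hP hx
  rw [e, abs_div, abs_of_pos (by positivity : 0 < 3 * vol T), mul_div_assoc', div_le_iff₀ (by positivity)]
  calc Real.sqrt (vol T) * |∫ x in cell T, inner ℝ (x - P) (G x)|
      ≤ Real.sqrt (vol T) * (Metric.diam (convexHull ℝ (T : Set E3))
        * (Real.sqrt (vol T) * l2 (cellMeasure T) G)) := by gcongr
    _ = Metric.diam (convexHull ℝ (T : Set E3)) * l2 (cellMeasure T) G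
        * (Real.sqrt (vol T) * Real.sqrt (vol T)) := by ring
    _ = _ := by rw [Real.mul_self_sqrt hV.le]; ring

/-- Replacing `v` by its interpolant in the lowest order Raviart-Thomas space leaves only the
deviation of the face means from the mean value. -/
lemma IsTet.interpolation_identity (h : IsTet T) {v : E3 → E3} {q : E3 → ℝ} {g : E3 → E3}
    (m : E3 → E3) (vb : E3)
    (hv : MemLp v 2 (cellMeasure T)) (hq : MemLp q 2 (cellMeasure T))
    (hg : MemLp g 2 (cellMeasure T)) :
    (∫ x in cell T, inner ℝ (v x) (g x)) + ∑ P ∈ T, (bary T P).linear (m P) * faceInt T P q g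
      = (∫ x in cell T, inner ℝ (v x - vb) (g x))
        + ∑ P ∈ T, (bary T P).linear (m P - vb) * faceInt T P q g := by
  have i1 : Integrable (fun x => inner ℝ (v x) (g x)) (cellMeasure T) := integrable_inner hv hg
  have i2 : Integrable (fun x => inner ℝ vb (g x)) (cellMeasure T) :=
    integrable_inner (memLp_const vb) hg
  have i3 : ∀ P, Integrable (fun x => 3 * q x + inner ℝ (x - P) (g x)) (cellMeasure T) := fun P =>
    ((hq.integrable (by norm_num)).const_mul 3).add
      (integrable_inner (Continuous.memLp_cell (by fun_prop) T) hg)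
  -- For a constant field the divergence part drops out since the coordinate slopes sum to zero, and
  -- the radial part reproduces `-vb`.
  have e1 : ∑ P ∈ T, (bary T P).linear vb * faceInt T P q g
      = -∫ x in cell T, inner ℝ vb (g x) := by
    simp only [faceInt, ← integral_const_mul]
    rw [← integral_finsetSum _ fun P _ => (i3 P).const_mul _, ← integral_neg]
    congr 1; ext x
    have s1 := h.sum_linear vb
    have s2 := h.sum_linear_smul vb
    have s3 : ∑ P ∈ T, (bary T P).linear vb * inner ℝ (x - P) (g x) = -inner ℝ vb (g x) := by
      have : ∑ P ∈ T, (bary T P).linear vb • (x - P) = -vb := by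
        simp only [smul_sub, Finset.sum_sub_distrib, ← Finset.sum_smul, s1, s2, zero_smul, zero_sub]
      rw [← inner_neg_left, ← this, sum_inner]
      exact Finset.sum_congr rfl fun P _ => (real_inner_smul_left _ _ _).symm
    simp only [mul_add, Finset.sum_add_distrib, s3, ← Finset.sum_mul, s1]
    ring
  simp only [map_sub, sub_mul, Finset.sum_sub_distrib, e1, inner_sub_left]
  rw [integral_sub i1 i2]
  ring

/-- The constant 9 is three components times the Poincaré constant 3; the constant 24 is four
vertices, times 2 from the slope bound, times 3 from the face flux of `q`. The factors `sqrt (vol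
T)` in the face mean and face flux bounds cancel. -/
lemma IsTet.local_estimate (h : IsTet T) {v : E3 → E3} {G : Fin 3 → E3 → E3}
    (hv : ∀ i, SmoothLimit T (fun x => v x i) (G i)) {q : E3 → ℝ} {g : E3 → E3}
    (hq : MemLp q 2 (cellMeasure T)) (hg : MemLp g 2 (cellMeasure T)) {σ : ℝ} {c : E3} {ρ : ℝ}
    (hρ : 0 < ρ) (hball : Metric.ball c ρ ⊆ convexHull ℝ (T : Set E3))
    (hσ : Metric.diam (convexHull ℝ (T : Set E3)) ≤ σ * ρ) :
    |(∫ x in cell T, inner ℝ (v x) (g x))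
        + ∑ P ∈ T, (bary T P).linear (faceVec T P v G) * faceInt T P q g|
      ≤ (9 + 24 * |σ|) * (elemNorm T G * (l2 (cellMeasure T) q
        + Metric.diam (convexHull ℝ (T : Set E3)) * l2 (cellMeasure T) g)) := by
  set d := Metric.diam (convexHull ℝ (T : Set E3)) with hd
  have hd0 : 0 ≤ d := Metric.diam_nonneg
  have hV := h.vol_pos
  set N := elemNorm T G
  have hN : 0 ≤ N := elemNorm_nonneg T G
  have hgn := l2_nonneg (μ := cellMeasure T) g
  have hqn := l2_nonneg (μ := cellMeasure T) q
  have hvm : MemLp v 2 (cellMeasure T) := MemLp.of_eval_piLp fun i => (hv i).1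
  rw [h.interpolation_identity (fun P => faceVec T P v G) (meanVec T v) hvm hq hg]
  have hcell : ∀ x ∈ cell T, ∀ y ∈ cell T, ‖y - x‖ ≤ d := fun x hx y hy =>
    norm_sub_le_diam_convexHull (cell_subset T hy) (cell_subset T hx)
  have part1 : |∫ x in cell T, inner ℝ (v x - meanVec T v) (g x)|
      ≤ 9 * d * N * l2 (cellMeasure T) g := by
    have e : ∀ x, inner ℝ (v x - meanVec T v) (g x)
        = ∑ i, (v x i - cellMean T fun y => v y i) * g x i := by
      intro x; simp [PiLp.inner_apply, meanVec, mul_comm]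
    have hm : ∀ i, MemLp (fun x => v x i - cellMean T fun y => v y i) 2 (cellMeasure T) := fun i =>
      (hv i).1.sub (memLp_const _)
    have hgi := memLp_coord hg
    have hmg : ∀ i, Integrable (fun x => (v x i - cellMean T fun y => v y i) * g x i)
        (cellMeasure T) := fun i => (hm i).integrable_mul (hgi i)
    simp only [e]
    rw [integral_finsetSum _ fun i _ => hmg i]
    refine (Finset.abs_sum_le_sum_abs _ _).trans ?_
    have hi : ∀ i ∈ Finset.univ, |∫ x in cell T, (v x i - cellMean T fun y => v y i) * g x i|
        ≤ 3 * d * N * l2 (cellMeasure T) g := by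
      intro i _
      refine (abs_integral_mul_le (hm i) (hgi i)).trans ?_
      have p1 := (hv i).poincare h hd0 hcell
      have p2 : l2 (cellMeasure T) (fun x => g x i) ≤ l2 (cellMeasure T) g := by
        apply Real.sqrt_le_sqrt
        refine integral_mono (hgi i).norm.integrable_sq hg.norm.integrable_sq fun x => ?_
        exact pow_le_pow_left₀ (norm_nonneg _) (PiLp.norm_apply_le (g x) i) 2
      have p3 := l2_le_elemNorm T G i
      have p4 : l2 (cellMeasure T) (fun x => v x i - cellMean T fun y => v y i) ≤ 3 * d * N :=
        p1.trans (by gcongr)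
      exact mul_le_mul p4 p2 (l2_nonneg _) (by positivity)
    refine (Finset.sum_le_sum hi).trans (le_of_eq ?_)
    simp; ring
  have part2 : ∀ P ∈ T, |(bary T P).linear (faceVec T P v G - meanVec T v) * faceInt T P q g|
      ≤ 2 * |σ| * N * (3 * l2 (cellMeasure T) q + d * l2 (cellMeasure T) g) := by
    intro P hP
    rw [abs_mul]
    have b1 := abs_faceInt_le hP hq hg
    have b2 := h.linear_bound hP hρ hball (faceVec T P v G - meanVec T v)
    have b3 : Real.sqrt (vol T) * ‖faceVec T P v G - meanVec T v‖ ≤ d * N := by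
      have a1 := norm_le_sum_abs (faceVec T P v G - meanVec T v)
      have a2 : ∀ i, Real.sqrt (vol T) * |(faceVec T P v G - meanVec T v) i| ≤ d * N / 3 := by
        intro i
        have := h.faceMean_sub_cellMean hP (hv i).1 (hv i).2.1
        have h2 : d * l2 (cellMeasure T) (G i) / 3 ≤ d * N / 3 := by
          gcongr; exact l2_le_elemNorm T G i
        exact this.trans h2
      calc Real.sqrt (vol T) * ‖faceVec T P v G - meanVec T v‖
          ≤ Real.sqrt (vol T) * ∑ i, |(faceVec T P v G - meanVec T v) i| := by gcongr
        _ ≤ ∑ i : Fin 3, d * N / 3 := by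
          rw [Finset.mul_sum]; exact Finset.sum_le_sum fun i _ => a2 i
        _ = d * N := by simp; ring
    -- Shape regularity enters only here: the diameter gained from the face means absorbs the factor
    -- `1 / ρ` of the coordinate slopes.
    have hdσ : d ≤ |σ| * ρ := hσ.trans (by gcongr; exact le_abs_self σ)
    set X := |(bary T P).linear (faceVec T P v G - meanVec T v)|
    set n := ‖faceVec T P v G - meanVec T v‖
    set S := 3 * l2 (cellMeasure T) q + d * l2 (cellMeasure T) g with hS
    have hS0 : 0 ≤ S := by positivity
    have hXV : X * Real.sqrt (vol T) ≤ 2 * |σ| * N := by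
      have : ρ * (X * Real.sqrt (vol T)) ≤ ρ * (2 * |σ| * N) := by
        calc ρ * (X * Real.sqrt (vol T)) = (ρ * X) * Real.sqrt (vol T) := by ring
          _ ≤ 2 * n * Real.sqrt (vol T) := by gcongr
          _ = 2 * (Real.sqrt (vol T) * n) := by ring
          _ ≤ 2 * (d * N) := by gcongr
          _ ≤ 2 * (|σ| * ρ * N) := by gcongr
          _ = _ := by ring
      exact le_of_mul_le_mul_left this hρ
    calc X * |faceInt T P q g| ≤ X * (Real.sqrt (vol T) * S) := by gcongr
      _ = X * Real.sqrt (vol T) * S := by ring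
      _ ≤ 2 * |σ| * N * S := by gcongr
  have part3 : |∑ P ∈ T, (bary T P).linear (faceVec T P v G - meanVec T v) * faceInt T P q g|
      ≤ 4 * (2 * |σ| * N * (3 * l2 (cellMeasure T) q + d * l2 (cellMeasure T) g)) := by
    refine (Finset.abs_sum_le_sum_abs _ _).trans ((Finset.sum_le_sum part2).trans (le_of_eq ?_))
    rw [Finset.sum_const, h.1, nsmul_eq_mul]; norm_num
  refine (abs_add_le _ _).trans ((add_le_add part1 part3).trans ?_)
  have t1 : 0 ≤ N * l2 (cellMeasure T) q := by positivity
  have t2 : 0 ≤ |σ| * (N * (d * l2 (cellMeasure T) g)) := by positivity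
  nlinarith

/-! ### Sums over faces -/

namespace TetMesh

/-- Contributions that cancel on interior faces and vanish on boundary faces add up to zero. -/
lemma sum_faces_eq_zero (M : TetMesh Ω) (Z : Finset E3 → E3 → ℝ)
    (hpair : ∀ T ∈ M.tets, ∀ T' ∈ M.tets, ∀ P ∈ T, ∀ P' ∈ T', T ≠ T' → face T P = face T' P' →
      Z T P + Z T' P' = 0)
    (hbd : ∀ T ∈ M.tets, ∀ P ∈ T, (∀ T' ∈ M.tets, T' ≠ T → ∀ P' ∈ T', face T' P' ≠ face T P) →
      Z T P = 0) : ∑ T ∈ M.tets, ∑ P ∈ T, Z T P = 0 := by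
  classical
  rw [Finset.sum_sigma']
  set s : Finset (Σ _ : Finset E3, E3) := M.tets.sigma fun T => T with hs
  have hmem : ∀ a : Σ _ : Finset E3, E3, a ∈ s ↔ a.1 ∈ M.tets ∧ a.2 ∈ a.1 := fun a => by
    simp [hs]
  let R : (Σ _ : Finset E3, E3) → (Σ _ : Finset E3, E3) → Prop := fun a b =>
    b ∈ s ∧ b.1 ≠ a.1 ∧ face b.1 b.2 = face a.1 a.2
  -- A face belongs to at most two tetrahedra, so passing to the neighbour twice returns to the
  -- start.
  have huniq : ∀ a ∈ s, ∀ b, R a b → ∀ c, R b c → c = a := by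
    rintro ⟨T, P⟩ ha ⟨T', P'⟩ ⟨hb, hb1, hb2⟩ ⟨T'', P''⟩ ⟨hc, hc1, hc2⟩
    rw [hmem] at ha hb hc
    dsimp only at *
    have e := M.eq_of_face_eq hb.1 hc.1 ha.1 hb.2 hc.2 ha.2 hc1.symm hb1 hc2.symm hb2
    subst e
    have := vertex_eq_of_face_eq hc.2 (hc2.trans hb2)
    subst this
    rfl
  -- Each face of a tetrahedron is paired with the same face seen from the neighbour. Fixed points
  -- are the boundary faces, whose contributions vanish.
  refine Finset.sum_involution
    (fun a _ => if h : ∃ b, R a b then h.choose else a) ?_ ?_ ?_ ?_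
  · intro a ha
    by_cases h : ∃ b, R a b
    · simp only [dif_pos h]
      obtain ⟨hb, hb1, hb2⟩ := h.choose_spec
      rw [hmem] at ha hb
      exact hpair _ ha.1 _ hb.1 _ ha.2 _ hb.2 hb1.symm hb2.symm
    · simp only [dif_neg h]
      rw [hmem] at ha
      rw [hbd _ ha.1 _ ha.2, add_zero]
      intro T' hT' hne P' hP' hF
      exact h ⟨⟨T', P'⟩, (hmem _).2 ⟨hT', hP'⟩, hne, hF⟩
  · intro a ha hne
    by_cases h : ∃ b, R a b
    · simp only [dif_pos h]
      intro e
      exact h.choose_spec.2.1 (by rw [e])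
    · exfalso
      apply hne
      rw [hmem] at ha
      apply hbd _ ha.1 _ ha.2
      intro T' hT' hne P' hP' hF
      exact h ⟨⟨T', P'⟩, (hmem _).2 ⟨hT', hP'⟩, hne, hF⟩
  · intro a ha
    by_cases h : ∃ b, R a b
    · simp only [dif_pos h]; exact h.choose_spec.1
    · simpa only [dif_neg h] using ha
  · intro a ha
    by_cases h : ∃ b, R a b
    · simp only [dif_pos h]
      obtain ⟨hb, hb1, hb2⟩ := h.choose_spec
      have h' : ∃ c, R h.choose c := ⟨a, ha, hb1.symm, hb2.symm⟩
      rw [dif_pos h']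
      exact huniq a ha _ h.choose_spec _ h'.choose_spec
    · simp only [dif_neg h]

end TetMesh

end

section

variable {T T' : Finset E3} {P P' Q : E3} {Ω : Set E3}

/-! ### The space `W + W_h` -/

lemma faceMean_congr_ae {f f' : E3 → ℝ} {G G' : E3 → E3} (hf : f =ᵐ[cellMeasure T] f')
    (hG : G =ᵐ[cellMeasure T] G') : faceMean T P f G = faceMean T P f' G' := by
  rw [faceMean, faceMean, faceInt, faceInt]
  congr 1
  refine integral_congr_ae ?_
  filter_upwards [hf, hG] with x h1 h2
  rw [h1, h2]

lemma SmoothLimit.congr {f f' : E3 → ℝ} {G G' : E3 → E3} (h : SmoothLimit T f G)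
    (hf : f =ᵐ[cellMeasure T] f') (hG : G =ᵐ[cellMeasure T] G') : SmoothLimit T f' G' := by
  obtain ⟨h1, h2, φ, hφ, l1, l2'⟩ := h
  refine ⟨(memLp_congr_ae hf).1 h1, (memLp_congr_ae hG).1 h2, φ, hφ, ?_, ?_⟩
  · refine l1.congr fun n => l2_congr ?_
    filter_upwards [hf] with x hx
    simp [hx]
  · refine l2'.congr fun n => l2_congr ?_
    filter_upwards [hG] with x hx
    simp [hx]

/-- The weak gradients of the components of a vector field on a cell. -/
def compGrad (T : Finset E3) (v : E3 → E3) (i : Fin 3) : E3 → E3 :=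
  weakGrad (cell T) fun y => v y i

namespace TetMesh

variable {M : TetMesh Ω}

lemma weakGrad_cell_ae (M : TetMesh Ω) (hT : T ∈ M.tets) {q : E3 → ℝ} (hq : MemH1 Ω q) :
    weakGrad (cell T) q =ᵐ[cellMeasure T] weakGrad Ω q := by
  have h := hq.hasWeakGrad.mono (M.cell_subset hT)
  exact (MemH1.hasWeakGrad ⟨_, h⟩).ae_unique (isOpen_cell T) h

lemma faceMean_eq_of_memH1 (M : TetMesh Ω) (hT : T ∈ M.tets) (hT' : T' ∈ M.tets) (hne : T ≠ T')
    (hP : P ∈ T) (hP' : P' ∈ T') (hF : face T P = face T' P') {q : E3 → ℝ} (hq : MemH1 Ω q) :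
    faceMean T P q (weakGrad (cell T) q) = faceMean T' P' q (weakGrad (cell T') q) := by
  rw [faceMean_congr_ae (ae_eq_refl q) (M.weakGrad_cell_ae hT hq),
    faceMean_congr_ae (ae_eq_refl q) (M.weakGrad_cell_ae hT' hq)]
  exact M.faceMean_eq_of_hasWeakGrad hT hT' hne hP hP' hF hq.hasWeakGrad

lemma midpoint_mem_closure (M : TetMesh Ω) (hT : T ∈ M.tets) {x y : E3} (hx : x ∈ T) (hy : y ∈ T) :
    midpoint ℝ x y ∈ closure Ω :=
  M.convexHull_subset_closure hT ((convex_convexHull ℝ (T : Set E3)).midpoint_mem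
    (subset_convexHull ℝ _ hx) (subset_convexHull ℝ _ hy))

/-- The properties of the components of functions in `W + W_h` that are used below. -/
lemma component_properties {v : E3 → E3} (hv : M.MemWaddWh v) (i : Fin 3) :
    (∀ T ∈ M.tets, SmoothLimit T (fun x => v x i) (compGrad T v i)) ∧
    (∀ T ∈ M.tets, ∀ T' ∈ M.tets, ∀ P ∈ T, ∀ P' ∈ T', T ≠ T' → face T P = face T' P' →
      faceMean T P (fun x => v x i) (compGrad T v i)
        = faceMean T' P' (fun x => v x i) (compGrad T' v i)) ∧
    (∀ T ∈ M.tets, ∀ P ∈ T, (∀ T' ∈ M.tets, T' ≠ T → ∀ P' ∈ T', face T' P' ≠ face T P) →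
      faceMean T P (fun x => v x i) (compGrad T v i) = 0) := by
  obtain ⟨w, wh, hw, hwh, rfl⟩ := hv
  obtain ⟨p, hp, hp0⟩ := hwh i
  have hwi := hw i
  set u : E3 → ℝ := fun x => w x i with hu
  have hpc : ∀ T ∈ M.tets, ContDiff ℝ 1 (p T) := fun T hT =>
    (hp.shape T hT).contDiff.of_le one_le_infty
  have hf : ∀ T ∈ M.tets, (fun x => (w + wh) x i) =ᵐ[cellMeasure T] u + p T := by
    intro T hT
    filter_upwards [hp.ae_eq T hT] with x hx
    simp only [Pi.add_apply, PiLp.add_apply, hu, ← hx]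
  have hG : ∀ T ∈ M.tets, compGrad T (w + wh) i =ᵐ[cellMeasure T]
      weakGrad Ω u + gradient (p T) := by
    intro T hT
    have h1 := (hwi.1.hasWeakGrad.mono (M.cell_subset hT)).add (hasWeakGrad_of_contDiff (hpc T hT) T)
    have h2 := h1.congr (hf T hT).symm (ae_eq_refl _)
    exact (MemH1.hasWeakGrad ⟨_, h2⟩).ae_unique (isOpen_cell T) h2
  have hmean : ∀ T ∈ M.tets, ∀ P ∈ T,
      faceMean T P (fun x => (w + wh) x i) (compGrad T (w + wh) i)
        = faceMean T P u (weakGrad Ω u) + faceMean T P (p T) (gradient (p T)) := by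
    intro T hT P _
    rw [faceMean_congr_ae (hf T hT) (hG T hT), faceMean,
      faceInt_add (hwi.1.hasWeakGrad.integrableOn_faceInt (M.cell_subset hT))
        (integrableOn_faceInt (hpc T hT) T P), add_div]
    rfl
  refine ⟨fun T hT => ?_, fun T hT T' hT' P hP P' hP' hne hF => ?_, fun T hT P hP hb => ?_⟩
  · exact (M.smoothLimit_add hT hwi (hpc T hT)).congr (hf T hT).symm (hG T hT).symm
  · rw [hmean T hT P hP, hmean T' hT' P' hP',
      M.faceMean_eq_of_hasWeakGrad hT hT' hne hP hP' hF hwi.1.hasWeakGrad]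
    congr 1
    refine (hp.shape T hT).faceMean_eq_faceMean (M.isTet hT) (M.isTet hT') (hp.shape T' hT') hP hP'
      hF fun x hx y hy hxy => ?_
    have hx' := hF ▸ hx
    have hy' := hF ▸ hy
    -- Even an interior face can have an edge whose midpoint is on the boundary of `Ω`; there both
    -- shape functions vanish, so the midpoint values still agree.
    by_cases hmid : midpoint ℝ x y ∈ Ω
    · exact hp.continuous_mid T hT T' hT' x y hxy hx.1 hy.1 hx'.1 hy'.1 hmid
    · have hfr : midpoint ℝ x y ∈ frontier Ω := by
        rw [M.isOpen.frontier_eq]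
        exact ⟨M.midpoint_mem_closure hT hx.1 hy.1, hmid⟩
      rw [hp0 T hT x hx.1 y hy.1 hxy hfr, hp0 T' hT' x hx'.1 y hy'.1 hxy hfr]
  · rw [hmean T hT P hP, M.faceMean_eq_zero_of_memH10 hT hP hb hwi, zero_add]
    refine (hp.shape T hT).faceMean_eq_zero (M.isTet hT) hP fun x hx y hy hxy => ?_
    refine hp0 T hT x hx.1 y hy.1 hxy ?_
    rw [M.isOpen.frontier_eq]
    refine ⟨M.midpoint_mem_closure hT hx.1 hy.1, M.notMem_of_boundary_face hT hP hb ?_⟩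
    exact (convex_convexHull ℝ _).midpoint_mem (subset_convexHull ℝ _ hx) (subset_convexHull ℝ _ hy)

/-- The interpolants of `v` may be integrated by parts globally. -/
lemma sum_faceVec_eq_zero {v : E3 → E3} (hv : M.MemWaddWh v) {q : E3 → ℝ} (hq : MemH1 Ω q) :
    ∑ T ∈ M.tets, ∑ P ∈ T, (bary T P).linear (faceVec T P v (compGrad T v))
      * faceInt T P q (weakGrad (cell T) q) = 0 := by
  have hfi : ∀ T ∈ M.tets, ∀ P, faceInt T P q (weakGrad (cell T) q)
      = vol T * (3 * faceMean T P q (weakGrad (cell T) q)) := by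
    intro T hT P
    have := (M.isTet hT).vol_pos
    rw [faceMean]; field_simp
  apply M.sum_faces_eq_zero
  · intro T hT T' hT' P hP P' hP' hne hF
    have e1 : faceVec T P v (compGrad T v) = faceVec T' P' v (compGrad T' v) := by
      ext i
      exact (component_properties hv i).2.1 T hT T' hT' P hP P' hP' hne hF
    have e2 := M.faceMean_eq_of_memH1 hT hT' hne hP hP' hF hq
    have e3 := M.vol_mul_linear hT hT' hne hP hP' hF (faceVec T' P' v (compGrad T' v))
    rw [hfi T hT, hfi T' hT', e1, e2]
    -- Once the means of `v` and `q` are identified across the face, the sum is a multiple of the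
    -- sum of opposite area vectors.
    linear_combination (3 * faceMean T' P' q (weakGrad (cell T') q)) * e3
  · intro T hT P hP hb
    have : faceVec T P v (compGrad T v) = 0 := by
      ext i
      exact (component_properties hv i).2.2 T hT P hP hb
    rw [this, map_zero, zero_mul]

lemma diam_le_meshSize (M : TetMesh Ω) (hT : T ∈ M.tets) :
    Metric.diam (convexHull ℝ (T : Set E3)) ≤ M.meshSize :=
  le_csSup ((M.tets.finite_toSet.image _).bddAbove) ⟨T, hT, rfl⟩

lemma meshSize_nonneg (M : TetMesh Ω) : 0 ≤ M.meshSize := by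
  apply Real.sSup_nonneg
  rintro _ ⟨T, _, rfl⟩
  exact Metric.diam_nonneg

/-- Disjoint subcells suffice for this inequality, so it need not be known that the faces are a null
set. -/
lemma sum_integral_cell_le (M : TetMesh Ω) {f : E3 → ℝ} (hf : IntegrableOn f Ω) (h0 : ∀ x, 0 ≤ f x) :
    ∑ T ∈ M.tets, ∫ x in cell T, f x ≤ ∫ x in Ω, f x := by
  rw [← integral_biUnion_finset M.tets (fun T _ => measurableSet_cell T)
    (fun T hT T' hT' hne => M.disjoint_cells hT hT' hne)
    (fun T hT => hf.mono_set (M.cell_subset hT))]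
  exact setIntegral_mono_set hf (Eventually.of_forall h0)
    (Eventually.of_forall (Set.iUnion₂_subset fun T hT => M.cell_subset hT))

/-! ### Summation of the cell estimates over the mesh -/

lemma integrable_compGrad {v w : E3 → E3} (hv : M.MemWaddWh v) (hw : M.MemWaddWh w)
    (hT : T ∈ M.tets) (i : Fin 3) :
    Integrable (fun x => inner ℝ (compGrad T v i x) (compGrad T w i x)) (cellMeasure T) :=
  integrable_inner ((component_properties hv i).1 T hT).2.1 ((component_properties hw i).1 T hT).2.1

lemma aForm_eq {v w : E3 → E3} (hv : M.MemWaddWh v) (hw : M.MemWaddWh w) :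
    M.aForm v w = ∑ T ∈ M.tets, ∑ i,
      ∫ x in cell T, inner ℝ (compGrad T v i x) (compGrad T w i x) :=
  Finset.sum_congr rfl fun _ hT =>
    integral_finsetSum _ fun i _ => integrable_compGrad hv hw hT i

lemma aNorm_eq {v : E3 → E3} (hv : M.MemWaddWh v) :
    M.aNorm v = Real.sqrt (∑ T ∈ M.tets, elemNorm T (compGrad T v) ^ 2) := by
  rw [aNorm, aForm_eq hv hv]
  congr 1
  refine Finset.sum_congr rfl fun T _ => ?_
  rw [elemNorm, Real.sq_sqrt (Finset.sum_nonneg fun i _ => sq_nonneg _)]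
  refine Finset.sum_congr rfl fun i _ => ?_
  rw [l2_sq]
  simp only [real_inner_self_eq_norm_sq]

lemma abs_aForm_le {v w : E3 → E3} (hv : M.MemWaddWh v) (hw : M.MemWaddWh w) :
    |M.aForm v w| ≤ M.aNorm v * M.aNorm w := by
  rw [aNorm_eq hv, aNorm_eq hw, aForm_eq hv hw]
  refine (Finset.abs_sum_le_sum_abs _ _).trans (le_trans (Finset.sum_le_sum fun T hT => ?_)
    (Real.sum_mul_le_sqrt_mul_sqrt _ _ _))
  refine (Finset.abs_sum_le_sum_abs _ _).trans (le_trans (Finset.sum_le_sum fun i _ => ?_)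
    (Real.sum_mul_le_sqrt_mul_sqrt _ (fun i => l2 (cellMeasure T) (compGrad T v i))
      (fun i => l2 (cellMeasure T) (compGrad T w i))))
  exact abs_integral_inner_le ((component_properties hv i).1 T hT).2.1
    ((component_properties hw i).1 T hT).2.1

/-- The face terms add up to zero over the mesh, so they are inserted cell by cell to make the local
estimate available; Cauchy-Schwarz over the cells then gives global norms with the same constant. -/
lemma abs_bForm_le {σ : ℝ} (hσ : M.ShapeRegular σ) {v : E3 → E3} {q : E3 → ℝ}
    (hv : M.MemWaddWh v) (hq : MemH1 Ω q) :
    |M.bForm v q| ≤ (9 + 24 * |σ|) *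
      (M.aNorm v * (normL2 Ω q + M.meshSize * normGrad Ω q)) := by
  have hgrad := hq.hasWeakGrad
  have hsum : M.bForm v q = -∑ T ∈ M.tets, ((∫ x in cell T, inner ℝ (v x) (weakGrad (cell T) q x))
      + ∑ P ∈ T, (bary T P).linear (faceVec T P v (compGrad T v))
        * faceInt T P q (weakGrad (cell T) q)) := by
    rw [Finset.sum_add_distrib, sum_faceVec_eq_zero hv hq, add_zero]; rfl
  set N : Finset E3 → ℝ := fun T => elemNorm T (compGrad T v)
  set κ : Finset E3 → ℝ := fun T => l2 (cellMeasure T) q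
  set γ : Finset E3 → ℝ := fun T => l2 (cellMeasure T) (weakGrad (cell T) q)
  have hloc : ∀ T ∈ M.tets, |(∫ x in cell T, inner ℝ (v x) (weakGrad (cell T) q x))
      + ∑ P ∈ T, (bary T P).linear (faceVec T P v (compGrad T v))
        * faceInt T P q (weakGrad (cell T) q)|
      ≤ (9 + 24 * |σ|) * (N T * κ T + M.meshSize * (N T * γ T)) := by
    intro T hT
    have hw := hgrad.mono (M.cell_subset hT)
    have hw' : HasWeakGrad (cell T) q (weakGrad (cell T) q) := MemH1.hasWeakGrad ⟨_, hw⟩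
    obtain ⟨c, ρ, hρ, hball, hdiam⟩ := hσ T hT
    refine ((M.isTet hT).local_estimate (fun i => (component_properties hv i).1 T hT)
      hw'.memLp_fun hw'.memLp_grad hρ hball hdiam).trans ?_
    have h1 := M.diam_le_meshSize hT
    have h2 : 0 ≤ N T := elemNorm_nonneg _ _
    have h3 : 0 ≤ γ T := l2_nonneg _
    have : N T * (κ T + Metric.diam (convexHull ℝ (T : Set E3)) * γ T)
        ≤ N T * κ T + M.meshSize * (N T * γ T) := by
      have := mul_le_mul_of_nonneg_right h1 (mul_nonneg h2 h3)
      linarith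
    gcongr
  have hκ : Real.sqrt (∑ T ∈ M.tets, κ T ^ 2) ≤ normL2 Ω q := by
    apply Real.sqrt_le_sqrt
    simp only [κ, l2_sq, Real.norm_eq_abs, sq_abs]
    exact M.sum_integral_cell_le hgrad.memLp_fun.integrable_sq fun x => sq_nonneg _
  have hγ : Real.sqrt (∑ T ∈ M.tets, γ T ^ 2) ≤ normGrad Ω q := by
    apply Real.sqrt_le_sqrt
    have e : ∀ T ∈ M.tets, γ T ^ 2 = ∫ x in cell T, ‖weakGrad Ω q x‖ ^ 2 := fun T hT => by
      simp only [γ]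
      rw [l2_congr (M.weakGrad_cell_ae hT hq), l2_sq]
    rw [Finset.sum_congr rfl e]
    exact M.sum_integral_cell_le hgrad.memLp_grad.norm.integrable_sq fun x => by positivity
  have hN : Real.sqrt (∑ T ∈ M.tets, N T ^ 2) = M.aNorm v := (aNorm_eq hv).symm
  have s1 : ∑ T ∈ M.tets, N T * κ T ≤ M.aNorm v * normL2 Ω q := by
    refine (Real.sum_mul_le_sqrt_mul_sqrt _ _ _).trans ?_
    rw [hN]
    exact mul_le_mul_of_nonneg_left hκ (Real.sqrt_nonneg _)
  have s2 : ∑ T ∈ M.tets, N T * γ T ≤ M.aNorm v * normGrad Ω q := by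
    refine (Real.sum_mul_le_sqrt_mul_sqrt _ _ _).trans ?_
    rw [hN]
    exact mul_le_mul_of_nonneg_left hγ (Real.sqrt_nonneg _)
  rw [hsum, abs_neg]
  calc _ ≤ ∑ T ∈ M.tets, (9 + 24 * |σ|) * (N T * κ T + M.meshSize * (N T * γ T)) :=
        (Finset.abs_sum_le_sum_abs _ _).trans (Finset.sum_le_sum hloc)
    _ = (9 + 24 * |σ|) * (∑ T ∈ M.tets, N T * κ T + M.meshSize * ∑ T ∈ M.tets, N T * γ T) := by
        rw [← Finset.mul_sum, Finset.sum_add_distrib, ← Finset.mul_sum]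
    _ ≤ (9 + 24 * |σ|) * (M.aNorm v * normL2 Ω q + M.meshSize * (M.aNorm v * normGrad Ω q)) := by
        have := M.meshSize_nonneg
        gcongr
    _ = _ := by ring

lemma le_tripleNorm (M : TetMesh Ω) (v : E3 → E3) (q : E3 → ℝ) :
    M.aNorm v ≤ M.tripleNorm v q ∧ normL2 Ω q ≤ M.tripleNorm v q ∧
      M.meshSize * normGrad Ω q ≤ M.tripleNorm v q := by
  have h1 := sq_nonneg (M.aNorm v)
  have h2 := sq_nonneg (normL2 Ω q)
  have h3 := sq_nonneg (M.meshSize * normGrad Ω q)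
  refine ⟨Real.le_sqrt_of_sq_le ?_, Real.le_sqrt_of_sq_le ?_, Real.le_sqrt_of_sq_le ?_⟩ <;>
    rw [← mul_pow] <;> linarith

end TetMesh

end

end

end RotatedQ1

/-! ### Continuity of both forms -/

theorem mainTheorem6 (σ : ℝ) :
    ∃ C : ℝ, 0 < C ∧ ∀ (Ω : Set RotatedQ1.E3) (M : RotatedQ1.TetMesh Ω), M.ShapeRegular σ →
      (∀ (v : RotatedQ1.E3 → RotatedQ1.E3) (q : RotatedQ1.E3 → ℝ),
        M.MemWaddWh v → RotatedQ1.MemQ Ω q → RotatedQ1.MemH1 Ω q →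
          |M.bForm v q| ≤
            C * (M.aNorm v *
              (RotatedQ1.normL2 Ω q + M.meshSize * RotatedQ1.normGrad Ω q))) ∧
      (∀ (v w : RotatedQ1.E3 → RotatedQ1.E3) (q r : RotatedQ1.E3 → ℝ),
        M.MemWaddWh v → M.MemWaddWh w →
        RotatedQ1.MemQ Ω q → RotatedQ1.MemH1 Ω q →
        RotatedQ1.MemQ Ω r → RotatedQ1.MemH1 Ω r →
          |M.AForm v q w r| ≤ C * (M.tripleNorm v q * M.tripleNorm w r)) := by
  set C₀ : ℝ := 9 + 24 * |σ| with hC₀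
  have hC₀pos : 0 ≤ C₀ := by positivity
  -- `a_h` contributes 1. Each of the two `b` terms contributes `2 * C₀`, since both summands of its
  -- pressure factor are bounded by the triple norm.
  refine ⟨1 + 4 * C₀, by positivity, fun Ω M hσ => ⟨fun v q hv _ hq => ?_,
    fun v w q r hv hw _ hq _ hr => ?_⟩⟩
  · refine (RotatedQ1.TetMesh.abs_bForm_le hσ hv hq).trans
      (mul_le_mul_of_nonneg_right ?_ (mul_nonneg (Real.sqrt_nonneg _) (add_nonneg
        (Real.sqrt_nonneg _) (mul_nonneg M.meshSize_nonneg (Real.sqrt_nonneg _)))))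
    change C₀ ≤ 1 + 4 * C₀
    linarith
  · have ha := RotatedQ1.TetMesh.abs_aForm_le hv hw
    have hb := RotatedQ1.TetMesh.abs_bForm_le hσ hv hr
    have hb' := RotatedQ1.TetMesh.abs_bForm_le hσ hw hq
    obtain ⟨v1, q1, q2⟩ := M.le_tripleNorm v q
    obtain ⟨w1, r1, r2⟩ := M.le_tripleNorm w r
    have hv0 : 0 ≤ M.aNorm v := Real.sqrt_nonneg _
    have hw0 : 0 ≤ M.aNorm w := Real.sqrt_nonneg _
    have hX : 0 ≤ M.tripleNorm v q := Real.sqrt_nonneg _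
    have hY : 0 ≤ M.tripleNorm w r := Real.sqrt_nonneg _
    set X := M.tripleNorm v q
    set Y := M.tripleNorm w r
    have hs : ∀ q : RotatedQ1.E3 → ℝ, 0 ≤ RotatedQ1.normL2 Ω q + M.meshSize * RotatedQ1.normGrad Ω q :=
      fun q => add_nonneg (Real.sqrt_nonneg _) (mul_nonneg M.meshSize_nonneg (Real.sqrt_nonneg _))
    have b1 : |M.bForm v r| ≤ C₀ * (X * (Y + Y)) := hb.trans (by have := hs r; gcongr)
    have b2 : |M.bForm w q| ≤ C₀ * (Y * (X + X)) := hb'.trans (by have := hs q; gcongr)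
    have b3 : |M.aForm v w| ≤ X * Y := ha.trans (by gcongr)
    have htri : |M.AForm v q w r| ≤ |M.aForm v w| + |M.bForm v r| + |M.bForm w q| :=
      (abs_add_le _ _).trans (by gcongr; exact abs_sub _ _)
    linarith
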